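/- **Setting.** Let $\tilde{\mathcal A}=\{\sum_{\nu\ge 0}P_\nu(a)\,b^\nu : P_\nu\in\mathbb C[x]\}$ be the $\mathbb C$-algebra with $ab-ba=b^2$ and with left and right multiplication by $a$ continuous for the $b$-adic filtration; it contains $\mathbb C[[b]]$. For $\lambda\in\mathbb Q\cap\,]0,1]$ and $N\in\mathbb N$ let $\Xi_\lambda^{(N)}=\bigoplus_{j=0}^N\mathbb C[[s]]\,s^{\lambda-1}(\mathrm{Log}\, s)^j$, where $a$ acts as multiplication by $s$ and $b$ as the primitive in $s$ without constant; put $\Xi_\lambda=\sum_N\Xi_\lambda^{(N)}$ and $\Xi_\Lambda^{(N)}=\bigoplus_{\lambda\in\Lambda}\Xi_\lambda^{(N)}$ for finite $\Lambda\subset\mathbb Q\cap\,]0,1]$. A *fresco* is a left $\tilde{\mathcal A}$-module isomorphic to $\tilde{\mathcal A}\varphi\subset\Xi_\Lambda^{(N)}\otimes_{\mathbb C}V$ for some $\Lambda$, $N$, some finite dimensional complex vector space $V$ and some $\varphi$, where $\tilde{\mathcal A}$ acts on the left factor; it is a *theme* if one may take $V=\mathbb C$. An *(a,b)-module* is an $\tilde{\mathcal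 A}$-module which is free of finite rank over $\mathbb C[[b]]$; *rank* means the rank over $\mathbb C[[b]]$. It has a *simple pole* if $aE\subset bE$, and then its Bernstein polynomial is the minimal polynomial of $-b^{-1}a$ on $E/bE$. It is *regular* if it embeds in a simple pole (a,b)-module; its Bernstein polynomial is then that of its saturation by $b^{-1}a$, i.e. of the minimal simple pole (a,b)-module containing it. A regular (a,b)-module is *$[\lambda]$-primitive* if all roots of its Bernstein polynomial lie in $-\lambda+\mathbb Z$. A submodule $F\subset E$ is *normal* if $F\cap bE=bF$. An (a,b)-module is *semi-simple* if it is isomorphic to a submodule of a finite direct sum of regular (a,b)-modules of rank $1$. For a regular (a,b)-module $E$, the elements $x$ with $\tilde{\mathcal A}x$ semi-simple form a normal submodule $S_1(E)$; put $S_0(E)=0$ and let $S_{j}(E)$ be the pull-back to $E$ of $S_1(E/S_{j-1}(E))$. The *semi-simple depth* $d(E)$ is the smallest $d$ with $S_d(E)=E$. **Proposition.** Let $E$ be a fresco. Below, "$[\lambda]$-primitive" means $[\lambda]$-primitive for some $\lambda\in\mathbb Q\cap\,]0,1]$. 1. Every submodule of $E$ which is a $[\lambda]$-primitive theme of rank $j$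 is contained in $S_j(E)$. 2. For every $j\in\mathbb N$, every quotient of $S_j(E)$ which is a $[\lambda]$-primitive theme has rank at most $j$. 3. For every $\lambda\in\mathbb Q\cap\,]0,1]$ and every $\varphi\in\mathrm{Hom}_{\tilde{\mathcal A}}(E,\Xi_\lambda)$ the image $\varphi(E)$ is a $[\lambda]$-primitive theme; for $j\in\mathbb N$, let $F_j(\varphi)$ be its normal submodule of rank $j$, with $F_j(\varphi)=\varphi(E)$ if the rank of $\varphi(E)$ is at most $j$; it exists and is unique. Then for every $j\in\mathbb N$ $$S_j(E)=\bigcap_{\lambda}\ \bigcap_{\varphi\in\mathrm{Hom}_{\tilde{\mathcal A}}(E,\Xi_\lambda)}\varphi^{-1}\big(F_j(\varphi)\big).$$ 4. The semi-simple depth is well defined, i.e. $S_{d(E)}(E)=E$; and for every $d\in\mathbb N$ one has $d(E)=d$ if and only if $d$ is the maximal rank of a quotient of $E$ which is a $[\lambda]$-primitive theme. 5. For every $d\in\mathbb N$ one has $d(E)=d$ if and only if $d$ is the maximal rank of a normal submodule of $E$ which is a $[\lambda]$-primitive theme. -/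

import Mathlib

open scoped Polynomial PowerSeries TensorProduct

noncomputable section

namespace FrescoTheory

/-! ## Operators `∑ P_ν(A) B^ν` on spaces of sequences -/

section Operators

variable {P : Type*} [AddCommGroup P] [Module ℂ P]

/-- `act A B u f = ∑_ν u_ν(A) (B^ν f)`. The sum makes sense as soon as `A` does not lower, and `B`
strictly raises, the order of vanishing of a sequence: then the terms with `ν > n` do not
contribute to the entry of index `n`. -/
def act (A B : Module.End ℂ (ℕ → P)) (u : ℕ → ℂ[X]) (f : ℕ → P) : ℕ → P :=
  fun n => ∑ ν ∈ Finset.range (n + 1), (Polynomial.aeval A (u ν) ((B ^ ν) f)) n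

/-- The conditions on the pair `(A, B)`: orders of vanishing, and `A B - B A = B ^ 2`. -/
structure Good (A B : Module.End ℂ (ℕ → P)) : Prop where
  ordA : ∀ (N : ℕ) (f : ℕ → P), (∀ i < N, f i = 0) → ∀ i < N, A f i = 0
  ordB : ∀ (N : ℕ) (f : ℕ → P), (∀ i < N, f i = 0) → ∀ i < N + 1, B f i = 0
  comm : A * B = B * A + B * B

/-- Left multiplication by `b` on series `∑ v_ν(a) b^ν`, determined by
`b Q(a) = Q(a) b - b Q'(a) b`. -/
def lbFun (v : ℕ → ℂ[X]) : ℕ → ℂ[X]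
  | 0 => 0
  | n + 1 => v n - Polynomial.derivative (lbFun v n)

/-- `lbFun` as a linear map. -/
def lb : Module.End ℂ (ℕ → ℂ[X]) where
  toFun := lbFun
  map_add' u v := by
    funext n
    induction n with
    | zero => simp [lbFun]
    | succ n ih =>
      simp only [lbFun, Pi.add_apply] at ih ⊢
      rw [ih, Polynomial.derivative_add]; ring
  map_smul' c v := by
    funext n
    induction n with
    | zero => simp [lbFun]
    | succ n ih =>
      simp only [lbFun, Pi.smul_apply, RingHom.id_apply] at ih ⊢
      rw [ih, Polynomial.derivative_smul, smul_sub]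

/-- Left multiplication by `a` on series `∑ v_ν(a) b^ν`. -/
def la : Module.End ℂ (ℕ → ℂ[X]) where
  toFun v := fun n => Polynomial.X * v n
  map_add' u v := by funext n; simp [mul_add]
  map_smul' c v := by funext n; simp

lemma lb_zero (v : ℕ → ℂ[X]) : lb v 0 = 0 := rfl

lemma lb_succ (v : ℕ → ℂ[X]) (n : ℕ) :
    lb v (n + 1) = v n - Polynomial.derivative (lb v n) := rfl

lemma la_apply (v : ℕ → ℂ[X]) (n : ℕ) : la v n = Polynomial.X * v n := rfl

lemma good_regular : Good la lb where
  ordA N f h i hi := by simp [la_apply, h i hi]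
  ordB N f h i hi := by
    induction i with
    | zero => exact lb_zero f
    | succ i ih => rw [lb_succ, ih (by omega), h i (by omega)]; simp
  comm := by
    refine LinearMap.ext fun v => funext fun n => ?_
    induction n with
    | zero => simp [lb_zero, la_apply]
    | succ n ih =>
      simp only [Module.End.mul_apply, LinearMap.add_apply, Pi.add_apply, la_apply, lb_succ]
        at ih ⊢
      have h := congrArg Polynomial.derivative ih
      simp only [Polynomial.derivative_mul, Polynomial.derivative_X, Polynomial.derivative_add,
        one_mul] at h
      linear_combination (-1 : ℂ[X]) * h

variable {A B : Module.End ℂ (ℕ → P)}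

lemma act_add_left (u v : ℕ → ℂ[X]) (f : ℕ → P) : act A B (u + v) f = act A B u f + act A B v f := by
  funext n
  simp [act, Finset.sum_add_distrib]

lemma act_add_right (u : ℕ → ℂ[X]) (f g : ℕ → P) : act A B u (f + g) = act A B u f + act A B u g := by
  funext n
  simp [act, Finset.sum_add_distrib]

lemma act_zero_left (f : ℕ → P) : act A B 0 f = 0 := by
  funext n
  simp [act]

lemma act_zero_right (u : ℕ → ℂ[X]) : act A B u 0 = 0 := by
  funext n
  simp [act]

lemma act_sum_left {ι : Type*} (s : Finset ι) (u : ι → ℕ → ℂ[X]) (f : ℕ → P) :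
    act A B (∑ i ∈ s, u i) f = ∑ i ∈ s, act A B (u i) f := by
  classical
  induction s using Finset.induction_on with
  | empty => simp [act_zero_left]
  | insert i s hi ih => rw [Finset.sum_insert hi, Finset.sum_insert hi, act_add_left, ih]

lemma act_single (p : ℂ[X]) (f : ℕ → P) : act A B (Pi.single 0 p) f = Polynomial.aeval A p f := by
  funext n
  rw [act, Finset.sum_eq_single 0]
  · simp
  · intro ν _ hν
    simp [Pi.single_eq_of_ne hν]
  · simp

/-- The truncated sum agrees with the action in low degree. -/
lemma Good.ordPow (h : Good A B) (f : ℕ → P) (ν : ℕ) : ∀ i < ν, (B ^ ν) f i = 0 := by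
  induction ν with
  | zero => intro i hi; omega
  | succ ν ih => rw [pow_succ']; exact h.ordB ν _ ih

lemma Good.ordPoly (h : Good A B) (p : ℂ[X]) (N : ℕ) (f : ℕ → P) (hf : ∀ i < N, f i = 0) :
    ∀ i < N, Polynomial.aeval A p f i = 0 := by
  induction p using Polynomial.induction_on' with
  | add p q hp hq => intro i hi; simp [hp i hi, hq i hi]
  | monomial n c =>
    have key : ∀ i < N, (A ^ n) f i = 0 := by
      induction n with
      | zero => simpa using hf
      | succ n ih => rw [pow_succ']; exact h.ordA N _ ih
    intro i hi
    simp [Polynomial.aeval_monomial, key i hi]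

lemma Good.act_trunc (h : Good A B) (u : ℕ → ℂ[X]) (f : ℕ → P) (N : ℕ) :
    ∀ i < N, act A B u f i =
      (∑ ν ∈ Finset.range N, Polynomial.aeval A (u ν) ((B ^ ν) f)) i := by
  intro i hi
  rw [Finset.sum_apply, act]
  refine Finset.sum_subset (by intro x; simp; omega) ?_
  intro ν _ hν
  have : i < ν := by simpa using hν
  exact h.ordPoly _ ν _ (h.ordPow f ν) i this

lemma Good.act_la (h : Good A B) (u : ℕ → ℂ[X]) (f : ℕ → P) :
    act A B (la u) f = A (act A B u f) := by
  funext n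
  have h1 := h.ordA (n + 1)
    (act A B u f - ∑ ν ∈ Finset.range (n + 1), Polynomial.aeval A (u ν) ((B ^ ν) f))
    (fun i hi => by rw [Pi.sub_apply, h.act_trunc u f (n + 1) i hi, sub_self]) n (by omega)
  rw [map_sub, Pi.sub_apply, sub_eq_zero] at h1
  rw [h1, map_sum, Finset.sum_apply, act]
  refine Finset.sum_congr rfl fun ν _ => ?_
  simp [la_apply]

lemma Good.comm_poly (h : Good A B) (p : ℂ[X]) :
    B * Polynomial.aeval A p =
      Polynomial.aeval A p * B - B * Polynomial.aeval A (Polynomial.derivative p) * B := by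
  induction p using Polynomial.induction_on with
  | C c => simp [Algebra.commutes]
  | add p q hp hq => simp only [map_add, mul_add, add_mul, hp, hq]; abel
  | monomial n c ih =>
    have e : Polynomial.C c * Polynomial.X ^ (n + 1) =
        Polynomial.X * (Polynomial.C c * Polynomial.X ^ n) := by ring
    rw [e]
    generalize Polynomial.C c * Polynomial.X ^ n = p at ih
    simp only [Polynomial.derivative_mul, Polynomial.derivative_X, one_mul, map_add, map_mul,
      Polynomial.aeval_X]
    generalize Polynomial.aeval A p = Q at ih
    generalize Polynomial.aeval A (Polynomial.derivative p) = Q' at ih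
    have hBA : B * A = A * B - B * B := by rw [h.comm]; abel
    calc B * (A * Q) = (B * A) * Q := by rw [mul_assoc]
      _ = A * (B * Q) - B * (B * Q) := by rw [hBA, sub_mul, mul_assoc, mul_assoc]
      _ = A * (Q * B - B * Q' * B) - B * (Q * B - B * Q' * B) := by rw [ih]
      _ = A * Q * B - (A * B - B * B) * Q' * B - B * Q * B := by
        simp only [mul_sub, sub_mul, mul_assoc]; abel
      _ = A * Q * B - (B * A) * Q' * B - B * Q * B := by rw [hBA]
      _ = A * Q * B - B * (Q + A * Q') * B := by
        simp only [mul_add, add_mul, mul_assoc]; abel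

lemma Good.lb_telescope (h : Good A B) (u : ℕ → ℂ[X]) (N : ℕ) :
    B * (∑ ν ∈ Finset.range (N + 1), Polynomial.aeval A (u ν) * B ^ ν) =
      (∑ ν ∈ Finset.range (N + 1), Polynomial.aeval A (lb u ν) * B ^ ν) +
        B * Polynomial.aeval A (lb u (N + 1)) * B ^ N := by
  induction N with
  | zero => simp [lb_succ, lb_zero]
  | succ N ih =>
    rw [Finset.sum_range_succ, mul_add, ih, Finset.sum_range_succ _ (N + 1)]
    have hu : u (N + 1) = lb u (N + 2) + Polynomial.derivative (lb u (N + 1)) := by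
      rw [lb_succ u (N + 1)]; ring
    have hc := h.comm_poly (lb u (N + 1))
    rw [hu, map_add, pow_succ']
    generalize Polynomial.aeval A (lb u (N + 1)) = Q at hc ⊢
    generalize Polynomial.aeval A (Polynomial.derivative (lb u (N + 1))) = Q' at hc ⊢
    generalize Polynomial.aeval A (lb u (N + 2)) = R
    rw [hc]
    simp only [mul_add, add_mul, sub_mul, mul_assoc]
    abel

lemma Good.act_lb (h : Good A B) (u : ℕ → ℂ[X]) (f : ℕ → P) :
    act A B (lb u) f = B (act A B u f) := by
  funext n
  have h1 := h.ordB (n + 1)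
    (act A B u f - ∑ ν ∈ Finset.range (n + 1), Polynomial.aeval A (u ν) ((B ^ ν) f))
    (fun i hi => by rw [Pi.sub_apply, h.act_trunc u f (n + 1) i hi, sub_self]) n (by omega)
  rw [map_sub, Pi.sub_apply, sub_eq_zero] at h1
  have h2 := congrFun (LinearMap.congr_fun (h.lb_telescope u n) f) n
  simp only [Module.End.mul_apply, LinearMap.add_apply, LinearMap.sum_apply, Pi.add_apply,
    Finset.sum_apply] at h2
  rw [h1, h2, h.ordB n _ (h.ordPoly _ n _ (h.ordPow f n)) n (by omega), add_zero]
  rfl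

lemma Good.act_act (h : Good A B) (u v : ℕ → ℂ[X]) (f : ℕ → P) :
    act A B (act la lb u v) f = act A B u (act A B v f) := by
  have hpow : ∀ (ν : ℕ) (w : ℕ → ℂ[X]), act A B ((lb ^ ν) w) f = (B ^ ν) (act A B w f) := by
    intro ν
    induction ν with
    | zero => intro w; rfl
    | succ ν ih => intro w; rw [pow_succ, pow_succ, Module.End.mul_apply, Module.End.mul_apply, ih,
        h.act_lb]
  have hsmul : ∀ (c : ℂ) (w : ℕ → ℂ[X]), act A B (c • w) f = c • act A B w f := by
    intro c w
    funext n
    simp [act, Finset.smul_sum]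
  have hpoly : ∀ (p : ℂ[X]) (w : ℕ → ℂ[X]),
      act A B (Polynomial.aeval la p w) f = Polynomial.aeval A p (act A B w f) := by
    intro p
    induction p using Polynomial.induction_on with
    | C c => intro w; simp [hsmul, Module.algebraMap_end_apply]
    | add p q hp hq => intro w; simp [act_add_left, hp, hq]
    | monomial n c ih =>
      intro w
      have e : Polynomial.C c * Polynomial.X ^ (n + 1) =
        (Polynomial.C c * Polynomial.X ^ n) * Polynomial.X := by ring
      rw [e]
      generalize Polynomial.C c * Polynomial.X ^ n = q at ih
      rw [map_mul, map_mul, Module.End.mul_apply, Module.End.mul_apply, ih,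
        Polynomial.aeval_X, Polynomial.aeval_X, h.act_la]
  funext n
  have h1 : act A B (act la lb u v) f n =
      act A B (∑ ν ∈ Finset.range (n + 1), Polynomial.aeval la (u ν) ((lb ^ ν) v)) f n := by
    simp only [act]
    refine Finset.sum_congr rfl fun ν hν => ?_
    rw [← good_regular.act_trunc u v (n + 1) ν (by simpa using hν)]
    rfl
  rw [h1, act_sum_left, Finset.sum_apply, act]
  refine Finset.sum_congr rfl fun ν _ => ?_
  rw [hpoly, hpow]

lemma aeval_la (p : ℂ[X]) (v : ℕ → ℂ[X]) (n : ℕ) : Polynomial.aeval la p v n = p * v n := by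
  induction p using Polynomial.induction_on with
  | C c => simp [Module.algebraMap_end_apply, Polynomial.smul_eq_C_mul]
  | add p q hp hq => simp [hp, hq, add_mul]
  | monomial k c ih =>
    have e : Polynomial.C c * Polynomial.X ^ (k + 1) =
      Polynomial.X * (Polynomial.C c * Polynomial.X ^ k) := by ring
    rw [e, map_mul, Module.End.mul_apply, Polynomial.aeval_X, la_apply, ih]
    ring

/-- On series with constant coefficients, left multiplication by `b` is a shift. -/
lemma lb_pow_const (c : ℕ → ℂ) (ν n : ℕ) :
    (lb ^ ν) (fun n => Polynomial.C (c n)) n =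
      Polynomial.C (if ν ≤ n then c (n - ν) else 0) := by
  induction ν generalizing n with
  | zero => simp
  | succ ν ih =>
    rw [pow_succ', Module.End.mul_apply]
    cases n with
    | zero => simp [lb_zero]
    | succ n =>
      have : ∀ m, Polynomial.derivative
          (lb ((lb ^ ν) (fun n => Polynomial.C (c n))) m) = 0 := by
        intro m
        induction m with
        | zero => simp [lb_zero]
        | succ m ihm => rw [lb_succ, ihm, ih]; simp
      rw [lb_succ, this, ih]
      simp

lemma act_regular_one (u : ℕ → ℂ[X]) : act la lb u (Pi.single 0 1) = u := by
  have e : (Pi.single 0 1 : ℕ → ℂ[X]) =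
      fun n => Polynomial.C ((Pi.single 0 1 : ℕ → ℂ) n) := by
    funext n
    cases n <;> simp
  funext n
  rw [act, Finset.sum_eq_single n]
  · rw [aeval_la, e, lb_pow_const]; simp
  · intro ν hν hn
    have : ν < n := by
      have := Finset.mem_range.1 hν
      omega
    rw [aeval_la, e, lb_pow_const, if_pos this.le, Pi.single_eq_of_ne (by omega)]
    simp
  · simp

end Operators

/-! ## The algebra -/

/-- The algebra `Ã` of series `∑_ν P_ν(a) b^ν` with `P_ν ∈ ℂ[x]`, given by the sequence of the
`P_ν`. -/
def Atilde : Type := ℕ → ℂ[X]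

namespace Atilde

instance : AddCommGroup Atilde := inferInstanceAs (AddCommGroup (ℕ → ℂ[X]))

/-- The element `P(a)`. -/
def poly (p : ℂ[X]) : Atilde := (Pi.single 0 p : ℕ → ℂ[X])

instance : One Atilde := ⟨poly 1⟩

/-- `(∑ P_ν(a) b^ν) * v = ∑ P_ν(a) (b^ν v)`, with left multiplication by `b` as in `lb`. -/
instance : Mul Atilde := ⟨fun u v => act la lb u v⟩

lemma mul_def (u v : Atilde) : u * v = act la lb u v := rfl

instance : Ring Atilde :=
  { (inferInstance : AddCommGroup Atilde) with
    one := 1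
    mul := (· * ·)
    left_distrib := fun u v w => act_add_right u v w
    right_distrib := fun u v w => act_add_left u v w
    zero_mul := fun u => act_zero_left u
    mul_zero := fun u => act_zero_right u
    mul_assoc := fun u v w => good_regular.act_act u v w
    one_mul := fun u => by
      refine (act_single (A := la) (B := lb) (1 : ℂ[X]) u).trans ?_
      rw [map_one]
      rfl
    mul_one := fun u => act_regular_one u }

/-- The generator `a`. -/
def a : Atilde := poly Polynomial.X

/-- The generator `b`. -/
def b : Atilde := (Pi.single 1 1 : ℕ → ℂ[X])

/-- The inclusion of `ℂ[[b]]` into `Ã`. -/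
def ofPowerSeries : ℂ⟦X⟧ →+* Atilde where
  toFun S := fun n => Polynomial.C (PowerSeries.coeff n S)
  map_one' := by
    funext n
    change _ = (Pi.single 0 1 : ℕ → ℂ[X]) n
    cases n <;> simp [PowerSeries.coeff_one]
  map_zero' := by funext n; simp; rfl
  map_add' S T := by funext n; simp; rfl
  map_mul' S T := by
    funext n
    change _ = act la lb _ _ n
    rw [PowerSeries.coeff_mul, act, Finset.Nat.sum_antidiagonal_eq_sum_range_succ
      (fun i j => PowerSeries.coeff i S * PowerSeries.coeff j T), map_sum]
    refine Finset.sum_congr rfl fun ν hν => ?_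
    rw [aeval_la, lb_pow_const, if_pos (by have := Finset.mem_range.1 hν; omega),
      Polynomial.C_mul]

/-- The inclusion of the constants. -/
def ofComplex : ℂ →+* Atilde := ofPowerSeries.comp (PowerSeries.C)

lemma ofComplex_eq (c : ℂ) : ofComplex c = poly (Polynomial.C c) := by
  funext n
  change Polynomial.C (PowerSeries.coeff n (PowerSeries.C c)) =
    (Pi.single 0 (Polynomial.C c) : ℕ → ℂ[X]) n
  cases n <;> simp [PowerSeries.coeff_C]

instance : Algebra ℂ Atilde :=
  ofComplex.toAlgebra' fun c u => by
    rw [ofComplex_eq]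
    have h1 : poly (Polynomial.C c) * u = c • (show ℕ → ℂ[X] from u) := by
      refine (act_single (A := la) (B := lb) _ u).trans ?_
      rw [Polynomial.aeval_C]
      rfl
    have h2 : ∀ v : ℕ → ℂ[X], act la lb v (Pi.single 0 (Polynomial.C c)) = c • v := by
      intro v
      have e : (Pi.single 0 (Polynomial.C c) : ℕ → ℂ[X]) = c • Pi.single 0 1 := by
        funext n
        cases n <;> simp [Polynomial.smul_eq_C_mul]
      have h3 : act la lb v (c • Pi.single 0 1) = c • act la lb v (Pi.single 0 1) := by
        funext n
        simp [act, Finset.smul_sum]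
      rw [e, h3, act_regular_one]
    exact h1.trans (h2 u).symm

lemma algebraMap_eq (c : ℂ) : algebraMap ℂ Atilde c = poly (Polynomial.C c) := ofComplex_eq c

/-- The commutation relation. -/
lemma a_mul_b_sub : a * b - b * a = b ^ 2 := by
  have hb : ∀ v : ℕ → ℂ[X], act la lb (Pi.single 1 1) v = lb v := by
    intro v
    have : (Pi.single 1 1 : ℕ → ℂ[X]) = lb (Pi.single 0 1) := by
      have e : (Pi.single 0 1 : ℕ → ℂ[X]) =
          fun n => Polynomial.C ((Pi.single 0 1 : ℕ → ℂ) n) := by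
        funext n
        cases n <;> simp
      funext n
      have := lb_pow_const (Pi.single 0 1) 1 n
      rw [pow_one, ← e] at this
      rw [this]
      rcases n with _ | _ | n <;> simp
    rw [this, good_regular.act_lb, act_single]
    simp
  have ha : ∀ v : ℕ → ℂ[X], act la lb (Pi.single 0 Polynomial.X) v = la v := by
    intro v
    rw [act_single, Polynomial.aeval_X]
  have hX : (Pi.single 0 Polynomial.X : ℕ → ℂ[X]) = la (Pi.single 0 1) := by
    funext n
    cases n <;> simp [la_apply]
  have h1 : (Pi.single 1 1 : ℕ → ℂ[X]) = lb (Pi.single 0 1) := by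
    rw [← hb, act_regular_one]
  have key := LinearMap.congr_fun good_regular.comm (Pi.single 0 1)
  simp only [Module.End.mul_apply, LinearMap.add_apply] at key
  rw [sub_eq_iff_eq_add, pow_two]
  change act la lb (Pi.single 0 Polynomial.X) (Pi.single 1 1) =
    act la lb (Pi.single 1 1) (Pi.single 1 1) +
      act la lb (Pi.single 1 1) (Pi.single 0 Polynomial.X)
  rw [ha, hb, hb, hX, h1, key, add_comm]

end Atilde

/-! ## Asymptotic expansions -/

/-- The exponents `λ ∈ ℚ ∩ ]0, 1]`. -/
abbrev Expo : Type := Set.Ioc (0 : ℚ) 1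

/-- Formal expansions `∑_{n ≥ 0} s^{λ-1+n} f_n(Log s)` with `f_n ∈ ℂ[x]`, given by the sequence of
the `f_n`; the degrees of the `f_n` need not be bounded. -/
def Expansion (_l : Expo) : Type := ℕ → ℂ[X]

namespace Expansion

variable (l : Expo)

instance : AddCommGroup (Expansion l) := inferInstanceAs (AddCommGroup (ℕ → ℂ[X]))

/-- Multiplication by `s`. -/
def mulS : Module.End ℂ (ℕ → ℂ[X]) where
  toFun f := fun n => if n = 0 then 0 else f (n - 1)
  map_add' f g := by funext n; by_cases h : n = 0 <;> simp [h]
  map_smul' c f := by funext n; by_cases h : n = 0 <;> simp [h]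

/-- For `μ ≠ 0` and a polynomial `p`, the polynomial `q = ∑_i (-1)^i μ^{-i-1} p^{(i)}`; it is the
solution of `μ q + q' = p`, so that `s^μ q(Log s)` is a primitive of `s^{μ-1} p(Log s)`. -/
def primPoly (μ : ℂ) (p : ℂ[X]) : ℂ[X] :=
  ∑ i ∈ Finset.range (p.natDegree + 1),
    ((-1) ^ i * (μ⁻¹) ^ (i + 1)) • (Polynomial.derivative^[i] p)

lemma primPoly_eq {μ : ℂ} {p : ℂ[X]} {N : ℕ} (h : p.natDegree < N) :
    primPoly μ p = ∑ i ∈ Finset.range N,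
      ((-1) ^ i * (μ⁻¹) ^ (i + 1)) • (Polynomial.derivative^[i] p) := by
  refine Finset.sum_subset (by intro x; simp; omega) ?_
  intro i _ hi
  rw [Polynomial.iterate_derivative_eq_zero (by simpa using hi), smul_zero]

lemma primPoly_spec {μ : ℂ} (hμ : μ ≠ 0) (p : ℂ[X]) :
    μ • primPoly μ p + Polynomial.derivative (primPoly μ p) = p := by
  have key : ∀ N : ℕ, μ • (∑ i ∈ Finset.range N,
      ((-1) ^ i * (μ⁻¹) ^ (i + 1)) • (Polynomial.derivative^[i] p)) +
      Polynomial.derivative (∑ i ∈ Finset.range N,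
      ((-1) ^ i * (μ⁻¹) ^ (i + 1)) • (Polynomial.derivative^[i] p)) =
      p - ((-1) ^ N * (μ⁻¹) ^ N) • (Polynomial.derivative^[N] p) := by
    intro N
    induction N with
    | zero => simp
    | succ N ih =>
      rw [Finset.sum_range_succ, smul_add, Polynomial.derivative_add, add_add_add_comm, ih,
        Polynomial.derivative_smul, ← Function.iterate_succ_apply' Polynomial.derivative N p, smul_smul]
      have e : μ * ((-1) ^ N * (μ⁻¹) ^ (N + 1)) = (-1) ^ N * (μ⁻¹) ^ N := by
        rw [pow_succ]; field_simp
      rw [e, pow_succ (-1 : ℂ) N, mul_neg_one, neg_mul, neg_smul]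
      abel
  have := key (p.natDegree + 1)
  rw [Polynomial.iterate_derivative_eq_zero (Nat.lt_succ_self _), smul_zero, sub_zero] at this
  exact this

/-- A polynomial `q` with `μ q + q' = 0` vanishes, for `μ ≠ 0`. -/
lemma eq_zero_of_spec {μ : ℂ} (hμ : μ ≠ 0) {q : ℂ[X]}
    (h : μ • q + Polynomial.derivative q = 0) : q = 0 := by
  by_contra hq
  have h1 := congrArg (fun r => Polynomial.coeff r q.natDegree) h
  simp only [Polynomial.coeff_add, Polynomial.coeff_smul, Polynomial.coeff_derivative,
    Polynomial.coeff_eq_zero_of_natDegree_lt (Nat.lt_succ_self _), smul_eq_mul, zero_mul, add_zero,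
    Polynomial.coeff_zero] at h1
  rcases mul_eq_zero.1 h1 with h2 | h2
  · exact hμ h2
  · exact hq (Polynomial.leadingCoeff_eq_zero.1 h2)

lemma eq_of_spec {μ : ℂ} (hμ : μ ≠ 0) {q r : ℂ[X]}
    (h : μ • q + Polynomial.derivative q = μ • r + Polynomial.derivative r) : q = r := by
  refine sub_eq_zero.1 (eq_zero_of_spec hμ ?_)
  rw [smul_sub, Polynomial.derivative_sub]
  linear_combination h

lemma expo_ne_zero (n : ℕ) : (((l.1 : ℚ) : ℂ) + n) ≠ 0 := by
  have h : (0 : ℚ) < l.1 + n := by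
    have := l.2.1
    positivity
  have h2 : ((l.1 + n : ℚ) : ℂ) ≠ 0 := by exact_mod_cast h.ne'
  simpa using h2

/-- The primitive in `s` without constant term. -/
def prim : Module.End ℂ (ℕ → ℂ[X]) where
  toFun f := fun n =>
    if n = 0 then 0 else primPoly (((l.1 : ℚ) : ℂ) + ((n - 1 : ℕ) : ℂ)) (f (n - 1))
  map_add' f g := by
    funext n
    by_cases h : n = 0
    · simp [h]
    · simp only [h, if_false, Pi.add_apply]
      have hμ := expo_ne_zero l (n - 1)
      refine eq_of_spec hμ ?_
      have h1 := primPoly_spec hμ (f (n - 1))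
      have h2 := primPoly_spec hμ (g (n - 1))
      rw [primPoly_spec hμ, smul_add, Polynomial.derivative_add]
      linear_combination - h1 - h2
  map_smul' c f := by
    funext n
    by_cases h : n = 0
    · simp [h]
    · simp only [h, if_false, Pi.smul_apply, RingHom.id_apply]
      have hμ := expo_ne_zero l (n - 1)
      refine eq_of_spec hμ ?_
      have h1 := primPoly_spec hμ (f (n - 1))
      rw [primPoly_spec hμ, Polynomial.derivative_smul, smul_comm, ← smul_add, h1]

lemma mulS_zero (f : ℕ → ℂ[X]) : mulS f 0 = 0 := rfl

lemma mulS_succ (f : ℕ → ℂ[X]) (n : ℕ) : mulS f (n + 1) = f n := rfl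

lemma prim_zero (f : ℕ → ℂ[X]) : prim l f 0 = 0 := rfl

lemma prim_succ (f : ℕ → ℂ[X]) (n : ℕ) :
    prim l f (n + 1) = primPoly (((l.1 : ℚ) : ℂ) + n) (f n) := rfl

lemma prim_spec (f : ℕ → ℂ[X]) (n : ℕ) :
    (((l.1 : ℚ) : ℂ) + n) • prim l f (n + 1) + Polynomial.derivative (prim l f (n + 1)) = f n := by
  rw [prim_succ]
  exact primPoly_spec (expo_ne_zero l n) _

lemma good_expansion : Good mulS (prim l) where
  ordA N f h i hi := by
    cases i with
    | zero => rfl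
    | succ i => rw [mulS_succ, h i (by omega)]
  ordB N f h i hi := by
    cases i with
    | zero => rfl
    | succ i => rw [prim_succ, h i (by omega)]; simp [primPoly]
  comm := by
    refine LinearMap.ext fun f => funext fun n => ?_
    simp only [Module.End.mul_apply, LinearMap.add_apply, Pi.add_apply]
    cases n with
    | zero => simp [mulS_zero, prim_zero]
    | succ n =>
      have h1 := prim_spec l (mulS f) n
      have h2 := prim_spec l (prim l f) n
      refine eq_of_spec (expo_ne_zero l n) ?_
      rw [smul_add, Polynomial.derivative_add, add_add_add_comm, h1, h2, mulS_succ]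
      cases n with
      | zero => simp [prim_zero, mulS_zero]
      | succ n =>
        have h3 := prim_spec l f n
        rw [mulS_succ]
        push_cast
        rw [show (((l.1 : ℚ) : ℂ) + ((n : ℂ) + 1)) = (((l.1 : ℚ) : ℂ) + n) + 1 by ring, add_smul,
          one_smul]
        linear_combination h3

/-- `a` acts as the multiplication by `s`, and `b` as the primitive without constant. -/
instance : Module Atilde (Expansion l) where
  smul u f := act mulS (prim l) u f
  one_smul f := by
    refine (act_single (A := mulS) (B := prim l) (1 : ℂ[X]) f).trans ?_
    rw [map_one]
    rfl
  mul_smul u v f := (good_expansion l).act_act u v f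
  smul_zero u := act_zero_right u
  smul_add u f g := act_add_right u f g
  add_smul u v f := act_add_left u v f
  zero_smul f := act_zero_left f

lemma smul_def (u : Atilde) (f : Expansion l) : u • f = act mulS (prim l) u f := rfl

instance : Module ℂ (Expansion l) := inferInstanceAs (Module ℂ (ℕ → ℂ[X]))

instance : IsScalarTower ℂ Atilde (Expansion l) :=
  IsScalarTower.of_algebraMap_smul fun c f => by
    rw [Atilde.algebraMap_eq, smul_def]
    refine (act_single (A := mulS) (B := prim l) _ f).trans ?_
    rw [Polynomial.aeval_C]
    rfl

end Expansion

lemma natDegree_primPoly_le (μ : ℂ) (p : ℂ[X]) :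
    (Expansion.primPoly μ p).natDegree ≤ p.natDegree := by
  refine Polynomial.natDegree_sum_le_of_forall_le _ _ fun i _ => ?_
  refine (Polynomial.natDegree_smul_le _ _).trans ?_
  exact (Polynomial.natDegree_iterate_derivative p i).trans (Nat.sub_le _ _)

/-- `Ξ_λ^{(N)}`: the expansions in which the powers of `Log s` are at most `N`, that is
`⊕_{j ≤ N} ℂ[[s]] s^{λ-1} (Log s)^j`. -/
def XiN (l : Expo) (N : ℕ) : Submodule Atilde (Expansion l) where
  carrier := {f | ∀ n, (f n).natDegree ≤ N}
  add_mem' hf hg n := (Polynomial.natDegree_add_le _ _).trans (max_le (hf n) (hg n))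
  zero_mem' n := by
    change (0 : ℂ[X]).natDegree ≤ N
    simp
  smul_mem' u f hf := by
    have hA : ∀ g : ℕ → ℂ[X], (∀ n, (g n).natDegree ≤ N) →
        ∀ n, (Expansion.mulS g n).natDegree ≤ N := by
      intro g hg n
      cases n with
      | zero => simp [Expansion.mulS_zero]
      | succ n => exact hg n
    have hB : ∀ g : ℕ → ℂ[X], (∀ n, (g n).natDegree ≤ N) →
        ∀ n, (Expansion.prim l g n).natDegree ≤ N := by
      intro g hg n
      cases n with
      | zero => simp [Expansion.prim_zero]
      | succ n => exact (natDegree_primPoly_le _ _).trans (hg n)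
    have hBpow : ∀ (ν n : ℕ), (((Expansion.prim l) ^ ν) f n).natDegree ≤ N := by
      intro ν
      induction ν with
      | zero => exact hf
      | succ ν ih => rw [pow_succ']; exact hB _ ih
    have hApoly : ∀ (p : ℂ[X]) (g : ℕ → ℂ[X]), (∀ n, (g n).natDegree ≤ N) →
        ∀ n, (Polynomial.aeval Expansion.mulS p g n).natDegree ≤ N := by
      intro p
      induction p using Polynomial.induction_on with
      | C c =>
        intro g hg n
        rw [Polynomial.aeval_C]
        exact (Polynomial.natDegree_smul_le c (g n)).trans (hg n)
      | add p q hp hq =>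
        intro g hg n
        rw [map_add]
        exact (Polynomial.natDegree_add_le _ _).trans (max_le (hp g hg n) (hq g hg n))
      | monomial k c ih =>
        intro g hg n
        have e : Polynomial.C c * Polynomial.X ^ (k + 1) =
          (Polynomial.C c * Polynomial.X ^ k) * Polynomial.X := by ring
        rw [e, map_mul, Module.End.mul_apply, Polynomial.aeval_X]
        exact ih _ (hA g hg) n
    intro n
    change (∑ ν ∈ Finset.range (n + 1), Polynomial.aeval Expansion.mulS
      ((u : ℕ → ℂ[X]) ν) ((Expansion.prim l ^ ν) f) n).natDegree ≤ N
    exact Polynomial.natDegree_sum_le_of_forall_le _ _ fun ν _ => hApoly _ _ (hBpow ν) n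

/-- `Ξ_λ = ∑_N Ξ_λ^{(N)}`. -/
def Xi (l : Expo) : Submodule Atilde (Expansion l) := ⨆ N : ℕ, XiN l N

/-- `Ξ_Λ^{(N)} = ⊕_{λ ∈ Λ} Ξ_λ^{(N)}` for a finite set `Λ`. -/
abbrev XiLN (L : Finset Expo) (N : ℕ) : Type := (l : L) → XiN l.1 N

/-! ## Frescos and themes -/

/-- `E` is isomorphic to `Ã φ` for some `Λ`, `N` and some `φ ∈ Ξ_Λ^{(N)} ⊗ V`, where `Ã` acts on
the left factor. -/
def IsMonogenicIn (V : Type) [AddCommGroup V] [Module ℂ V] (E : Type*) [AddCommGroup E]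
    [Module Atilde E] : Prop :=
  ∃ (L : Finset Expo) (N : ℕ) (φ : XiLN L N ⊗[ℂ] V),
    Nonempty (E ≃ₗ[Atilde] Submodule.span Atilde {φ})

/-- Frescos. -/
def IsFresco (E : Type*) [AddCommGroup E] [Module Atilde E] : Prop :=
  ∃ (V : Type) (_ : AddCommGroup V) (_ : Module ℂ V),
    FiniteDimensional ℂ V ∧ IsMonogenicIn V E

/-- Themes: one may take `V = ℂ`. -/
def IsTheme (E : Type*) [AddCommGroup E] [Module Atilde E] : Prop := IsMonogenicIn ℂ E

/-! ## (a,b)-modules -/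

/-- The `ℂ[[b]]`-module underlying an `Ã`-module. -/
abbrev modulePowerSeries (E : Type*) [AddCommGroup E] [Module Atilde E] : Module ℂ⟦X⟧ E :=
  Module.compHom E Atilde.ofPowerSeries

/-- The complex vector space underlying an `Ã`-module. -/
abbrev moduleComplex (E : Type*) [AddCommGroup E] [Module Atilde E] : Module ℂ E :=
  Module.compHom E (algebraMap ℂ Atilde)

/-- The rank over `ℂ[[b]]`. -/
def rank (E : Type*) [AddCommGroup E] [Module Atilde E] : ℕ :=
  letI := modulePowerSeries E
  Module.finrank ℂ⟦X⟧ E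

/-- (a,b)-modules: free of finite rank over `ℂ[[b]]`. -/
def IsABModule (E : Type*) [AddCommGroup E] [Module Atilde E] : Prop :=
  letI := modulePowerSeries E
  Module.Free ℂ⟦X⟧ E ∧ Module.Finite ℂ⟦X⟧ E

/-- Simple poles: `a E ⊆ b E`. -/
def HasSimplePole (E : Type*) [AddCommGroup E] [Module Atilde E] : Prop :=
  ∀ x : E, ∃ y : E, Atilde.a • x = Atilde.b • y

/-- Regular (a,b)-modules: those that embed into a simple pole (a,b)-module. (An (a,b)-module is
isomorphic to one in `Type`, so it suffices to consider the latter here and below.) -/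
def IsRegular (E : Type*) [AddCommGroup E] [Module Atilde E] : Prop :=
  IsABModule E ∧
    ∃ (G : Type) (_ : AddCommGroup G) (_ : Module Atilde G) (i : E →ₗ[Atilde] G),
      IsABModule G ∧ HasSimplePole G ∧ Function.Injective i

section Bernstein

attribute [local instance] moduleComplex

/-- The subspace `b E`. -/
def bImage (E : Type*) [AddCommGroup E] [Module Atilde E] : Submodule ℂ E where
  carrier := {x | ∃ y : E, x = Atilde.b • y}
  add_mem' := by
    rintro _ _ ⟨x, rfl⟩ ⟨y, rfl⟩
    exact ⟨x + y, (smul_add _ _ _).symm⟩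
  zero_mem' := ⟨0, (smul_zero _).symm⟩
  smul_mem' := by
    rintro c _ ⟨x, rfl⟩
    refine ⟨algebraMap ℂ Atilde c • x, ?_⟩
    change algebraMap ℂ Atilde c • Atilde.b • x = _
    rw [← mul_smul, ← mul_smul, Algebra.commutes]

/-- `B` is the Bernstein polynomial of the simple pole (a,b)-module `G`: the minimal polynomial of
the endomorphism `-b⁻¹ a` of the complex vector space `G / b G`. -/
def IsBernsteinOfSimplePole (G : Type*) [AddCommGroup G] [Module Atilde G] (B : ℂ[X]) : Prop :=
  ∃ t : Module.End ℂ (G ⧸ bImage G),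
    (∀ x y : G, Atilde.a • x = Atilde.b • y →
      t (Submodule.Quotient.mk x) = - Submodule.Quotient.mk y) ∧
    B = minpoly ℂ t

end Bernstein

/-- `i : E → G` is the inclusion of `E` into its saturation by `b⁻¹ a`: the minimal embedding of `E`
into a simple pole (a,b)-module. -/
def IsSaturation {E G : Type*} [AddCommGroup E] [Module Atilde E] [AddCommGroup G]
    [Module Atilde G] (i : E →ₗ[Atilde] G) : Prop :=
  IsABModule G ∧ HasSimplePole G ∧ Function.Injective i ∧
    ∀ H : Submodule Atilde G, LinearMap.range i ≤ H → HasSimplePole H → H = ⊤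

/-- `B` is the Bernstein polynomial of the regular (a,b)-module `E`, that is, of its saturation. -/
def IsBernstein (E : Type*) [AddCommGroup E] [Module Atilde E] (B : ℂ[X]) : Prop :=
  IsABModule E ∧
    ∃ (G : Type) (_ : AddCommGroup G) (_ : Module Atilde G) (i : E →ₗ[Atilde] G),
      IsSaturation i ∧ IsBernsteinOfSimplePole G B

/-- `[λ]`-primitive regular (a,b)-modules: all roots of the Bernstein polynomial are in
`-λ + ℤ`. -/
def IsPrimitive (l : Expo) (E : Type*) [AddCommGroup E] [Module Atilde E] : Prop :=
  IsRegular E ∧ ∃ B : ℂ[X], IsBernstein E B ∧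
    ∀ z : ℂ, B.IsRoot z → ∃ m : ℤ, z = -((l.1 : ℚ) : ℂ) + m

/-- Normal submodules: `F ∩ b E = b F`. -/
def IsNormal {E : Type*} [AddCommGroup E] [Module Atilde E] (F : Submodule Atilde E) : Prop :=
  {x : E | x ∈ F ∧ ∃ y : E, x = Atilde.b • y} = {x : E | ∃ y ∈ F, x = Atilde.b • y}

/-! ## The semi-simple filtration -/

/-- Semi-simple (a,b)-modules: submodules of a finite direct sum of regular (a,b)-modules of
rank `1`. -/
def IsSemiSimple (E : Type*) [AddCommGroup E] [Module Atilde E] : Prop :=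
  ∃ (n : ℕ) (M : Fin n → Type) (_ : ∀ i, AddCommGroup (M i)) (_ : ∀ i, Module Atilde (M i))
    (f : E →ₗ[Atilde] (∀ i, M i)),
    (∀ i, IsRegular (M i) ∧ rank (M i) = 1) ∧ Function.Injective f

/-- The semi-simple part `S_1(E)`: the submodule of the elements `x` such that `Ã x` is semi-simple.
(For a regular (a,b)-module the set of these elements is a submodule, so that it is equal to its
span.) -/
def ssPart (E : Type*) [AddCommGroup E] [Module Atilde E] : Submodule Atilde E :=
  Submodule.span Atilde {x : E | IsSemiSimple (Submodule.span Atilde {x})}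

/-- The semi-simple filtration: `S_0(E) = 0`, and `S_{j+1}(E)` is the pull-back of
`S_1(E / S_j(E))`. -/
def ssFilt (E : Type*) [AddCommGroup E] [Module Atilde E] : ℕ → Submodule Atilde E
  | 0 => ⊥
  | j + 1 => (ssPart (E ⧸ ssFilt E j)).comap (ssFilt E j).mkQ

/-- The semi-simple depth `d(E)`: the smallest `d` with `S_d(E) = E`. -/
def ssDepth (E : Type*) [AddCommGroup E] [Module Atilde E] : ℕ :=
  sInf {d : ℕ | ssFilt E d = ⊤}

/-- `F` is the normal submodule of rank `j` of `T`, by convention `T` itself if the rank of `T` is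
at most `j`. -/
def IsNormalTerm (T : Type*) [AddCommGroup T] [Module Atilde T] (j : ℕ)
    (F : Submodule Atilde T) : Prop :=
  (rank T ≤ j ∧ F = ⊤) ∨ (j < rank T ∧ IsNormal F ∧ rank F = j)

/-- The normal submodule of rank `j` of a `[λ]`-primitive theme `T` (with the above convention). It
is unique; as a total function, this is the supremum of all candidates. -/
def normalTerm (T : Type*) [AddCommGroup T] [Module Atilde T] (j : ℕ) : Submodule Atilde T :=
  sSup {F : Submodule Atilde T | IsNormalTerm T j F}

end FrescoTheory

end

/-! Everything is read off from the powers of `Log s`. The derivation `D = logDer` with respect to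
`Log s` commutes with `a` and `b`, hence is linear over the algebra, and its powers filter the
expansions by `logFilt l j = ker D ^ j`. A basis of `V` and the components indexed by `Λ` turn a
fresco `E` into a module with finitely many jointly injective morphisms `f i` to spaces of
expansions, all killed by one power of `D`.

The central fact is that morphisms do not create logarithms: if `D ^ j` kills a jointly injective
family on `M`, it kills every morphism from `M` to expansions
(`logDer_pow_eq_zero_of_jointly_injective`). Indeed `b⁻¹ a` acts on the coefficient of `s ^ (λ - 1 +
n)` as `λ + n + d/dLog s`. Thus, modulo `b ^ N`, the operator `b⁻¹ a` on a sum of modules `logFilt`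
is annihilated by a polynomial whose roots have order at most `j`. After multiplication by a power
of `b` this polynomial becomes an element of the algebra. The Artin-Rees lemma transfers the
divisibility to `M`, and any morphism carries it to its target, where it bounds the degree in `Log
s` (`logDer_pow_eq_zero_of_aeval`).

Regular modules of rank one only have simple roots in this sense, so semi-simple modules have only
morphisms without logarithms. Conversely, expansions without logarithms have rank one. By induction,
`S_j(E)` is the set of `x` with `D ^ j (f i x) = 0` for all `i` (`mem_ssFilt_iff`).

On the side of themes, a `[λ]`-primitive theme embeds in the expansions of exponent `λ`, because a
`[λ]`-primitive module has no nonzero morphism to those of another exponent. Its rank is the least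
`k` such that `D ^ k` kills it (`rank_le_iff`), and its normal submodule of rank `j` is the kernel
of `D ^ j` (`isNormalTerm_iff`). Both sides being expressed through `D`, the assertions on
submodules, on quotients and on the intersection follow from the central fact.

The depth is therefore the least power of `D` killing all the `f i`. A quotient theme of that rank
is the image of a suitable `f i`. A normal sub-theme of that rank (`exists_normal_subtheme`) is the
`b`-saturation of the module generated by one homogeneous component of an element with the highest
power of `Log s`: such components lie in `E` up to a power of `b`, by closedness of submodules for
the `b`-adic topology. -/

open scoped Polynomial PowerSeries TensorProduct

noncomputable section

namespace FrescoTheory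

/-! ## Elements of the algebra -/

namespace Atilde

/-- The coefficient of `b ^ n`. -/
def coeff (w : Atilde) (n : ℕ) : ℂ[X] := (show ℕ → ℂ[X] from w) n

/-- The element with given coefficients. -/
def mk (w : ℕ → ℂ[X]) : Atilde := w

lemma ext_coeff {v w : Atilde} (h : ∀ n, v.coeff n = w.coeff n) : v = w := funext h

lemma ofPowerSeries_X : ofPowerSeries PowerSeries.X = b := by
  refine ext_coeff fun n => ?_
  change Polynomial.C (PowerSeries.coeff n PowerSeries.X) = (Pi.single 1 1 : ℕ → ℂ[X]) n
  rw [PowerSeries.coeff_X]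
  by_cases h : n = 1
  · subst h; simp
  · simp [h]

lemma ofPowerSeries_X_pow (k : ℕ) : ofPowerSeries (PowerSeries.X ^ k) = b ^ k := by
  rw [map_pow, ofPowerSeries_X]

lemma a_mul_b : a * b = b * a + b * b := by
  have := a_mul_b_sub
  rw [sub_eq_iff_eq_add, pow_two] at this
  rw [this, add_comm]

lemma a_mul_b_pow (k : ℕ) : a * b ^ k = b ^ k * a + (k : Atilde) * b ^ (k + 1) := by
  induction k with
  | zero => simp
  | succ k ih =>
    have h : (b : Atilde) ^ (k + 1 + 1) = b ^ k * b * b := by rw [pow_succ, pow_succ]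
    rw [h, pow_succ b k, ← mul_assoc, ih, add_mul, mul_assoc (b ^ k) a b, a_mul_b, pow_succ]
    push_cast
    simp only [mul_add, add_mul, mul_assoc, one_mul]
    abel

lemma b_pow_mul_a (k : ℕ) : b ^ k * a = (a - (k : Atilde) * b) * b ^ k := by
  rw [sub_mul, a_mul_b_pow, mul_assoc, ← pow_succ']
  abel

lemma poly_mul (p q : ℂ[X]) : poly p * poly q = poly (p * q) := by
  refine ext_coeff fun n => ?_
  change act la lb (Pi.single 0 p) (Pi.single 0 q) n = (Pi.single 0 (p * q) : ℕ → ℂ[X]) n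
  rw [act_single, aeval_la]
  cases n <;> simp

lemma poly_add (p q : ℂ[X]) : poly (p + q) = poly p + poly q :=
  Pi.single_add (f := fun _ : ℕ => ℂ[X]) 0 p q

lemma b_mul (v : Atilde) : b * v = mk (lb v) := by
  have h : (Pi.single 1 1 : ℕ → ℂ[X]) = lb (Pi.single 0 1) := by
    have e : (Pi.single 0 1 : ℕ → ℂ[X]) =
        fun n => Polynomial.C ((Pi.single 0 1 : ℕ → ℂ) n) := by
      funext n
      cases n <;> simp
    funext n
    have := lb_pow_const (Pi.single 0 1) 1 n
    rw [pow_one, ← e] at this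
    rw [this]
    rcases n with _ | _ | n <;> simp
  have h2 : ∀ v : ℕ → ℂ[X], act la lb (Pi.single 1 1) v = lb v := by
    intro v
    rw [h, good_regular.act_lb, act_single]
    simp
  exact h2 v

/-- Every element is congruent to a polynomial in `a` modulo left multiples of `b`. -/
lemma exists_eq_poly_add (w : Atilde) : ∃ v : Atilde, w = poly (w.coeff 0) + b * v := by
  -- Solving `lb v (n + 1) = w (n + 1)` in the recursion `lb v (n + 1) = v n - (lb v n)'`; at `n =
  -- 0` no derivative enters, because `lb v 0` is `0` and not the coefficient of index `0` of `w`.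
  let v : ℕ → ℂ[X] := fun n =>
    w.coeff (n + 1) + if n = 0 then 0 else Polynomial.derivative (w.coeff n)
  refine ⟨mk v, ext_coeff fun n => ?_⟩
  have key : ∀ n, lb v (n + 1) = w.coeff (n + 1) := by
    intro n
    induction n with
    | zero => simp [lb_succ, lb_zero, v]
    | succ n ih => rw [lb_succ, ih]; simp [v]
  have h : (poly (w.coeff 0) + b * mk v).coeff n =
      (Pi.single 0 (w.coeff 0) : ℕ → ℂ[X]) n + lb v n := by
    rw [b_mul]; rfl
  rw [h]
  cases n with
  | zero => simp [lb_zero]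
  | succ n => simp [key]

end Atilde

/-! ## The derivation in `Log s` and the operator `b⁻¹ a` on expansions -/

namespace Expansion

variable {l : Expo}

/-- The coefficient of `s ^ (λ - 1 + n)`, a polynomial in `Log s`. -/
def coeff (f : Expansion l) (n : ℕ) : ℂ[X] := (show ℕ → ℂ[X] from f) n

/-- The expansion with given coefficients. -/
def mk (f : ℕ → ℂ[X]) : Expansion l := f

lemma ext_coeff {f g : Expansion l} (h : ∀ n, f.coeff n = g.coeff n) : f = g := funext h

@[simp] lemma coeff_mk (f : ℕ → ℂ[X]) (n : ℕ) : (mk f : Expansion l).coeff n = f n := rfl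

@[simp] lemma coeff_smul (c : ℂ) (f : Expansion l) (n : ℕ) :
    (c • f).coeff n = c • f.coeff n := rfl

@[simp] lemma coeff_add (f g : Expansion l) (n : ℕ) :
    (f + g).coeff n = f.coeff n + g.coeff n := rfl

@[simp] lemma coeff_sub (f g : Expansion l) (n : ℕ) :
    (f - g).coeff n = f.coeff n - g.coeff n := rfl

@[simp] lemma coeff_zero (n : ℕ) : (0 : Expansion l).coeff n = 0 := rfl

lemma a_smul (f : Expansion l) : Atilde.a • f = mk (mulS f) := by
  refine (act_single (A := mulS) (B := prim l) _ f).trans ?_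
  rw [Polynomial.aeval_X]
  rfl

lemma coeff_a_smul_zero (f : Expansion l) : (Atilde.a • f).coeff 0 = 0 := by
  rw [a_smul]; rfl

lemma coeff_a_smul_succ (f : Expansion l) (n : ℕ) :
    (Atilde.a • f).coeff (n + 1) = f.coeff n := by
  rw [a_smul]; rfl

lemma b_smul (f : Expansion l) : Atilde.b • f = mk (prim l f) := by
  have key : ∀ f : ℕ → ℂ[X], act mulS (prim l) (Pi.single 1 1) f = prim l f := by
    intro f
    funext n
    cases n with
    | zero => simp [act]; rfl
    | succ n =>
      unfold act
      rw [Finset.sum_eq_single 1]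
      · simp
      · intro ν _ hν
        simp [Pi.single_eq_of_ne hν]
      · simp
  exact key f

lemma coeff_b_smul_zero (f : Expansion l) : (Atilde.b • f).coeff 0 = 0 := by
  rw [b_smul]; rfl

lemma coeff_b_smul_spec (f : Expansion l) (n : ℕ) :
    (((l.1 : ℚ) : ℂ) + n) • (Atilde.b • f).coeff (n + 1) +
      Polynomial.derivative ((Atilde.b • f).coeff (n + 1)) = f.coeff n := by
  rw [b_smul]
  exact prim_spec l f n

lemma eq_b_smul {f g : Expansion l} (h0 : f.coeff 0 = 0)
    (h : ∀ n : ℕ, (((l.1 : ℚ) : ℂ) + n) • f.coeff (n + 1) +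
      Polynomial.derivative (f.coeff (n + 1)) = g.coeff n) :
    f = Atilde.b • g := by
  refine ext_coeff fun n => ?_
  cases n with
  | zero => rw [h0, coeff_b_smul_zero]
  | succ n =>
    refine eq_of_spec (expo_ne_zero l n) ?_
    rw [h, coeff_b_smul_spec]

lemma b_smul_injective : Function.Injective fun f : Expansion l => Atilde.b • f := by
  intro f g h
  have h' : Atilde.b • f = Atilde.b • g := h
  refine ext_coeff fun n => ?_
  rw [← coeff_b_smul_spec f n, ← coeff_b_smul_spec g n, h']

lemma coeff_b_pow_smul (k : ℕ) (f : Expansion l) : ∀ i < k, (Atilde.b ^ k • f).coeff i = 0 := by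
  induction k with
  | zero => intro i hi; omega
  | succ k ih =>
    rw [pow_succ', mul_smul, b_smul]
    exact (good_expansion l).ordB k _ ih

variable (l) in
/-- Derivation with respect to `Log s`, coefficient by coefficient. -/
def logDer : Module.End Atilde (Expansion l) where
  toFun f := mk fun n => Polynomial.derivative (f.coeff n)
  map_add' f g := ext_coeff fun n => Polynomial.derivative_add
  map_smul' u f := by
    let δ : Module.End ℂ (ℕ → ℂ[X]) :=
      { toFun := fun f n => Polynomial.derivative (f n)
        map_add' := fun f g => funext fun n => Polynomial.derivative_add
        map_smul' := fun c f => funext fun n => Polynomial.derivative_smul c (f n) }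
    have hA : ∀ f, δ (mulS f) = mulS (δ f) := by
      intro f
      funext n
      cases n with
      | zero => exact Polynomial.derivative_zero
      | succ n => rfl
    have hB : ∀ f, δ (prim l f) = prim l (δ f) := by
      intro f
      funext n
      cases n with
      | zero => exact Polynomial.derivative_zero
      | succ n =>
        refine eq_of_spec (expo_ne_zero l n) ?_
        rw [prim_spec l (δ f) n]
        change _ = Polynomial.derivative (f n)
        rw [← prim_spec l f n, Polynomial.derivative_add, Polynomial.derivative_smul]
        rfl
    have hpow : ∀ (ν : ℕ) f, δ ((prim l ^ ν) f) = (prim l ^ ν) (δ f) := by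
      intro ν
      induction ν with
      | zero => intro f; rfl
      | succ ν ih => intro f; rw [pow_succ', Module.End.mul_apply, hB, ih]; rfl
    have hpoly : ∀ (p : ℂ[X]) f, δ (Polynomial.aeval mulS p f) = Polynomial.aeval mulS p (δ f) := by
      intro p
      induction p using Polynomial.induction_on with
      | C c => intro f; simp [Module.algebraMap_end_apply]
      | add p q hp hq => intro f; simp [hp, hq]
      | monomial k c ih =>
        intro f
        have e : Polynomial.C c * Polynomial.X ^ (k + 1) =
          (Polynomial.C c * Polynomial.X ^ k) * Polynomial.X := by ring
        rw [e, map_mul, Module.End.mul_apply, Polynomial.aeval_X, ih, hA]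
        rfl
    have key : ∀ (u f : ℕ → ℂ[X]) (n : ℕ),
        Polynomial.derivative (act mulS (prim l) u f n) = act mulS (prim l) u (δ f) n := by
      intro u f n
      unfold act
      rw [Polynomial.derivative_sum]
      refine Finset.sum_congr rfl fun ν _ => ?_
      rw [← hpow, ← hpoly]
      rfl
    exact ext_coeff fun n => key u f n

@[simp] lemma coeff_logDer (f : Expansion l) (n : ℕ) :
    (logDer l f).coeff n = Polynomial.derivative (f.coeff n) := rfl

lemma coeff_logDer_pow (j : ℕ) (f : Expansion l) (n : ℕ) :
    ((logDer l ^ j) f).coeff n = (Polynomial.derivative ^ j : Module.End ℂ ℂ[X]) (f.coeff n) := by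
  induction j with
  | zero => rfl
  | succ j ih =>
    rw [pow_succ', pow_succ', Module.End.mul_apply, Module.End.mul_apply, coeff_logDer, ih]

variable (l) in
/-- The operator `b⁻¹ a = s ∂/∂s + 1`. -/
def euler : Module.End ℂ (Expansion l) where
  toFun f := mk fun n => (((l.1 : ℚ) : ℂ) + n) • f.coeff n + Polynomial.derivative (f.coeff n)
  map_add' f g := ext_coeff fun n => by
    simp only [coeff_mk, coeff_add, Polynomial.derivative_add, smul_add]
    abel
  map_smul' c f := ext_coeff fun n => by
    simp only [coeff_mk, coeff_smul, Polynomial.derivative_smul, smul_add, RingHom.id_apply]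
    rw [smul_comm]

@[simp] lemma coeff_euler (f : Expansion l) (n : ℕ) : (euler l f).coeff n =
    (((l.1 : ℚ) : ℂ) + n) • f.coeff n + Polynomial.derivative (f.coeff n) := rfl

lemma b_smul_euler (f : Expansion l) : Atilde.b • euler l f = Atilde.a • f :=
  (eq_b_smul (coeff_a_smul_zero f) fun n => by rw [coeff_a_smul_succ, coeff_euler]).symm

lemma logDer_euler (f : Expansion l) : logDer l (euler l f) = euler l (logDer l f) :=
  ext_coeff fun n => by simp

/-- An expansion whose first `k` coefficients vanish is a multiple of `b ^ k`. -/
lemma exists_eq_b_pow_smul (k : ℕ) (f : Expansion l) (h : ∀ i < k, f.coeff i = 0) :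
    ∃ g : Expansion l, f = Atilde.b ^ k • g := by
  induction k generalizing f with
  | zero => exact ⟨f, by simp⟩
  | succ k ih =>
    let g : Expansion l := mk fun n =>
      (((l.1 : ℚ) : ℂ) + n) • f.coeff (n + 1) + Polynomial.derivative (f.coeff (n + 1))
    have hg : f = Atilde.b • g := eq_b_smul (h 0 (by omega)) fun n => rfl
    obtain ⟨g', hg'⟩ := ih g fun i hi => by simp [g, h (i + 1) (by omega)]
    exact ⟨g', by rw [hg, hg', pow_succ', mul_smul]⟩

/-- The operator `b⁻¹ a` preserves each power of `s`, so a polynomial in it is, coefficient by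
coefficient, a differential operator in `Log s` with constant coefficients. Questions on exponents
thereby become questions on `d/dx` acting on polynomials. -/
lemma coeff_aeval_euler (q : ℂ[X]) (f : Expansion l) (n : ℕ) :
    (Polynomial.aeval (euler l) q f).coeff n =
      Polynomial.aeval (Polynomial.derivative : Module.End ℂ ℂ[X])
        (q.comp (Polynomial.X + Polynomial.C (((l.1 : ℚ) : ℂ) + n))) (f.coeff n) := by
  induction q using Polynomial.induction_on generalizing f with
  | C c => simp [Module.algebraMap_end_apply]
  | add p q hp hq => simp [hp, hq]
  | monomial k c ih =>
    have e : Polynomial.C c * Polynomial.X ^ (k + 1) =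
      (Polynomial.C c * Polynomial.X ^ k) * Polynomial.X := by ring
    have e2 : (((l.1 : ℚ) : ℂ) + n) • f.coeff n + Polynomial.derivative (f.coeff n) =
        Polynomial.aeval (Polynomial.derivative : Module.End ℂ ℂ[X])
        (Polynomial.X + Polynomial.C (((l.1 : ℚ) : ℂ) + n)) (f.coeff n) := by
      rw [map_add, Polynomial.aeval_X, Polynomial.aeval_C, LinearMap.add_apply,
        Module.algebraMap_end_apply, add_comm]
    rw [e]
    generalize Polynomial.C c * Polynomial.X ^ k = r at ih
    rw [map_mul, Module.End.mul_apply, Polynomial.aeval_X, ih, Polynomial.mul_comp, map_mul,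
      Module.End.mul_apply, coeff_euler, e2, Polynomial.X_comp]

end Expansion

/-! ## The operator `b⁻¹ a` on simple pole modules without `b`-torsion -/

section SimplePole

variable {E F : Type*} [AddCommGroup E] [Module Atilde E] [AddCommGroup F] [Module Atilde F]

lemma b_pow_smul_injective (hb : Function.Injective fun x : E => Atilde.b • x) (k : ℕ) :
    Function.Injective fun x : E => Atilde.b ^ k • x := by
  induction k with
  | zero => intro x y h; simpa using h
  | succ k ih =>
    intro x y h
    simp only [pow_succ, mul_smul] at h
    exact hb (ih h)

lemma eq_zero_of_b_pow_smul (hb : Function.Injective fun x : E => Atilde.b • x) {k : ℕ} {x : E}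
    (h : Atilde.b ^ k • x = 0) : x = 0 :=
  b_pow_smul_injective hb k (by simpa using h)

lemma a_smul_b_pow_smul (k : ℕ) (x : E) : Atilde.a • Atilde.b ^ k • x =
    Atilde.b ^ k • Atilde.a • x + (k : Atilde) • Atilde.b ^ (k + 1) • x := by
  rw [← mul_smul, Atilde.a_mul_b_pow, add_smul, mul_smul, mul_smul]

lemma b_smul_injective_of_injective {i : E →ₗ[Atilde] F} (hi : Function.Injective i)
    (hb : Function.Injective fun x : F => Atilde.b • x) :
    Function.Injective fun x : E => Atilde.b • x := by
  intro x y h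
  have h' : Atilde.b • x = Atilde.b • y := h
  refine hi (hb ?_)
  change Atilde.b • i x = Atilde.b • i y
  rw [← map_smul, ← map_smul, h']

variable [Module ℂ E] [IsScalarTower ℂ Atilde E] [Module ℂ F] [IsScalarTower ℂ Atilde F]

lemma atilde_smul_comm (c : ℂ) (u : Atilde) (x : E) : u • c • x = c • u • x :=
  smul_comm u c x

/-- Division by `b` is unique without `b`-torsion, which makes any choice of `b⁻¹ a x` automatically
linear. -/
lemma exists_euler (hb : Function.Injective fun x : E => Atilde.b • x) (hp : HasSimplePole E) :
    ∃ θ : Module.End ℂ E, ∀ x, Atilde.b • θ x = Atilde.a • x := by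
  choose t ht using hp
  refine ⟨{ toFun := t, map_add' := fun x y => hb ?_, map_smul' := fun c x => hb ?_ },
    fun x => (ht x).symm⟩
  · change Atilde.b • t (x + y) = Atilde.b • (t x + t y)
    rw [smul_add, ← ht, ← ht, ← ht, smul_add]
  · change Atilde.b • t (c • x) = Atilde.b • (c • t x)
    rw [atilde_smul_comm, ← ht, ← ht, atilde_smul_comm]

lemma euler_comm (hb : Function.Injective fun x : F => Atilde.b • x)
    {θ : Module.End ℂ E} (hθ : ∀ x, Atilde.b • θ x = Atilde.a • x)
    {η : Module.End ℂ F} (hη : ∀ x, Atilde.b • η x = Atilde.a • x)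
    (f : E →ₗ[Atilde] F) (q : ℂ[X]) (x : E) :
    f (Polynomial.aeval θ q x) = Polynomial.aeval η q (f x) := by
  have hc : ∀ (c : ℂ) (x : E), f (c • x) = c • f x := fun c x => by
    rw [← algebraMap_smul Atilde c x, map_smul, algebraMap_smul]
  induction q using Polynomial.induction_on generalizing x with
  | C c => simp [Module.algebraMap_end_apply, hc]
  | add p q hp hq => simp [hp, hq]
  | monomial k c ih =>
    have e : Polynomial.C c * Polynomial.X ^ (k + 1) =
      (Polynomial.C c * Polynomial.X ^ k) * Polynomial.X := by ring
    rw [e]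
    generalize Polynomial.C c * Polynomial.X ^ k = r at ih
    rw [map_mul, Module.End.mul_apply, Polynomial.aeval_X, ih, map_mul, Module.End.mul_apply,
      Polynomial.aeval_X]
    congr 1
    refine hb ?_
    change Atilde.b • f (θ x) = Atilde.b • η (f x)
    rw [← map_smul, hθ, hη, map_smul]

/-- This is `a b ^ k = b ^ k a + k b ^ (k + 1)` divided by `b`: passing `b ^ k` shifts the exponents
by `k`. -/
lemma euler_b_pow_smul (hb : Function.Injective fun x : E => Atilde.b • x)
    {θ : Module.End ℂ E} (hθ : ∀ x, Atilde.b • θ x = Atilde.a • x) (k : ℕ) (x : E) :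
    θ (Atilde.b ^ k • x) = Atilde.b ^ k • (θ x + (k : ℂ) • x) := by
  refine hb ?_
  change Atilde.b • θ (Atilde.b ^ k • x) = Atilde.b • Atilde.b ^ k • (θ x + (k : ℂ) • x)
  have h : (k : Atilde) • Atilde.b ^ (k + 1) • x = Atilde.b ^ (k + 1) • (k : ℂ) • x := by
    rw [atilde_smul_comm, ← algebraMap_smul Atilde (k : ℂ), map_natCast]
  rw [hθ, a_smul_b_pow_smul, h, ← hθ, ← mul_smul (Atilde.b ^ k) Atilde.b, ← pow_succ,
    ← mul_smul Atilde.b (Atilde.b ^ k), ← pow_succ', smul_add]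

lemma aeval_euler_b_pow_smul (hb : Function.Injective fun x : E => Atilde.b • x)
    {θ : Module.End ℂ E} (hθ : ∀ x, Atilde.b • θ x = Atilde.a • x) (q : ℂ[X]) (k : ℕ) (x : E) :
    Polynomial.aeval θ q (Atilde.b ^ k • x) =
      Atilde.b ^ k • Polynomial.aeval θ (q.comp (Polynomial.X + Polynomial.C (k : ℂ))) x := by
  induction q using Polynomial.induction_on generalizing x with
  | C c => simp [Module.algebraMap_end_apply, atilde_smul_comm]
  | add p q hp hq => simp [hp, hq]
  | monomial n c ih =>
    have e : Polynomial.C c * Polynomial.X ^ (n + 1) =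
      (Polynomial.C c * Polynomial.X ^ n) * Polynomial.X := by ring
    have e2 : θ x + (k : ℂ) • x =
        Polynomial.aeval θ (Polynomial.X + Polynomial.C (k : ℂ)) x := by
      rw [map_add, Polynomial.aeval_X, Polynomial.aeval_C, LinearMap.add_apply,
        Module.algebraMap_end_apply]
    rw [e]
    generalize Polynomial.C c * Polynomial.X ^ n = r at ih
    rw [map_mul, Module.End.mul_apply, Polynomial.aeval_X, euler_b_pow_smul hb hθ, ih,
      Polynomial.mul_comp, map_mul, Module.End.mul_apply, e2, Polynomial.X_comp]

/-- If `q(b⁻¹ a)` maps `E` to `b E`, then a product of shifts of `q` maps `E` to `b ^ n E`. -/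
lemma exists_eq_b_pow_smul_of_prod_shift (hb : Function.Injective fun x : E => Atilde.b • x)
    {θ : Module.End ℂ E} (hθ : ∀ x, Atilde.b • θ x = Atilde.a • x) {q : ℂ[X]}
    (hq : ∀ x, ∃ y, Polynomial.aeval θ q x = Atilde.b • y) (n : ℕ) (x : E) :
    ∃ y, Polynomial.aeval θ (∏ m ∈ Finset.range n,
      q.comp (Polynomial.X - Polynomial.C (m : ℂ))) x = Atilde.b ^ n • y := by
  induction n with
  | zero => exact ⟨x, by simp⟩
  | succ n ih =>
    obtain ⟨y, hy⟩ := ih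
    obtain ⟨z, hz⟩ := hq y
    refine ⟨z, ?_⟩
    -- Moving the new factor past `b ^ n` shifts its variable by `n`, which cancels its own shift by
    -- `-n`; the hypothesis on `q` then yields one more factor `b`.
    have e : (q.comp (Polynomial.X - Polynomial.C (n : ℂ))).comp
        (Polynomial.X + Polynomial.C (n : ℂ)) = q := by
      rw [Polynomial.comp_assoc]
      simp
    rw [Finset.prod_range_succ, mul_comm, map_mul, Module.End.mul_apply, hy,
      aeval_euler_b_pow_smul hb hθ, e, hz, pow_succ, mul_smul]

end SimplePole

/-- `b ^ k q(b⁻¹ a)` is given by an element of the algebra, the same one for all modules. -/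
lemma exists_smul_eq_b_pow_smul_aeval (q : ℂ[X]) :
    ∃ (k : ℕ) (u : Atilde), ∀ (E : Type) [AddCommGroup E] [Module Atilde E] [Module ℂ E]
      [IsScalarTower ℂ Atilde E] (θ : Module.End ℂ E) (_ : ∀ x, Atilde.b • θ x = Atilde.a • x)
      (x : E), u • x = Atilde.b ^ k • Polynomial.aeval θ q x := by
  induction q using Polynomial.induction_on with
  | C c =>
    refine ⟨0, algebraMap ℂ Atilde c, ?_⟩
    intro E _ _ _ _ θ hθ x
    rw [algebraMap_smul, pow_zero, one_smul, Polynomial.aeval_C, Module.algebraMap_end_apply]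
  | add p q hp hq =>
    obtain ⟨k, u, hu⟩ := hp
    obtain ⟨m, v, hv⟩ := hq
    refine ⟨k + m, Atilde.b ^ m * u + Atilde.b ^ k * v, ?_⟩
    intro E _ _ _ _ θ hθ x
    rw [add_smul, mul_smul, mul_smul, hu E θ hθ, hv E θ hθ, map_add, LinearMap.add_apply,
      smul_add, ← mul_smul, ← mul_smul, ← pow_add, ← pow_add, add_comm m k]
  | monomial n c ih =>
    have e : Polynomial.C c * Polynomial.X ^ (n + 1) =
      Polynomial.X * (Polynomial.C c * Polynomial.X ^ n) := by ring
    rw [e]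
    generalize Polynomial.C c * Polynomial.X ^ n = r at ih
    obtain ⟨k, u, hu⟩ := ih
    -- With `θ = b⁻¹ a` one has `b ^ (k + 1) θ = b ^ k a = (a - k b) b ^ k`: each factor `θ` costs
    -- one power of `b`.
    refine ⟨k + 1, (Atilde.a - (k : Atilde) * Atilde.b) * u, ?_⟩
    intro E _ _ _ _ θ hθ x
    rw [mul_smul, hu E θ hθ, ← mul_smul, ← Atilde.b_pow_mul_a, mul_smul, ← hθ, map_mul,
      Module.End.mul_apply, Polynomial.aeval_X, pow_succ, mul_smul]

/-! ## Modules over `ℂ⟦b⟧` -/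

section PowerSeriesModules

attribute [local instance] modulePowerSeries

variable {E F : Type*} [AddCommGroup E] [Module Atilde E] [AddCommGroup F] [Module Atilde F]

lemma powerSeries_smul_def (S : ℂ⟦X⟧) (x : E) : S • x = Atilde.ofPowerSeries S • x := rfl

lemma X_pow_smul (k : ℕ) (x : E) : (PowerSeries.X ^ k : ℂ⟦X⟧) • x = Atilde.b ^ k • x := by
  rw [powerSeries_smul_def, Atilde.ofPowerSeries_X_pow]

lemma X_smul (x : E) : (PowerSeries.X : ℂ⟦X⟧) • x = Atilde.b • x := by
  rw [powerSeries_smul_def, Atilde.ofPowerSeries_X]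

/-- An `Ã`-linear map as a `ℂ⟦b⟧`-linear map. -/
def toPS (f : E →ₗ[Atilde] F) : E →ₗ[ℂ⟦X⟧] F where
  toFun := f
  map_add' := map_add f
  map_smul' S x := f.map_smul (Atilde.ofPowerSeries S) x

/-- An `Ã`-submodule as a `ℂ⟦b⟧`-submodule. -/
def subPS (M : Submodule Atilde E) : Submodule ℂ⟦X⟧ E where
  carrier := M
  add_mem' := M.add_mem
  zero_mem' := M.zero_mem
  smul_mem' S _ hx := M.smul_mem (Atilde.ofPowerSeries S) hx

@[simp] lemma mem_subPS (M : Submodule Atilde E) (x : E) : x ∈ subPS M ↔ x ∈ M := Iff.rfl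

/-- The tautological identification. -/
def subPSEquiv (M : Submodule Atilde E) : M ≃ₗ[ℂ⟦X⟧] subPS M where
  toFun x := ⟨x.1, x.2⟩
  invFun x := ⟨x.1, x.2⟩
  left_inv _ := rfl
  right_inv _ := rfl
  map_add' _ _ := rfl
  map_smul' _ _ := rfl

/-- A nonzero power series is a unit times a power of `b`, so torsion can only come from `b`. -/
lemma eq_zero_of_powerSeries_smul (hb : Function.Injective fun x : E => Atilde.b • x)
    {S : ℂ⟦X⟧} (hS : S ≠ 0) {x : E} (h : S • x = 0) : x = 0 := by
  obtain ⟨w, hw⟩ := PowerSeries.isUnit_divided_by_X_pow_order hS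
  rw [← PowerSeries.X_pow_order_mul_divXPowOrder (f := S), ← hw, mul_smul, X_pow_smul] at h
  have h2 := eq_zero_of_b_pow_smul hb h
  have h3 := congrArg (fun y => (↑w⁻¹ : ℂ⟦X⟧) • y) h2
  simpa [← mul_smul] using h3

lemma isTorsionFree_of_b (hb : Function.Injective fun x : E => Atilde.b • x) :
    Module.IsTorsionFree ℂ⟦X⟧ E :=
  Module.IsTorsionFree.of_smul_eq_zero fun S x h => by
    by_cases hS : S = 0
    · exact Or.inl hS
    · exact Or.inr (eq_zero_of_powerSeries_smul hb hS h)

/-- Finite torsion-free modules over the principal ideal domain `ℂ⟦b⟧` are free, and torsion is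
tested on `b` alone. -/
lemma isABModule_iff : IsABModule E ↔
    (Function.Injective fun x : E => Atilde.b • x) ∧ Module.Finite ℂ⟦X⟧ E := by
  constructor
  · rintro ⟨h1, h2⟩
    refine ⟨fun x y h => ?_, h2⟩
    have h' : (PowerSeries.X : ℂ⟦X⟧) • x = (PowerSeries.X : ℂ⟦X⟧) • y := by
      rw [X_smul, X_smul]; exact h
    exact smul_right_injective E PowerSeries.X_ne_zero h'
  · rintro ⟨h1, h2⟩
    have := isTorsionFree_of_b h1
    exact ⟨Module.free_of_finite_type_torsion_free', h2⟩

lemma IsABModule.b_injective (h : IsABModule E) : Function.Injective fun x : E => Atilde.b • x :=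
  (isABModule_iff.1 h).1

lemma IsABModule.finite (h : IsABModule E) : Module.Finite ℂ⟦X⟧ E := h.2

lemma IsABModule.of_injective (h : IsABModule F) {i : E →ₗ[Atilde] F}
    (hi : Function.Injective i) : IsABModule E := by
  have := h.finite
  refine isABModule_iff.2 ⟨b_smul_injective_of_injective hi h.b_injective, ?_⟩
  exact Module.Finite.of_injective (toPS i) hi

lemma IsABModule.pi {ι : Type*} [Fintype ι] {M : ι → Type*} [∀ i, AddCommGroup (M i)]
    [∀ i, Module Atilde (M i)] (h : ∀ i, IsABModule (M i)) : IsABModule (∀ i, M i) := by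
  have := fun i => (h i).finite
  refine isABModule_iff.2 ⟨fun x y hxy => funext fun i => (h i).b_injective (congrFun hxy i), ?_⟩
  exact Module.Finite.pi

lemma rank_eq (E : Type*) [AddCommGroup E] [Module Atilde E] :
    rank E = Module.finrank ℂ⟦X⟧ E := rfl

lemma rank_ker_add_rank_range (h : IsABModule E) (f : E →ₗ[Atilde] F) :
    rank (LinearMap.range f) + rank (LinearMap.ker f) = rank E := by
  have := h.finite
  have h1 := Submodule.finrank_quotient_add_finrank (LinearMap.ker (toPS f))
  rw [LinearEquiv.finrank_eq (toPS f).quotKerEquivRange] at h1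
  rw [rank_eq, rank_eq, rank_eq, ← h1, LinearEquiv.finrank_eq (subPSEquiv (LinearMap.range f)),
    LinearEquiv.finrank_eq (subPSEquiv (LinearMap.ker f))]
  rfl

/-- Artin-Rees for the `b`-adic filtration. -/
lemma exists_artin_rees (h : IsABModule F) (i : E →ₗ[Atilde] F) (hi : Function.Injective i) :
    ∃ K : ℕ, ∀ (m : ℕ) (z : E) (y : F), i z = Atilde.b ^ (m + K) • y →
      ∃ w : E, z = Atilde.b ^ m • w := by
  have := h.finite
  obtain ⟨K, hK⟩ := Ideal.exists_pow_inf_eq_pow_smul (Ideal.span {(PowerSeries.X : ℂ⟦X⟧)})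
    (LinearMap.range (toPS i))
  refine ⟨K, fun m z y hz => ?_⟩
  have h1 : i z ∈ Ideal.span {(PowerSeries.X : ℂ⟦X⟧)} ^ (m + K) • (⊤ : Submodule ℂ⟦X⟧ F) ⊓
      LinearMap.range (toPS i) := by
    refine ⟨?_, ⟨z, rfl⟩⟩
    rw [hz, ← X_pow_smul]
    exact Submodule.smul_mem_smul (Ideal.pow_mem_pow (Ideal.mem_span_singleton_self _) _) trivial
  rw [hK (m + K) (by omega), Nat.add_sub_cancel, Ideal.span_singleton_pow,
    Submodule.ideal_span_singleton_smul, Submodule.mem_smul_pointwise_iff_exists] at h1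
  obtain ⟨_, ⟨-, w, rfl⟩, hw⟩ := h1
  refine ⟨w, hi ?_⟩
  rw [← hw, map_smul, ← X_pow_smul]
  rfl

/-- Submodules are closed for the `b`-adic topology. -/
lemma mem_of_forall_exists_b_pow (h : IsABModule E) (M : Submodule Atilde E) (x : E)
    (hx : ∀ n : ℕ, ∃ y ∈ M, ∃ z : E, x = y + Atilde.b ^ n • z) : x ∈ M := by
  have := h.finite
  -- Krull's intersection theorem in the finite module `E / M`, where the class of `x` is divisible
  -- by every power of `b`.
  have h1 := Ideal.iInf_pow_smul_eq_bot_of_isLocalRing (M := E ⧸ subPS M)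
    (Ideal.span {(PowerSeries.X : ℂ⟦X⟧)}) (by
      rw [← PowerSeries.maximalIdeal_eq_span_X]; exact Ideal.IsPrime.ne_top inferInstance)
  have h2 : (subPS M).mkQ x ∈ (⊥ : Submodule ℂ⟦X⟧ (E ⧸ subPS M)) := by
    rw [← h1, Submodule.mem_iInf]
    intro n
    obtain ⟨y, hy, z, rfl⟩ := hx n
    have h3 : (subPS M).mkQ y = 0 := by simpa using hy
    rw [map_add, h3, zero_add, ← X_pow_smul, map_smul]
    exact Submodule.smul_mem_smul (Ideal.pow_mem_pow (Ideal.mem_span_singleton_self _) _) trivial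
  simpa using h2

/-- Nakayama's lemma. -/
lemma eq_top_of_forall_exists_b_smul (h : Module.Finite ℂ⟦X⟧ E) (M : Submodule Atilde E)
    (hM : ∀ x : E, ∃ y ∈ M, ∃ z : E, x = y + Atilde.b • z) : M = ⊤ := by
  have h1 : (⊤ : Submodule ℂ⟦X⟧ E) ≤ subPS M := by
    refine Submodule.le_of_le_smul_of_le_jacobson_bot
      (I := Ideal.span {(PowerSeries.X : ℂ⟦X⟧)}) Module.Finite.fg_top ?_ ?_
    · rw [← PowerSeries.maximalIdeal_eq_span_X]
      exact IsLocalRing.maximalIdeal_le_jacobson _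
    · intro x _
      obtain ⟨y, hy, z, rfl⟩ := hM x
      refine Submodule.add_mem_sup hy ?_
      rw [← X_smul]
      exact Submodule.smul_mem_smul (Ideal.mem_span_singleton_self _) trivial
  exact eq_top_iff.2 fun x _ => h1 trivial

end PowerSeriesModules

/-! ## Differential operators with constant coefficients on polynomials -/

section Derivative

local notation "δ" => (Polynomial.derivative : Module.End ℂ ℂ[X])

lemma derivative_pow_apply (k : ℕ) (p : ℂ[X]) : (δ ^ k) p = Polynomial.derivative^[k] p :=
  Module.End.pow_apply _ _ _

lemma exists_derivative_pow_eq_zero (p : ℂ[X]) : ∃ k, (δ ^ k) p = 0 :=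
  ⟨p.natDegree + 1, by
    rw [derivative_pow_apply]
    exact Polynomial.iterate_derivative_eq_zero (Nat.lt_succ_self _)⟩

/-- The degree is even smaller than `k` unless `k = 0`; the weak bound treats both cases alike and
suffices to bound the powers of `Log s`. -/
lemma natDegree_le_of_derivative_pow {k : ℕ} {p : ℂ[X]} (h : (δ ^ k) p = 0) :
    p.natDegree ≤ k := by
  by_contra hk
  have h1 := congrArg (fun r => Polynomial.coeff r (p.natDegree - k)) h
  simp only [derivative_pow_apply, Polynomial.coeff_iterate_derivative, Polynomial.coeff_zero] at h1
  rw [Nat.sub_add_cancel (by omega), smul_eq_zero] at h1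
  rcases h1 with h1 | h1
  · rw [Nat.descFactorial_eq_zero_iff_lt] at h1
    omega
  · rw [Polynomial.coeff_natDegree, Polynomial.leadingCoeff_eq_zero] at h1
    rw [h1] at hk
    simp at hk

lemma eq_zero_of_aeval_derivative {r : ℂ[X]} (hr : ¬ Polynomial.X ∣ r) {p : ℂ[X]}
    (h : Polynomial.aeval δ r p = 0) : p = 0 := by
  obtain ⟨k, hk⟩ := exists_derivative_pow_eq_zero p
  obtain ⟨c, d, hcd⟩ : IsCoprime (Polynomial.X ^ k) r :=
    IsCoprime.pow_left ((Polynomial.irreducible_X).coprime_iff_not_dvd.2 hr)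
  have h1 := congrArg (fun q => Polynomial.aeval δ q p) hcd
  simp only [map_add, map_mul, map_pow, Polynomial.aeval_X, map_one, LinearMap.add_apply,
    Module.End.mul_apply, h, hk, map_zero, add_zero, Module.End.one_apply] at h1
  exact h1.symm

/-- If `q(μ + d/dx) p = 0` and `μ` is a root of order at most `j` of `q`, then `p` is a polynomial
of degree less than `j`. -/
lemma derivative_pow_eq_zero_of_aeval {q : ℂ[X]} (hq : q ≠ 0) {μ : ℂ} {j : ℕ}
    (hj : q.rootMultiplicity μ ≤ j) {p : ℂ[X]}
    (h : Polynomial.aeval δ (q.comp (Polynomial.X + Polynomial.C μ)) p = 0) : (δ ^ j) p = 0 := by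
  obtain ⟨r, hr, hr'⟩ := Polynomial.exists_eq_pow_rootMultiplicity_mul_and_not_dvd q hq μ
  rw [hr, Polynomial.mul_comp, Polynomial.pow_comp, Polynomial.sub_comp, Polynomial.X_comp,
    Polynomial.C_comp, add_sub_cancel_right, mul_comm, map_mul, Module.End.mul_apply, map_pow,
    Polynomial.aeval_X] at h
  -- The cofactor `r` of the power of `X - μ` does not vanish at `μ`, so `r(μ + d/dx)` is injective
  -- and only a power of `d/dx` remains.
  have h1 := eq_zero_of_aeval_derivative (by
    rw [Polynomial.X_dvd_iff, Polynomial.coeff_zero_eq_eval_zero]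
    rw [Polynomial.dvd_iff_isRoot, Polynomial.IsRoot.def] at hr'
    simpa using hr') h
  obtain ⟨m, rfl⟩ := Nat.exists_eq_add_of_le hj
  rw [add_comm, pow_add, Module.End.mul_apply, h1, map_zero]

/-- A polynomial of degree exactly `d` generates the polynomials of degree at most `d` under
differentiation. -/
lemma exists_aeval_derivative_eq {d : ℕ} {p : ℂ[X]} (hp : (δ ^ d) p ≠ 0)
    (hp' : (δ ^ (d + 1)) p = 0) {k : ℕ} (hk : k ≤ d + 1) {r : ℂ[X]} (hr : (δ ^ k) r = 0) :
    ∃ q : ℂ[X], r = Polynomial.aeval δ q p := by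
  have hconst : ∀ s : ℂ[X], δ s = 0 → ∃ c : ℂ, s = Polynomial.C c := by
    intro s hs
    exact ⟨s.coeff 0, Polynomial.eq_C_of_derivative_eq_zero hs⟩
  induction k generalizing r with
  | zero => exact ⟨0, by simpa using hr⟩
  | succ k ih =>
    rw [pow_succ', Module.End.mul_apply] at hr hp'
    obtain ⟨c, hc⟩ := hconst _ hr
    obtain ⟨c', hc'⟩ := hconst _ hp'
    have hc0 : c' ≠ 0 := by
      rintro rfl
      exact hp (by rw [hc']; simp)
    have e : (δ ^ k) ((δ ^ (d - k)) p) = (δ ^ d) p := by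
      rw [← Module.End.mul_apply, ← pow_add, Nat.add_sub_cancel' (by omega)]
    -- The `k`-th derivatives of `r` and of `δ ^ (d - k) p` are the constants `c` and `c' ≠ 0`;
    -- subtracting the right multiple lowers the degree.
    obtain ⟨q, hq⟩ := ih (by omega) (r := r - (c / c') • (δ ^ (d - k)) p) (by
      rw [map_sub, map_smul, e, hc, hc', Polynomial.smul_C, smul_eq_mul, div_mul_cancel₀ _ hc0,
        sub_self])
    refine ⟨q + Polynomial.C (c / c') * Polynomial.X ^ (d - k), ?_⟩
    rw [map_add, LinearMap.add_apply, ← hq, map_mul, Polynomial.aeval_C, map_pow,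
      Polynomial.aeval_X, Module.End.mul_apply, Module.algebraMap_end_apply, sub_add_cancel]

end Derivative

/-! ## The filtration by the powers of `Log s` -/

section LogFiltration

attribute [local instance] modulePowerSeries

open Expansion

/-- The expansions in which only powers of `Log s` smaller than `j` occur. -/
def logFilt (l : Expo) (j : ℕ) : Submodule Atilde (Expansion l) := LinearMap.ker (logDer l ^ j)

variable {l : Expo}

lemma mem_logFilt {j : ℕ} {f : Expansion l} : f ∈ logFilt l j ↔ (logDer l ^ j) f = 0 := Iff.rfl

lemma mem_logFilt_iff_coeff {j : ℕ} {f : Expansion l} : f ∈ logFilt l j ↔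
    ∀ n, (Polynomial.derivative ^ j : Module.End ℂ ℂ[X]) (f.coeff n) = 0 := by
  rw [mem_logFilt]
  constructor
  · intro h n
    rw [← coeff_logDer_pow, h, coeff_zero]
  · intro h
    refine ext_coeff fun n => ?_
    rw [coeff_logDer_pow, h, coeff_zero]

lemma logFilt_mono {j k : ℕ} (h : j ≤ k) : logFilt l j ≤ logFilt l k := by
  intro f hf
  obtain ⟨m, rfl⟩ := Nat.exists_eq_add_of_le h
  rw [mem_logFilt] at hf ⊢
  rw [add_comm, pow_add, Module.End.mul_apply, hf, map_zero]

lemma XiN_le_logFilt (N : ℕ) : XiN l N ≤ logFilt l (N + 1) := by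
  intro f hf
  rw [mem_logFilt_iff_coeff]
  intro n
  rw [derivative_pow_apply]
  exact Polynomial.iterate_derivative_eq_zero (Nat.lt_succ_of_le (hf n))

lemma logFilt_le_XiN (N : ℕ) : logFilt l N ≤ XiN l N := by
  intro f hf n
  exact natDegree_le_of_derivative_pow (mem_logFilt_iff_coeff.1 hf n)

lemma coeff_powerSeries_smul (S : ℂ⟦X⟧) (f : Expansion l) (n : ℕ) :
    (S • f).coeff n =
      ∑ ν ∈ Finset.range (n + 1), PowerSeries.coeff ν S • (Atilde.b ^ ν • f).coeff n := by
  have hpow : ∀ ν, Atilde.b ^ ν • f = mk ((prim l ^ ν) f) := by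
    intro ν
    induction ν with
    | zero => rw [pow_zero, one_smul]; rfl
    | succ ν ih => rw [pow_succ', mul_smul, ih, b_smul, pow_succ']; rfl
  have h : (S • f).coeff n = ∑ ν ∈ Finset.range (n + 1),
      Polynomial.aeval mulS (Polynomial.C (PowerSeries.coeff ν S)) ((prim l ^ ν) f) n := rfl
  rw [h]
  refine Finset.sum_congr rfl fun ν _ => ?_
  rw [hpow, Polynomial.aeval_C, Module.algebraMap_end_apply]
  rfl

variable (l) in
/-- The expansion `s ^ (λ - 1)`. -/
def sPow : Expansion l := mk fun n => if n = 0 then 1 else 0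

lemma coeff_b_pow_smul_sPow (m : ℕ) : ∃ c : ℂ, c ≠ 0 ∧
    ∀ n, (Atilde.b ^ m • sPow l).coeff n = if n = m then Polynomial.C c else 0 := by
  induction m with
  | zero => exact ⟨1, one_ne_zero, fun n => by simp [sPow]⟩
  | succ m ih =>
    obtain ⟨c, hc, h⟩ := ih
    refine ⟨(((l.1 : ℚ) : ℂ) + m)⁻¹ * c, mul_ne_zero (inv_ne_zero (expo_ne_zero l m)) hc, ?_⟩
    have h2 : (mk fun n => if n = m + 1 then
        Polynomial.C ((((l.1 : ℚ) : ℂ) + m)⁻¹ * c) else 0 : Expansion l) =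
        Atilde.b • Atilde.b ^ m • sPow l := by
      refine eq_b_smul (by simp) fun n => ?_
      rw [h]
      by_cases hn : n = m
      · subst hn
        rw [coeff_mk, if_pos rfl, if_pos rfl, Polynomial.smul_C, smul_eq_mul,
          mul_inv_cancel_left₀ (expo_ne_zero l n), Polynomial.derivative_C, add_zero]
      · simp [hn]
    intro n
    rw [pow_succ', mul_smul, ← h2, coeff_mk]

/-- Since `b ^ n s ^ (λ - 1)` is a nonzero multiple of `s ^ (λ - 1 + n)`, the coefficients of `S`
are found by division, one power of `s` at a time. Expansions without logarithms thus have a single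
generator over `ℂ⟦b⟧`. -/
lemma exists_eq_smul_sPow {f : Expansion l} (hf : f ∈ logFilt l 1) :
    ∃ S : ℂ⟦X⟧, f = S • sPow l := by
  choose γ hγ h using coeff_b_pow_smul_sPow (l := l)
  rw [mem_logFilt_iff_coeff] at hf
  refine ⟨PowerSeries.mk fun n => (f.coeff n).coeff 0 / γ n, ext_coeff fun n => ?_⟩
  rw [coeff_powerSeries_smul, Finset.sum_eq_single n]
  · rw [h, if_pos rfl, PowerSeries.coeff_mk, Polynomial.smul_C, smul_eq_mul,
      div_mul_cancel₀ _ (hγ n)]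
    exact Polynomial.eq_C_of_derivative_eq_zero (by simpa using hf n)
  · intro ν _ hν
    rw [h, if_neg hν.symm, smul_zero]
  · simp

/-- `D ^ j` maps `logFilt l (j + 1)` to the noetherian module `logFilt l 1` with kernel `logFilt l
j`, which allows an induction on `j`. -/
lemma fg_subPS_logFilt (j : ℕ) : (subPS (logFilt l j)).FG := by
  have h1 : (subPS (logFilt l 1)).FG := by
    have h2 : subPS (logFilt l 1) ≤ Submodule.span ℂ⟦X⟧ {sPow l} := by
      intro f hf
      obtain ⟨S, rfl⟩ := exists_eq_smul_sPow hf
      exact Submodule.smul_mem _ _ (Submodule.mem_span_singleton_self _)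
    have h3 : IsNoetherian ℂ⟦X⟧ (Submodule.span ℂ⟦X⟧ {sPow l}) := inferInstance
    exact isNoetherian_submodule.1 h3 _ h2
  induction j with
  | zero =>
    have : subPS (logFilt l 0) = ⊥ := by
      refine eq_bot_iff.2 fun f hf => ?_
      simpa [mem_logFilt] using hf
    rw [this]
    exact Submodule.fg_bot
  | succ j ih =>
    have : Module.Finite ℂ⟦X⟧ (subPS (logFilt l 1)) := Module.Finite.iff_fg.2 h1
    have h3 : IsNoetherian ℂ⟦X⟧ (subPS (logFilt l 1)) := inferInstance
    refine Submodule.fg_of_fg_map_of_fg_inf_ker (toPS (logDer l ^ j)) ?_ ?_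
    · refine isNoetherian_submodule.1 h3 _ ?_
      rintro _ ⟨f, hf, rfl⟩
      change (logDer l ^ 1) ((logDer l ^ j) f) = 0
      rw [← Module.End.mul_apply, ← pow_add, add_comm]
      exact hf
    · have : subPS (logFilt l (j + 1)) ⊓ LinearMap.ker (toPS (logDer l ^ j)) =
          subPS (logFilt l j) :=
        le_antisymm inf_le_right fun f hf => ⟨logFilt_mono (Nat.le_succ j) hf, hf⟩
      rw [this]
      exact ih

lemma isABModule_logFilt (l : Expo) (j : ℕ) : IsABModule (logFilt l j) := by
  refine isABModule_iff.2 ⟨b_smul_injective_of_injective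
    (i := (logFilt l j).subtype) Subtype.val_injective b_smul_injective, ?_⟩
  have : Module.Finite ℂ⟦X⟧ (subPS (logFilt l j)) := Module.Finite.iff_fg.2 (fg_subPS_logFilt j)
  exact Module.Finite.equiv (subPSEquiv (logFilt l j)).symm

lemma euler_mem_logFilt {j : ℕ} {f : Expansion l} (hf : f ∈ logFilt l j) :
    euler l f ∈ logFilt l j := by
  rw [mem_logFilt] at hf ⊢
  have : ∀ (j : ℕ) (f : Expansion l), (logDer l ^ j) (euler l f) = euler l ((logDer l ^ j) f) := by
    intro j
    induction j with
    | zero => intro f; rfl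
    | succ j ih => intro f; rw [pow_succ, Module.End.mul_apply, logDer_euler, ih]; rfl
  rw [this, hf, map_zero]

lemma hasSimplePole_logFilt (l : Expo) (j : ℕ) : HasSimplePole (logFilt l j) := by
  rintro ⟨f, hf⟩
  exact ⟨⟨euler l f, euler_mem_logFilt hf⟩, Subtype.ext (b_smul_euler f).symm⟩

/-- An element of `logFilt` divisible by `b ^ k` as an expansion is so in `logFilt`. -/
lemma exists_mem_logFilt_eq_b_pow_smul {j : ℕ} (k : ℕ) {f : Expansion l} (hf : f ∈ logFilt l j)
    (h : ∀ i < k, f.coeff i = 0) : ∃ g ∈ logFilt l j, f = Atilde.b ^ k • g := by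
  obtain ⟨g, rfl⟩ := exists_eq_b_pow_smul k f h
  refine ⟨g, ?_, rfl⟩
  rw [mem_logFilt] at hf ⊢
  rw [map_smul] at hf
  exact eq_zero_of_b_pow_smul b_smul_injective hf

/-! ## Ranks -/

variable {F : Type*} [AddCommGroup F] [Module Atilde F]

lemma eq_zero_of_rank_eq_zero (h : IsABModule F) (hr : rank F = 0) (x : F) : x = 0 := by
  have := h.finite
  obtain ⟨S, hS⟩ := Module.finrank_eq_zero_iff_isTorsion.1 hr (x := x)
  exact eq_zero_of_powerSeries_smul h.b_injective (nonZeroDivisors.ne_zero S.2) hS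

lemma rank_eq_zero_of_forall (h : ∀ x : F, x = 0) : rank F = 0 := by
  have : Subsingleton F := ⟨fun x y => by rw [h x, h y]⟩
  exact Module.finrank_zero_of_subsingleton

lemma rank_le_of_injective {E : Type*} [AddCommGroup E] [Module Atilde E] (h : IsABModule F)
    {i : E →ₗ[Atilde] F} (hi : Function.Injective i) : rank E ≤ rank F := by
  have := h.finite
  exact LinearMap.finrank_le_finrank_of_injective (f := toPS i) hi

lemma rank_logFilt_one_le (l : Expo) : rank (logFilt l 1) ≤ 1 := by
  have hs : sPow l ∈ logFilt l 1 := by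
    rw [mem_logFilt_iff_coeff]
    intro n
    by_cases h : n = 0 <;> simp [sPow, h]
  refine finrank_le_one (R := ℂ⟦X⟧) (⟨sPow l, hs⟩ : logFilt l 1) fun f => ?_
  obtain ⟨S, hS⟩ := exists_eq_smul_sPow f.2
  exact ⟨S, Subtype.ext hS.symm⟩

/-- Write `f = S s ^ (λ - 1)` with `S` a unit times `b ^ m`; the inverse of the unit leaves a single
power of `s`. -/
lemma exists_smul_homogeneous {f : Expansion l} (hf : f ∈ logFilt l 1) (h0 : f ≠ 0) :
    ∃ (u : Atilde) (m : ℕ), (u • f).coeff m ≠ 0 ∧ ∀ n, n ≠ m → (u • f).coeff n = 0 := by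
  obtain ⟨S, rfl⟩ := exists_eq_smul_sPow hf
  have hS : S ≠ 0 := by
    rintro rfl
    exact h0 (zero_smul _ _)
  obtain ⟨w, hw⟩ := PowerSeries.isUnit_divided_by_X_pow_order hS
  obtain ⟨c, hc, h⟩ := coeff_b_pow_smul_sPow (l := l) S.order.toNat
  have e : Atilde.ofPowerSeries (↑w⁻¹ : ℂ⟦X⟧) • S • sPow l =
      Atilde.b ^ S.order.toNat • sPow l := by
    rw [← powerSeries_smul_def, ← mul_smul, ← X_pow_smul]
    congr 1
    conv_lhs => rw [← PowerSeries.X_pow_order_mul_divXPowOrder (f := S), ← hw]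
    rw [mul_comm, mul_assoc, Units.mul_inv, mul_one]
  refine ⟨Atilde.ofPowerSeries (↑w⁻¹ : ℂ⟦X⟧), S.order.toNat, ?_, ?_⟩
  · rw [e, h, if_pos rfl]
    simpa using hc
  · intro n hn
    rw [e, h, if_neg hn]

lemma isABModule_of_logDer {k : ℕ} {f : F →ₗ[Atilde] Expansion l} (hf : Function.Injective f)
    (h1 : ∀ x, (logDer l ^ k) (f x) = 0) : IsABModule F :=
  (isABModule_logFilt l k).of_injective (i := f.codRestrict _ h1)
    ((LinearMap.injective_codRestrict_iff _).2 hf)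

/-- The rank of a module of expansions is determined by the powers of `Log s`. -/
lemma rank_eq_of_logDer {k : ℕ} {f : F →ₗ[Atilde] Expansion l} (hf : Function.Injective f)
    (h1 : ∀ x, (logDer l ^ k) (f x) = 0)
    (h2 : k = 0 ∨ ∃ x, (logDer l ^ (k - 1)) (f x) ≠ 0) : rank F = k := by
  induction k generalizing F with
  | zero => exact rank_eq_zero_of_forall fun x => hf (by simpa using h1 x)
  | succ k ih =>
    obtain ⟨x, hx⟩ : ∃ x, (logDer l ^ k) (f x) ≠ 0 := by simpa using h2
    -- The image of `g` is nonzero and free of logarithms, hence of rank one; its kernel is the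
    -- submodule with fewer logarithms, to which the induction applies once it is shown to reach the
    -- next lower power of `Log s`.
    let g : F →ₗ[Atilde] Expansion l := (logDer l ^ k) ∘ₗ f
    have hg : ∀ x, (logDer l ^ 1) (g x) = 0 := by
      intro x
      change (logDer l ^ 1) ((logDer l ^ k) (f x)) = 0
      rw [← Module.End.mul_apply, ← pow_add, add_comm, h1]
    have hr : ∀ y : LinearMap.range g, (logDer l ^ 1) ((LinearMap.range g).subtype y) = 0 := by
      rintro ⟨_, x, rfl⟩
      exact hg x
    have hrange : rank (LinearMap.range g) = 1 := by
      have hle := rank_le_of_injective (isABModule_logFilt l 1)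
        (i := (LinearMap.range g).subtype.codRestrict _ hr)
        ((LinearMap.injective_codRestrict_iff _).2 Subtype.val_injective)
      have hne : rank (LinearMap.range g) ≠ 0 := by
        intro h0
        have := eq_zero_of_rank_eq_zero (isABModule_of_logDer (k := 1) (f := (LinearMap.range g).subtype)
          Subtype.val_injective hr) h0 ⟨g x, x, rfl⟩
        exact hx (congrArg Subtype.val this)
      have := rank_logFilt_one_le l
      omega
    have hker : rank (LinearMap.ker g) = k := by
      refine ih (F := LinearMap.ker g) (f := f ∘ₗ (LinearMap.ker g).subtype)
        (hf.comp Subtype.val_injective) (fun x => x.2) ?_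
      rcases k with _ | k
      · exact Or.inl rfl
      · refine Or.inr ?_
        obtain ⟨u, m, hm, hn⟩ := exists_smul_homogeneous (hg x) hx
        -- `a - (λ + m) b` is `b (b⁻¹ a - (λ + m))`. It kills the monomial `g (u • x)`, and on the
        -- coefficient of `s ^ (λ - 1 + m)` the operator `b⁻¹ a - (λ + m)` is `d/dLog s`, so that
        -- exactly one power of `Log s` is lost there.
        let z : F := (Atilde.a - algebraMap ℂ Atilde (((l.1 : ℚ) : ℂ) + m) * Atilde.b) • u • x
        have hz : ∀ y : Expansion l,
            (Atilde.a - algebraMap ℂ Atilde (((l.1 : ℚ) : ℂ) + m) * Atilde.b) • y =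
            Atilde.b • (euler l y - (((l.1 : ℚ) : ℂ) + m) • y) := by
          intro y
          rw [sub_smul, mul_smul, algebraMap_smul, smul_sub, b_smul_euler, atilde_smul_comm]
        have hgu : g (u • x) = u • g x := map_smul _ _ _
        have hzk : g z = 0 := by
          change g ((Atilde.a - algebraMap ℂ Atilde (((l.1 : ℚ) : ℂ) + m) * Atilde.b) • u • x) = 0
          rw [map_smul, hz, hgu]
          have : euler l (u • g x) - (((l.1 : ℚ) : ℂ) + m) • u • g x = 0 := by
            refine ext_coeff fun n => ?_
            have hd : Polynomial.derivative ((u • g x).coeff n) = 0 := by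
              have h3 : (logDer l ^ 1) (u • g x) = 0 := by rw [map_smul, hg, smul_zero]
              rw [← coeff_logDer, ← pow_one (logDer l), h3, coeff_zero]
            rw [coeff_sub, coeff_euler, coeff_smul, coeff_zero, hd, add_zero]
            by_cases h : n = m
            · subst h; exact sub_self _
            · have h4 : (u • g x).coeff n = 0 := hn n h
              rw [h4, smul_zero, smul_zero, sub_zero]
          rw [this, smul_zero]
        refine ⟨⟨z, hzk⟩, ?_⟩
        intro h0
        have h5 : (logDer l ^ k)
            (f ((Atilde.a - algebraMap ℂ Atilde (((l.1 : ℚ) : ℂ) + m) * Atilde.b) • u • x)) = 0 :=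
          h0
        rw [map_smul, map_smul, hz] at h5
        have h6 := b_smul_injective (h5.trans (smul_zero Atilde.b).symm)
        have h7 := congrArg (fun y => Expansion.coeff y m) h6
        simp only [coeff_sub, coeff_euler, coeff_smul, coeff_zero, add_sub_cancel_left] at h7
        refine hm ?_
        rw [← hgu]
        change ((logDer l ^ (k + 1)) (f (u • x))).coeff m = 0
        rw [pow_succ', Module.End.mul_apply, coeff_logDer, h7]
    rw [← rank_ker_add_rank_range (isABModule_of_logDer hf h1) g, hrange, hker, add_comm]

/-- The rank is the least power of `D` that kills the image; `hk` only ensures that there is one. -/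
lemma rank_le_iff {k : ℕ} {f : F →ₗ[Atilde] Expansion l} (hf : Function.Injective f)
    (hk : ∀ x, (logDer l ^ k) (f x) = 0) (j : ℕ) :
    rank F ≤ j ↔ ∀ x, (logDer l ^ j) (f x) = 0 := by
  classical
  have hex : ∃ k, ∀ x, (logDer l ^ k) (f x) = 0 := ⟨k, hk⟩
  have hr : rank F = Nat.find hex := by
    refine rank_eq_of_logDer hf (Nat.find_spec hex) ?_
    rcases Nat.eq_zero_or_pos (Nat.find hex) with h | h
    · exact Or.inl h
    · refine Or.inr ?_
      have := Nat.find_min hex (m := Nat.find hex - 1) (by omega)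
      simpa using this
  rw [hr]
  constructor
  · intro h x
    exact logFilt_mono h (Nat.find_spec hex x)
  · exact fun h => Nat.find_min' hex h

end LogFiltration

/-! ## Exponents of simple pole modules and morphisms to expansions -/

section Exponents

open Expansion

lemma isScalarTower_moduleComplex (E : Type*) [AddCommGroup E] [Module Atilde E] :
    letI := moduleComplex E
    IsScalarTower ℂ Atilde E :=
  letI := moduleComplex E
  IsScalarTower.of_algebraMap_smul fun _ _ => rfl

section Generic

variable {M : Type*} [AddCommGroup M] [Module Atilde M]
variable {P : Type} [AddCommGroup P] [Module Atilde P] [Module ℂ P] [IsScalarTower ℂ Atilde P]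

/-- Morphisms to expansions are constrained by the polynomials `q` such that `q(b⁻¹ a)` is small
for the `b`-adic topology. -/
lemma logDer_pow_eq_zero_of_aeval (hP : IsABModule P) {θ : Module.End ℂ P}
    (hθ : ∀ x, Atilde.b • θ x = Atilde.a • x) {i : M →ₗ[Atilde] P} (hi : Function.Injective i)
    {l : Expo} {j : ℕ}
    (hq : ∀ n : ℕ, ∃ q : ℂ[X], q ≠ 0 ∧ (∀ x, ∃ y, Polynomial.aeval θ q x = Atilde.b ^ n • y) ∧
      ∀ p : ℕ, q.rootMultiplicity (((l.1 : ℚ) : ℂ) + p) ≤ j)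
    (φ : M →ₗ[Atilde] Expansion l) (x : M) : (logDer l ^ j) (φ x) = 0 := by
  refine mem_logFilt_iff_coeff.2 fun p => ?_
  obtain ⟨K, hK⟩ := exists_artin_rees hP i hi
  -- `K` powers of `b` are lost when divisibility is brought from `P` back to `M`; the `p + 1`
  -- remaining ones make the coefficient of index `p` vanish.
  obtain ⟨q, hq0, hq1, hq2⟩ := hq (p + 1 + K)
  obtain ⟨k, u, hu⟩ := exists_smul_eq_b_pow_smul_aeval q
  obtain ⟨y, hy⟩ := hq1 (i x)
  have h1 : i (u • x) = Atilde.b ^ (k + (p + 1) + K) • y := by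
    -- Only `u`, and not `q(b⁻¹ a)`, acts on `M`, which need not have a simple pole; the factor `b ^
    -- k` that it carries is cancelled in the target.
    rw [map_smul, hu P θ hθ, hy, ← mul_smul, ← pow_add, ← add_assoc]
  obtain ⟨w, hw⟩ := hK _ _ _ h1
  have h2 : Atilde.b ^ k • Polynomial.aeval (euler l) q (φ x) =
      Atilde.b ^ k • Atilde.b ^ (p + 1) • φ w := by
    rw [← hu (Expansion l) (euler l) b_smul_euler, ← map_smul, hw, map_smul, pow_add, mul_smul]
  have h3 := b_pow_smul_injective b_smul_injective k h2
  have h4 : (Polynomial.aeval (euler l) q (φ x)).coeff p = 0 := by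
    rw [h3]
    exact coeff_b_pow_smul _ _ p (Nat.lt_succ_self p)
  rw [coeff_aeval_euler] at h4
  exact derivative_pow_eq_zero_of_aeval hq0 (hq2 p) h4

variable (P) in
/-- For all `n`, the operator `b⁻¹ a` on `E / b ^ n E` is annihilated by a polynomial all of whose
roots have order at most `j`. -/
def HasExponents (j : ℕ) : Prop :=
  ∀ θ : Module.End ℂ P, (∀ x, Atilde.b • θ x = Atilde.a • x) → ∀ n : ℕ, ∃ Λ : Finset ℂ, ∀ x, ∃ y,
    Polynomial.aeval θ ((∏ ν ∈ Λ, (Polynomial.X - Polynomial.C ν)) ^ j) x = Atilde.b ^ n • y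

/-- A product of linear factors over a set has simple roots, so its `j`-th power has roots of order
at most `j`. -/
lemma logDer_pow_eq_zero_of_hasExponents (hP : IsABModule P) (hs : HasSimplePole P) {j : ℕ}
    (he : HasExponents P j) {i : M →ₗ[Atilde] P} (hi : Function.Injective i)
    {l : Expo} (φ : M →ₗ[Atilde] Expansion l) (x : M) : (logDer l ^ j) (φ x) = 0 := by
  obtain ⟨θ, hθ⟩ := exists_euler hP.b_injective hs
  refine logDer_pow_eq_zero_of_aeval hP hθ hi (fun n => ?_) φ x
  obtain ⟨Λ, hΛ⟩ := he θ hθ n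
  have hmonic : (∏ ν ∈ Λ, (Polynomial.X - Polynomial.C ν) : ℂ[X]).Monic :=
    Polynomial.monic_prod_of_monic _ _ fun ν _ => Polynomial.monic_X_sub_C ν
  refine ⟨_, (hmonic.pow j).ne_zero, hΛ, fun p => ?_⟩
  rw [← Polynomial.count_roots, Polynomial.roots_pow, Multiset.count_nsmul,
    Polynomial.roots_prod_X_sub_C]
  exact (Nat.mul_le_mul_left j (Multiset.nodup_iff_count_le_one.1 Λ.nodup _)).trans
    (mul_one j).le

end Generic

/-- The union of the sets of exponents serves all factors at once. Taking a union of sets rather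
than a product of polynomials is what keeps the order of the roots at `j`. -/
lemma HasExponents.pi {n j : ℕ} {M : Fin n → Type} [∀ i, AddCommGroup (M i)]
    [∀ i, Module Atilde (M i)] [∀ i, Module ℂ (M i)] [∀ i, IsScalarTower ℂ Atilde (M i)]
    (hM : ∀ i, IsABModule (M i)) (hs : ∀ i, HasSimplePole (M i))
    (he : ∀ i, HasExponents (M i) j) : HasExponents (∀ i, M i) j := by
  classical
  intro θ hθ N
  choose η hη using fun i => exists_euler (hM i).b_injective (hs i)
  choose Λ hΛ using fun i => he i (η i) (hη i) N
  refine ⟨Finset.univ.biUnion Λ, fun x => ?_⟩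
  have key : ∀ i, ∃ y, Polynomial.aeval (η i)
      ((∏ ν ∈ Finset.univ.biUnion Λ, (Polynomial.X - Polynomial.C ν)) ^ j) (x i) =
      Atilde.b ^ N • y := by
    intro i
    obtain ⟨r, hr⟩ := pow_dvd_pow_of_dvd (Finset.prod_dvd_prod_of_subset (Λ i)
      (Finset.univ.biUnion Λ) (fun ν => (Polynomial.X - Polynomial.C ν : ℂ[X]))
      (Finset.subset_biUnion_of_mem Λ (Finset.mem_univ i))) j
    rw [hr, map_mul, Module.End.mul_apply]
    exact hΛ i _
  choose y hy using key
  refine ⟨y, funext fun i => ?_⟩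
  exact (euler_comm (hM i).b_injective hθ (hη i) (LinearMap.proj i) _ x).trans (hy i)

/-- On the coefficient of `s ^ (λ - 1 + m)` the factor `(b⁻¹ a - λ - m) ^ j` is `(d/dLog s) ^ j`,
which is zero on `logFilt l j`. The first `n` coefficients vanish, which amounts to divisibility by
`b ^ n`. -/
lemma exists_aeval_eq_b_pow_smul_logFilt (l : Expo) (j : ℕ) {θ : Module.End ℂ (logFilt l j)}
    (hθ : ∀ x, Atilde.b • θ x = Atilde.a • x) (n : ℕ) (x : logFilt l j) :
    ∃ y, Polynomial.aeval θ ((∏ ν ∈ (Finset.range n).image fun m : ℕ => ((l.1 : ℚ) : ℂ) + m,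
      (Polynomial.X - Polynomial.C ν)) ^ j) x = Atilde.b ^ n • y := by
  have h := fun q => euler_comm b_smul_injective hθ b_smul_euler (logFilt l j).subtype q x
  obtain ⟨g, hg, hg'⟩ := exists_mem_logFilt_eq_b_pow_smul n
    (Polynomial.aeval θ ((∏ ν ∈ (Finset.range n).image fun m : ℕ => ((l.1 : ℚ) : ℂ) + m,
      (Polynomial.X - Polynomial.C ν)) ^ j) x).2 (by
    intro m hm
    obtain ⟨r, hr⟩ := pow_dvd_pow_of_dvd (Finset.dvd_prod_of_mem
      (fun ν => (Polynomial.X - Polynomial.C ν : ℂ[X])) (Finset.mem_image_of_mem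
        (fun m : ℕ => ((l.1 : ℚ) : ℂ) + m) (Finset.mem_range.2 hm))) j
    have h1 := h ((Polynomial.X - Polynomial.C (((l.1 : ℚ) : ℂ) + m)) ^ j * r)
    rw [← hr] at h1
    refine (congrArg (fun f => Expansion.coeff f m) h1).trans ?_
    rw [hr, coeff_aeval_euler, mul_comm, Polynomial.mul_comp, Polynomial.pow_comp,
      Polynomial.sub_comp, Polynomial.X_comp, Polynomial.C_comp, add_sub_cancel_right, map_mul,
      Module.End.mul_apply, map_pow, Polynomial.aeval_X]
    have h2 := mem_logFilt_iff_coeff.1 x.2 m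
    exact (congrArg _ h2).trans (map_zero _))
  exact ⟨⟨g, hg⟩, Subtype.ext hg'⟩

lemma hasExponents_logFilt (l : Expo) (j : ℕ) : HasExponents (logFilt l j) j :=
  fun _ hθ n => ⟨_, exists_aeval_eq_b_pow_smul_logFilt l j hθ n⟩

/-- Morphisms between modules of expansions do not raise the powers of `Log s`. -/
lemma logDer_pow_eq_zero_of_jointly_injective {M : Type*} [AddCommGroup M] [Module Atilde M]
    {n j : ℕ} {L : Fin n → Expo} {f : ∀ i, M →ₗ[Atilde] Expansion (L i)}
    (hf : ∀ x, (∀ i, f i x = 0) → x = 0) (hj : ∀ i x, (logDer (L i) ^ j) (f i x) = 0)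
    {l : Expo} (φ : M →ₗ[Atilde] Expansion l) (x : M) : (logDer l ^ j) (φ x) = 0 := by
  let i : M →ₗ[Atilde] (∀ i, logFilt (L i) j) :=
    LinearMap.pi fun i => (f i).codRestrict (logFilt (L i) j) (hj i)
  have hi : Function.Injective i := by
    rw [← LinearMap.ker_eq_bot, LinearMap.ker_eq_bot']
    intro x hx
    exact hf x fun i => congrArg Subtype.val (congrFun hx i)
  refine logDer_pow_eq_zero_of_hasExponents
    (IsABModule.pi fun i => isABModule_logFilt (L i) j) ?_
    (HasExponents.pi (fun i => isABModule_logFilt (L i) j) (fun i => hasSimplePole_logFilt (L i) j)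
      fun i => hasExponents_logFilt (L i) j) hi φ x
  intro x
  choose y hy using fun i => hasSimplePole_logFilt (L i) j (x i)
  exact ⟨y, funext hy⟩

/-! ## Semi-simple modules -/

section RankOne

attribute [local instance] modulePowerSeries

lemma exists_generator_of_rank_one {M : Type*} [AddCommGroup M] [Module Atilde M]
    (h : IsABModule M) (hr : rank M = 1) : ∃ e : M, e ≠ 0 ∧ ∀ x, ∃ S : ℂ⟦X⟧, x = S • e := by
  have := h.1
  have := h.2
  let B := Module.finBasisOfFinrankEq ℂ⟦X⟧ M hr
  refine ⟨B 0, B.ne_zero 0, fun x => ⟨B.repr x 0, ?_⟩⟩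
  conv_lhs => rw [← B.sum_repr x]
  simp

lemma exists_powerSeries_eq (S : ℂ⟦X⟧) :
    ∃ S' : ℂ⟦X⟧, S = PowerSeries.C (PowerSeries.constantCoeff S) + PowerSeries.X * S' := by
  have h : PowerSeries.X ∣ S - PowerSeries.C (PowerSeries.constantCoeff S) := by
    rw [PowerSeries.X_dvd_iff]; simp
  obtain ⟨S', hS'⟩ := h
  exact ⟨S', by rw [← hS']; ring⟩

lemma powerSeries_smul_comm {M : Type*} [AddCommGroup M] [Module Atilde M] (k : ℕ) (S : ℂ⟦X⟧)
    (x : M) : S • Atilde.b ^ k • x = Atilde.b ^ k • S • x := by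
  rw [← X_pow_smul, ← X_pow_smul, smul_comm]

/-- For a generator `e` write `a e = S e`. If `S` were a unit, `e` would become infinitely divisible
by `b` in a simple pole module containing `M`, hence zero; so `b` divides `S`. -/
lemma IsRegular.exists_a_smul_of_rank_one {M : Type*} [AddCommGroup M] [Module Atilde M]
    (h : IsRegular M) (hr : rank M = 1) : ∃ (e : M) (S : ℂ⟦X⟧),
      (∀ x, ∃ T : ℂ⟦X⟧, x = T • e) ∧ Atilde.a • e = Atilde.b • S • e := by
  obtain ⟨hM, G, _, _, i, hG, hs, hi⟩ := h
  obtain ⟨e, he0, he⟩ := exists_generator_of_rank_one hM hr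
  obtain ⟨S, hS⟩ := he (Atilde.a • e)
  by_cases h0 : PowerSeries.constantCoeff S = 0
  · obtain ⟨S', hS'⟩ := exists_powerSeries_eq S
    refine ⟨e, S', he, ?_⟩
    rw [hS, hS', h0, map_zero, zero_add, mul_smul, X_smul]
  · exfalso
    obtain ⟨w, rfl⟩ := PowerSeries.isUnit_iff_constantCoeff.2 (isUnit_iff_ne_zero.2 h0)
    refine he0 (hi ((?_ : i e = 0).trans (map_zero i).symm))
    -- In a module with a simple pole `a` maps `b ^ k G` into `b ^ (k + 1) G`, while here `a` acts
    -- on `e` as a unit.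
    have key : ∀ k : ℕ, ∃ y, i e = Atilde.b ^ k • y := by
      intro k
      induction k with
      | zero => exact ⟨i e, by simp⟩
      | succ k ih =>
        obtain ⟨y, hy⟩ := ih
        obtain ⟨z, hz⟩ := hs y
        have h1 : (w : ℂ⟦X⟧) • i e = Atilde.b ^ (k + 1) • (z + (k : Atilde) • y) := by
          have h2 : (w : ℂ⟦X⟧) • i e = Atilde.a • i e :=
            ((toPS i).map_smul (w : ℂ⟦X⟧) e).symm.trans
              ((congrArg i hS.symm).trans (i.map_smul _ _))
          have h3 : (k : Atilde) • Atilde.b ^ (k + 1) • y =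
              Atilde.b ^ (k + 1) • (k : Atilde) • y := by
            rw [← mul_smul, ← mul_smul, Nat.cast_comm]
          rw [h2, hy, a_smul_b_pow_smul, hz, ← mul_smul, ← pow_succ, smul_add, h3]
        refine ⟨(↑w⁻¹ : ℂ⟦X⟧) • (z + (k : Atilde) • y), ?_⟩
        rw [← powerSeries_smul_comm, ← h1, ← mul_smul, Units.inv_mul, one_smul]
    have := mem_of_forall_exists_b_pow hG ⊥ (i e) fun n => by
      obtain ⟨y, hy⟩ := key n
      exact ⟨0, Submodule.zero_mem _, y, by rw [zero_add, hy]⟩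
    simpa using this

lemma exists_eq_smul_add_b_smul {M : Type*} [AddCommGroup M] [Module Atilde M] {e : M}
    (he : ∀ x, ∃ T : ℂ⟦X⟧, x = T • e) (x : M) :
    ∃ (c : ℂ) (y : M), x = algebraMap ℂ Atilde c • e + Atilde.b • y := by
  obtain ⟨T, rfl⟩ := he x
  obtain ⟨T', hT'⟩ := exists_powerSeries_eq T
  refine ⟨PowerSeries.constantCoeff T, T' • e, ?_⟩
  conv_lhs => rw [hT', add_smul, mul_smul, X_smul]
  rfl

lemma IsRegular.hasSimplePole_of_rank_one {M : Type*} [AddCommGroup M] [Module Atilde M]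
    (h : IsRegular M) (hr : rank M = 1) : HasSimplePole M := by
  obtain ⟨e, S, he, hS⟩ := h.exists_a_smul_of_rank_one hr
  intro x
  obtain ⟨c, y, rfl⟩ := exists_eq_smul_add_b_smul he x
  refine ⟨algebraMap ℂ Atilde c • S • e + (Atilde.a • y + Atilde.b • y), ?_⟩
  rw [smul_add, smul_add, smul_add, ← mul_smul, ← Algebra.commutes, mul_smul, hS,
    ← mul_smul Atilde.a, Atilde.a_mul_b, add_smul, mul_smul, mul_smul,
    ← mul_smul, Algebra.commutes, mul_smul]

/-- On the line `M / b M` the operator `b⁻¹ a` is a scalar `μ`, so modulo `b ^ n` its exponents are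
`μ, μ + 1, …, μ + n - 1`. These are distinct, whence simple roots. -/
lemma IsRegular.hasExponents_of_rank_one {M : Type} [AddCommGroup M] [Module Atilde M] [Module ℂ M]
    [IsScalarTower ℂ Atilde M] (h : IsRegular M) (hr : rank M = 1) : HasExponents M 1 := by
  classical
  obtain ⟨e, S, he, hS⟩ := h.exists_a_smul_of_rank_one hr
  intro θ hθ n
  have hb := h.1.b_injective
  obtain ⟨S', hS'⟩ := exists_powerSeries_eq S
  set μ := PowerSeries.constantCoeff S
  have hθe : θ e = algebraMap ℂ Atilde μ • e + Atilde.b • S' • e := by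
    refine hb ((hθ e).trans (hS.trans ?_))
    change _ = Atilde.b • (algebraMap ℂ Atilde μ • e + Atilde.b • S' • e)
    rw [hS', add_smul, mul_smul, X_smul]
    rfl
  have h1 : ∀ x, ∃ y, Polynomial.aeval θ (Polynomial.X - Polynomial.C μ) x = Atilde.b • y := by
    intro x
    obtain ⟨c, y, rfl⟩ := exists_eq_smul_add_b_smul he x
    have h2 : θ (Atilde.b • y) = Atilde.b • (θ y + y) := by
      have := euler_b_pow_smul hb hθ 1 y
      simpa using this
    refine ⟨c • S' • e + (θ y + y) - μ • y, ?_⟩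
    rw [map_sub, Polynomial.aeval_X, Polynomial.aeval_C, LinearMap.sub_apply,
      Module.algebraMap_end_apply, map_add, h2, algebraMap_smul, map_smul, hθe, algebraMap_smul]
    simp only [smul_add, smul_sub, atilde_smul_comm]
    rw [smul_comm c μ e]
    abel
  refine ⟨(Finset.range n).image fun m : ℕ => μ + (m : ℂ), fun x => ?_⟩
  have h2 := exists_eq_b_pow_smul_of_prod_shift hb hθ h1 n x
  rw [pow_one, Finset.prod_image (by intro a _ b _ hab; simpa using hab)]
  convert h2 using 5 with y
  refine Finset.prod_congr rfl fun m _ => ?_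
  rw [Polynomial.sub_comp, Polynomial.X_comp, Polynomial.C_comp, map_add]
  ring

end RankOne

/-! ### Semi-simplicity and the absence of logarithms -/

lemma IsSemiSimple.logDer_eq_zero {M : Type*} [AddCommGroup M] [Module Atilde M]
    (h : IsSemiSimple M) {l : Expo} (φ : M →ₗ[Atilde] Expansion l) (x : M) :
    (logDer l ^ 1) (φ x) = 0 := by
  obtain ⟨n, N, _, _, f, hN, hf⟩ := h
  let _ := fun i => moduleComplex (N i)
  have := fun i => isScalarTower_moduleComplex (N i)
  refine logDer_pow_eq_zero_of_hasExponents (IsABModule.pi fun i => (hN i).1.1) ?_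
    (HasExponents.pi (fun i => (hN i).1.1) (fun i => (hN i).1.hasSimplePole_of_rank_one (hN i).2)
      fun i => (hN i).1.hasExponents_of_rank_one (hN i).2) hf φ x
  intro x
  choose y hy using fun i => (hN i).1.hasSimplePole_of_rank_one (hN i).2 (x i)
  exact ⟨y, funext hy⟩

/-- The kernel of `D ∘ φ` is a submodule containing the generators of `ssPart M`; it is not needed
that the elements generating semi-simple modules are themselves closed under addition. -/
lemma logDer_eq_zero_of_mem_ssPart {M : Type*} [AddCommGroup M] [Module Atilde M] {l : Expo}
    (φ : M →ₗ[Atilde] Expansion l) {x : M} (hx : x ∈ ssPart M) : (logDer l ^ 1) (φ x) = 0 := by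
  have hle : ssPart M ≤ LinearMap.ker ((logDer l ^ 1) ∘ₗ φ) := by
    refine Submodule.span_le.2 fun y hy => ?_
    have h := IsSemiSimple.logDer_eq_zero hy (φ ∘ₗ (Submodule.span Atilde {y}).subtype)
      ⟨y, Submodule.mem_span_singleton_self y⟩
    exact h
  exact hle hx

lemma rank_logFilt_one (l : Expo) : rank (logFilt l 1) = 1 := by
  refine rank_eq_of_logDer (f := (logFilt l 1).subtype) Subtype.val_injective (fun x => x.2)
    (Or.inr ?_)
  have hs : sPow l ∈ logFilt l 1 := by
    rw [mem_logFilt_iff_coeff]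
    intro n
    by_cases h : n = 0 <;> simp [sPow, h]
  refine ⟨⟨sPow l, hs⟩, fun h => ?_⟩
  have h1 : (sPow l).coeff 0 = 0 := congrArg (fun f => Expansion.coeff f 0) h
  simp [sPow] at h1

/-- The modules `logFilt (L i) 1` are regular of rank one, and `M` embeds in their direct sum. -/
lemma isSemiSimple_of_jointly_injective {M : Type*} [AddCommGroup M] [Module Atilde M]
    {n : ℕ} {L : Fin n → Expo} {f : ∀ i, M →ₗ[Atilde] Expansion (L i)}
    (hf : ∀ x, (∀ i, f i x = 0) → x = 0) (hj : ∀ i x, (logDer (L i) ^ 1) (f i x) = 0) :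
    IsSemiSimple M := by
  refine ⟨n, fun i => logFilt (L i) 1, inferInstance, inferInstance,
    LinearMap.pi fun i => (f i).codRestrict (logFilt (L i) 1) (hj i), fun i => ⟨⟨?_, ?_⟩, ?_⟩, ?_⟩
  · exact isABModule_logFilt _ _
  · exact ⟨logFilt (L i) 1, inferInstance, inferInstance, LinearMap.id, isABModule_logFilt _ _,
      hasSimplePole_logFilt _ _, fun _ _ h => h⟩
  · exact rank_logFilt_one _
  · rw [← LinearMap.ker_eq_bot, LinearMap.ker_eq_bot']
    intro x hx
    exact hf x fun i => congrArg Subtype.val (congrFun hx i)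

/-- The semi-simple filtration in terms of a finite family of morphisms to expansions. -/
lemma mem_ssFilt_iff {E : Type*} [AddCommGroup E] [Module Atilde E]
    {n : ℕ} {L : Fin n → Expo} {f : ∀ i, E →ₗ[Atilde] Expansion (L i)}
    (hf : ∀ x, (∀ i, f i x = 0) → x = 0)
    (j : ℕ) (x : E) : x ∈ ssFilt E j ↔ ∀ i, (logDer (L i) ^ j) (f i x) = 0 := by
  induction j generalizing x with
  | zero =>
    constructor
    · intro h i
      have h' : x = 0 := h
      rw [h', map_zero, map_zero]
    · exact fun h => hf x h
  | succ j ih =>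
    -- By the induction hypothesis `D ^ j` kills the coordinates on `S_j(E)`, hence every morphism
    -- on it. The maps `D ^ j ∘ f i` therefore descend to `E / S_j(E)`.
    have hhom : ∀ {l : Expo} (φ : E →ₗ[Atilde] Expansion l),
        ssFilt E j ≤ LinearMap.ker ((logDer l ^ j) ∘ₗ φ) := by
      intro l φ y hy
      exact logDer_pow_eq_zero_of_jointly_injective
        (f := fun i => f i ∘ₗ (ssFilt E j).subtype)
        (fun z hz => Subtype.ext (hf z.1 hz)) (fun i z => (ih z.1).1 z.2 i)
        (φ ∘ₗ (ssFilt E j).subtype) ⟨y, hy⟩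
    have e : x ∈ ssFilt E (j + 1) ↔ (ssFilt E j).mkQ x ∈ ssPart (E ⧸ ssFilt E j) := Iff.rfl
    rw [e]
    constructor
    · intro hx i
      obtain ⟨ψ, hψ⟩ : ∃ ψ : E ⧸ ssFilt E j →ₗ[Atilde] Expansion (L i),
          ∀ y, ψ ((ssFilt E j).mkQ y) = (logDer (L i) ^ j) (f i y) :=
        ⟨(ssFilt E j).liftQ _ (hhom (f i)), fun y => rfl⟩
      have h1 := logDer_eq_zero_of_mem_ssPart ψ hx
      rwa [hψ, ← Module.End.mul_apply, ← pow_add, add_comm] at h1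
    · intro hx
      refine Submodule.subset_span ?_
      obtain ⟨ψ, hψ⟩ : ∃ ψ : ∀ i, E ⧸ ssFilt E j →ₗ[Atilde] Expansion (L i),
          ∀ i y, ψ i ((ssFilt E j).mkQ y) = (logDer (L i) ^ j) (f i y) :=
        ⟨fun i => (ssFilt E j).liftQ _ (hhom (f i)), fun i y => rfl⟩
      -- By the induction hypothesis the descended maps are jointly injective. On the module
      -- generated by the class of `x` they have no logarithms, which makes it semi-simple.
      have hψ0 : ∀ y, (∀ i, ψ i y = 0) → y = 0 := by
        intro y hy
        obtain ⟨y, rfl⟩ := (ssFilt E j).mkQ_surjective y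
        exact (Submodule.Quotient.mk_eq_zero _).2 ((ih y).2 fun i => by rw [← hψ, hy])
      have hψ1 : ∀ i, ∀ y ∈ Submodule.span Atilde {(ssFilt E j).mkQ x},
          (logDer (L i) ^ 1) (ψ i y) = 0 := by
        intro i y hy
        obtain ⟨u, rfl⟩ := Submodule.mem_span_singleton.1 hy
        rw [map_smul, map_smul, hψ, ← Module.End.mul_apply, ← pow_add, add_comm, hx i, smul_zero]
      change IsSemiSimple (Submodule.span Atilde {(ssFilt E j).mkQ x})
      generalize Submodule.span Atilde {(ssFilt E j).mkQ x} = Y at hψ1 ⊢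
      exact isSemiSimple_of_jointly_injective (L := L) (f := fun i => ψ i ∘ₗ Y.subtype)
        (fun z hz => Subtype.ext (hψ0 z.1 hz)) fun i y => hψ1 i y.1 y.2

end Exponents

/-! ## Themes -/

section Themes

open Expansion

variable {l : Expo} {F : Type*} [AddCommGroup F] [Module Atilde F]

/-- Normality says that the quotient has no `b`-torsion. -/
lemma isNormal_iff (hb : Function.Injective fun x : F => Atilde.b • x) (A : Submodule Atilde F) :
    IsNormal A ↔ ∀ y, Atilde.b • y ∈ A → y ∈ A := by
  constructor
  · intro h y hy
    have h1 : Atilde.b • y ∈ {x : F | x ∈ A ∧ ∃ y : F, x = Atilde.b • y} := ⟨hy, y, rfl⟩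
    rw [h] at h1
    obtain ⟨z, hz, hyz⟩ := h1
    rwa [hb hyz]
  · intro h
    ext x
    constructor
    · rintro ⟨hx, y, rfl⟩
      exact ⟨y, h y hx, rfl⟩
    · rintro ⟨y, hy, rfl⟩
      exact ⟨A.smul_mem _ hy, y, rfl⟩

lemma isABModule_quotient_of_isNormal (hF : IsABModule F) {A : Submodule Atilde F}
    (hA : IsNormal A) : IsABModule (F ⧸ A) := by
  refine isABModule_iff.2 ⟨?_, ?_⟩
  · intro x y hxy
    obtain ⟨x, rfl⟩ := A.mkQ_surjective x
    obtain ⟨y, rfl⟩ := A.mkQ_surjective y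
    have h : A.mkQ (Atilde.b • x) = A.mkQ (Atilde.b • y) := by simpa using hxy
    rw [← sub_eq_zero, ← map_sub, ← smul_sub] at h
    have h1 := (isNormal_iff hF.b_injective A).1 hA _ ((Submodule.Quotient.mk_eq_zero A).1 h)
    rw [← sub_eq_zero, ← map_sub]
    exact (Submodule.Quotient.mk_eq_zero A).2 h1
  · let _ := modulePowerSeries F
    let _ := modulePowerSeries (F ⧸ A)
    have := hF.finite
    exact Module.Finite.of_surjective (toPS A.mkQ) A.mkQ_surjective

/-- Normal submodules are determined by their rank among the submodules containing them. -/
lemma le_of_isNormal_of_rank_le (hF : IsABModule F) {A T : Submodule Atilde F} (hA : IsNormal A)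
    (hAT : A ≤ T) (hr : rank T ≤ rank A) : T ≤ A := by
  have hT : IsABModule T := hF.of_injective (i := T.subtype) Subtype.val_injective
  -- The image of `T` in `F / A` has rank zero and, `A` being normal, no torsion; so it is zero.
  let g : T →ₗ[Atilde] F ⧸ A := A.mkQ ∘ₗ T.subtype
  have h1 := rank_ker_add_rank_range hT g
  have h2 : rank A ≤ rank (LinearMap.ker g) := by
    have hmem : ∀ x : A, (Submodule.inclusion hAT) x ∈ LinearMap.ker g := fun x =>
      (Submodule.Quotient.mk_eq_zero A).2 x.2
    refine rank_le_of_injective (hT.of_injective (i := (LinearMap.ker g).subtype)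
      Subtype.val_injective) (i := (Submodule.inclusion hAT).codRestrict _ hmem) ?_
    exact (LinearMap.injective_codRestrict_iff _).2 (Submodule.inclusion_injective hAT)
  intro x hx
  have h3 := eq_zero_of_rank_eq_zero ((isABModule_quotient_of_isNormal hF hA).of_injective
    (i := (LinearMap.range g).subtype) Subtype.val_injective) (by omega) ⟨g ⟨x, hx⟩, ⟨x, hx⟩, rfl⟩
  exact (Submodule.Quotient.mk_eq_zero A).1 (congrArg Subtype.val h3)

/-- The kernel of `D ^ j` is normal of rank at most `j` and contains every submodule of rank at most
`j`. If the rank of the theme exceeds `j`, the image of `D ^ j` has rank at most `rank F - j`, so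
the kernel has rank exactly `j`. -/
lemma isNormalTerm_iff {k : ℕ} {f : F →ₗ[Atilde] Expansion l} (hf : Function.Injective f)
    (hk : ∀ x, (logDer l ^ k) (f x) = 0) (j : ℕ) (A : Submodule Atilde F) :
    IsNormalTerm F j A ↔ A = LinearMap.ker ((logDer l ^ j) ∘ₗ f) := by
  have hF := isABModule_of_logDer hf hk
  have hT : rank (LinearMap.ker ((logDer l ^ j) ∘ₗ f)) ≤ j :=
    (rank_le_iff (f := f ∘ₗ (LinearMap.ker ((logDer l ^ j) ∘ₗ f)).subtype)
      (hf.comp Subtype.val_injective) (fun x => hk x) j).2 fun x => x.2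
  constructor
  · rintro (⟨hr, rfl⟩ | ⟨hr, hA, hrA⟩)
    · exact (eq_top_iff.2 fun x _ => (rank_le_iff hf hk j).1 hr x).symm
    · have hle : A ≤ LinearMap.ker ((logDer l ^ j) ∘ₗ f) := fun x hx =>
        (rank_le_iff (f := f ∘ₗ A.subtype) (hf.comp Subtype.val_injective) (fun x => hk x) j).1
          hrA.le ⟨x, hx⟩
      exact le_antisymm hle (le_of_isNormal_of_rank_le hF hA hle (by omega))
  · rintro rfl
    rcases le_or_gt (rank F) j with hr | hr
    · exact Or.inl ⟨hr, eq_top_iff.2 fun x _ => (rank_le_iff hf hk j).1 hr x⟩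
    · refine Or.inr ⟨hr, (isNormal_iff hF.b_injective _).2 fun y hy => ?_, ?_⟩
      · have h : (logDer l ^ j) (f (Atilde.b • y)) = 0 := hy
        rw [map_smul, map_smul] at h
        exact eq_zero_of_b_pow_smul (k := 1) b_smul_injective (by rwa [pow_one])
      · have h1 := rank_ker_add_rank_range hF ((logDer l ^ j) ∘ₗ f)
        have h2 : rank (LinearMap.range ((logDer l ^ j) ∘ₗ f)) ≤ rank F - j := by
          have h3 : ∀ i, j ≤ i → (∀ x, (logDer l ^ i) (f x) = 0) →
              ∀ y : LinearMap.range ((logDer l ^ j) ∘ₗ f),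
              (logDer l ^ (i - j)) ((LinearMap.range ((logDer l ^ j) ∘ₗ f)).subtype y) = 0 := by
            rintro i hi hx ⟨_, x, rfl⟩
            change (logDer l ^ (i - j)) ((logDer l ^ j) (f x)) = 0
            rw [← Module.End.mul_apply, ← pow_add, Nat.sub_add_cancel hi, hx]
          have h4 := h3 (rank F) hr.le ((rank_le_iff hf hk _).1 le_rfl)
          exact (rank_le_iff Subtype.val_injective h4 _).2 h4
        omega

lemma normalTerm_eq {k : ℕ} {f : F →ₗ[Atilde] Expansion l} (hf : Function.Injective f)
    (hk : ∀ x, (logDer l ^ k) (f x) = 0) (j : ℕ) :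
    normalTerm F j = LinearMap.ker ((logDer l ^ j) ∘ₗ f) := by
  have h : {A : Submodule Atilde F | IsNormalTerm F j A} =
      {LinearMap.ker ((logDer l ^ j) ∘ₗ f)} := by
    ext A
    exact isNormalTerm_iff hf hk j A
  rw [normalTerm, h, sSup_singleton]

/-- One takes `Λ = {λ}` and `V = ℂ`; the image of the embedding is generated by the image of `e`. -/
lemma isTheme_of_injective {e : F} (he : Submodule.span Atilde {e} = ⊤) {k : ℕ}
    {f : F →ₗ[Atilde] Expansion l} (hf : Function.Injective f)
    (hk : ∀ x, (logDer l ^ k) (f x) = 0) : IsTheme F := by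
  classical
  have hX : ∀ x, f x ∈ XiN l k := fun x => logFilt_le_XiN k (hk x)
  let L : Finset Expo := {l}
  let g : XiN l k →ₗ[Atilde] XiLN L k :=
    LinearMap.single Atilde (fun l' : L => XiN l'.1 k) ⟨l, Finset.mem_singleton_self l⟩
  let h : F →ₗ[Atilde] XiLN L k ⊗[ℂ] ℂ :=
    (TensorProduct.AlgebraTensorModule.rid ℂ Atilde (XiLN L k)).symm.toLinearMap ∘ₗ g ∘ₗ
      f.codRestrict _ hX
  have hg : Function.Injective g := by
    intro x y hxy
    have h1 : ∀ x, g x ⟨l, Finset.mem_singleton_self l⟩ = x := fun x => Pi.single_eq_same _ _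
    rw [← h1 x, hxy, h1]
  have hh : Function.Injective h := by
    intro x y hxy
    have h1 := (TensorProduct.AlgebraTensorModule.rid ℂ Atilde (XiLN L k)).symm.injective hxy
    exact (LinearMap.injective_codRestrict_iff hX).2 hf (hg h1)
  have hr : LinearMap.range h = Submodule.span Atilde {h e} := by
    rw [LinearMap.range_eq_map, ← he, Submodule.map_span, Set.image_singleton]
  exact ⟨L, k, h e, ⟨(LinearEquiv.ofInjective h hh).trans (LinearEquiv.ofEq _ _ hr)⟩⟩

/-! ## Bernstein polynomials -/

/-- An element of `G` divisible by `b` in `logFilt l k` need not be so in `G`. Divisibility by `b ^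
(1 + K)` in the large module is enough, with `K` from Artin-Rees, at the price of more exponents in
`λ + ℕ`. -/
lemma exists_aeval_eq_b_smul {G : Type*} [AddCommGroup G] [Module Atilde G] [Module ℂ G]
    [IsScalarTower ℂ Atilde G] {θ : Module.End ℂ G} (hθ : ∀ x, Atilde.b • θ x = Atilde.a • x)
    {k : ℕ} {i : G →ₗ[Atilde] logFilt l k} (hi : Function.Injective i) :
    ∃ n : ℕ, ∀ x, ∃ y, Polynomial.aeval θ
      ((∏ ν ∈ (Finset.range n).image fun m : ℕ => ((l.1 : ℚ) : ℂ) + m,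
        (Polynomial.X - Polynomial.C ν)) ^ k) x = Atilde.b • y := by
  have hP := isABModule_logFilt l k
  obtain ⟨η, hη⟩ := exists_euler hP.b_injective (hasSimplePole_logFilt l k)
  obtain ⟨K, hK⟩ := exists_artin_rees hP i hi
  refine ⟨1 + K, fun x => ?_⟩
  obtain ⟨y, hy⟩ := exists_aeval_eq_b_pow_smul_logFilt l k hη (1 + K) (i x)
  obtain ⟨w, hw⟩ := hK 1 _ y ((euler_comm hP.b_injective hθ hη i _ x).trans hy)
  exact ⟨w, by rw [hw, pow_one]⟩

section Bernstein

attribute [local instance] moduleComplex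

lemma aeval_bernstein {G : Type*} [AddCommGroup G] [Module Atilde G] {θ : Module.End ℂ G}
    (hθ : ∀ x, Atilde.b • θ x = Atilde.a • x) {t : Module.End ℂ (G ⧸ bImage G)}
    (ht : ∀ x y : G, Atilde.a • x = Atilde.b • y →
      t (Submodule.Quotient.mk x) = - Submodule.Quotient.mk y) (p : ℂ[X]) (x : G) :
    Polynomial.aeval t p (Submodule.Quotient.mk x) =
      Submodule.Quotient.mk (Polynomial.aeval θ (p.comp (-Polynomial.X)) x) := by
  induction p using Polynomial.induction_on generalizing x with
  | C c => simp [Module.algebraMap_end_apply]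
  | add p q hp hq => simp [hp, hq]
  | monomial k c ih =>
    have e : Polynomial.C c * Polynomial.X ^ (k + 1) =
      (Polynomial.C c * Polynomial.X ^ k) * Polynomial.X := by ring
    rw [e]
    generalize Polynomial.C c * Polynomial.X ^ k = r at ih
    have e2 : Polynomial.aeval θ (-Polynomial.X : ℂ[X]) x = -θ x := by simp
    rw [map_mul, Module.End.mul_apply, Polynomial.aeval_X, ht x (θ x) (hθ x).symm,
      Polynomial.mul_comp, map_mul, Module.End.mul_apply, Polynomial.X_comp, e2, map_neg, map_neg,
      ih, Submodule.Quotient.mk_neg]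

lemma exists_bernstein_operator {G : Type*} [AddCommGroup G] [Module Atilde G]
    (hb : Function.Injective fun x : G => Atilde.b • x)
    {θ : Module.End ℂ G} (hθ : ∀ x, Atilde.b • θ x = Atilde.a • x) :
    ∃ t : Module.End ℂ (G ⧸ bImage G), ∀ x y : G, Atilde.a • x = Atilde.b • y →
      t (Submodule.Quotient.mk x) = - Submodule.Quotient.mk y := by
  have hst := isScalarTower_moduleComplex G
  have hle : bImage G ≤ (bImage G).comap (-θ) := by
    rintro _ ⟨y, rfl⟩
    refine ⟨-(θ y + y), ?_⟩
    have := euler_b_pow_smul hb hθ 1 y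
    rw [pow_one, Nat.cast_one, one_smul] at this
    rw [LinearMap.neg_apply, this, smul_neg]
  refine ⟨(bImage G).mapQ (bImage G) (-θ) hle, fun x y hxy => ?_⟩
  have : θ x = y := hb ((hθ x).trans hxy)
  rw [Submodule.mapQ_apply, LinearMap.neg_apply, this, Submodule.Quotient.mk_neg]

/-- The saturation is found inside the simple pole module `logFilt l k`, where a product of powers
of factors `b⁻¹ a - (λ + m)` is divisible by `b`. This confines the roots of the Bernstein
polynomial to `-λ - ℕ`. -/
lemma isPrimitive_of_injective {k : ℕ}
    {f : F →ₗ[Atilde] Expansion l} (hf : Function.Injective f)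
    (hk : ∀ x, (logDer l ^ k) (f x) = 0) : IsPrimitive l F := by
  classical
  let i : F →ₗ[Atilde] logFilt l k := f.codRestrict _ hk
  have hi : Function.Injective i := (LinearMap.injective_codRestrict_iff _).2 hf
  have hP := isABModule_logFilt l k
  have hF : IsABModule F := hP.of_injective hi
  refine ⟨⟨hF, logFilt l k, inferInstance, inferInstance, i, hP, hasSimplePole_logFilt l k, hi⟩, ?_⟩
  -- The intersection of all simple pole submodules containing the image again has a simple pole,
  -- because the quotient by `b` is unique in `logFilt l k`.
  let H : Submodule Atilde (logFilt l k) :=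
    sInf {H | LinearMap.range i ≤ H ∧ HasSimplePole H}
  have hH : HasSimplePole H := by
    rintro ⟨x, hx⟩
    obtain ⟨y, hy⟩ := hasSimplePole_logFilt l k x
    refine ⟨⟨y, ?_⟩, Subtype.ext hy⟩
    rw [Submodule.mem_sInf] at hx ⊢
    intro H' hH'
    obtain ⟨y', hy'⟩ := hH'.2 ⟨x, hx H' hH'⟩
    have h : y = y' := hP.b_injective (hy.symm.trans (congrArg Subtype.val hy'))
    rw [h]
    exact y'.2
  have hiH : LinearMap.range i ≤ H := le_sInf fun H' hH' => hH'.1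
  have hHAB : IsABModule H := hP.of_injective (i := H.subtype) Subtype.val_injective
  have hsH := isScalarTower_moduleComplex H
  obtain ⟨θ, hθ⟩ := exists_euler hHAB.b_injective hH
  obtain ⟨t, ht⟩ := exists_bernstein_operator hHAB.b_injective hθ
  refine ⟨minpoly ℂ t, ⟨hF, H, inferInstance, inferInstance,
    i.codRestrict H (fun x => hiH ⟨x, rfl⟩), ⟨hHAB, hH, ?_, ?_⟩, t, ht, rfl⟩, ?_⟩
  · exact (LinearMap.injective_codRestrict_iff _).2 hi
  · intro K hK hKs
    have h1 : H ≤ K.map H.subtype := by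
      refine sInf_le ⟨?_, ?_⟩
      · rintro _ ⟨x, rfl⟩
        exact ⟨⟨i x, hiH ⟨x, rfl⟩⟩, hK ⟨x, rfl⟩, rfl⟩
      · rintro ⟨_, x, hx, rfl⟩
        obtain ⟨y, hy⟩ := hKs ⟨x, hx⟩
        exact ⟨⟨y.1.1, y.1, y.2, rfl⟩, Subtype.ext (congrArg (fun z => z.1.1) hy)⟩
    refine eq_top_iff.2 fun x _ => ?_
    obtain ⟨y, hy, hyx⟩ := h1 x.2
    rwa [← Subtype.ext hyx]
  · obtain ⟨n, hn⟩ := exists_aeval_eq_b_smul hθ (i := H.subtype) Subtype.val_injective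
    set q : ℂ[X] := (∏ ν ∈ (Finset.range n).image fun m : ℕ => ((l.1 : ℚ) : ℂ) + m,
      (Polynomial.X - Polynomial.C ν)) ^ k with hqdef
    have hq : Polynomial.aeval t (q.comp (-Polynomial.X)) = 0 := by
      refine LinearMap.ext fun x => ?_
      obtain ⟨x, rfl⟩ := Submodule.Quotient.mk_surjective _ x
      rw [aeval_bernstein hθ ht, Polynomial.comp_assoc, Polynomial.neg_comp, Polynomial.X_comp,
        neg_neg, Polynomial.comp_X, LinearMap.zero_apply, Submodule.Quotient.mk_eq_zero]
      exact hn x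
    intro z hz
    have h1 := Polynomial.IsRoot.dvd hz (minpoly.dvd ℂ t hq)
    rw [hqdef, Polynomial.IsRoot.def, Polynomial.eval_comp, Polynomial.eval_pow,
      Polynomial.eval_prod] at h1
    obtain ⟨ν, hν, hνz⟩ := Finset.prod_eq_zero_iff.1 (eq_zero_of_pow_eq_zero h1)
    obtain ⟨m, -, rfl⟩ := Finset.mem_image.1 hν
    refine ⟨-m, ?_⟩
    simp only [Polynomial.eval_neg, Polynomial.eval_X, Polynomial.eval_sub,
      Polynomial.eval_C] at hνz
    push_cast
    linear_combination -hνz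

/-- Two points of `]0, 1]` differ by less than `1`. -/
lemma expo_eq_of_sub_eq_int {l l' : Expo} {m : ℤ}
    (h : ((l.1 : ℚ) : ℂ) - ((l'.1 : ℚ) : ℂ) = m) : l = l' := by
  have h1 : l.1 - l'.1 = m := by exact_mod_cast h
  have hl := l.2
  have hl' := l'.2
  have h2 : (m : ℚ) < 1 := by rw [← h1]; linarith [hl.1, hl.2, hl'.1, hl'.2]
  have h3 : (-1 : ℚ) < m := by rw [← h1]; linarith [hl.1, hl.2, hl'.1, hl'.2]
  have h4 : m < 1 := by exact_mod_cast h2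
  have h5 : -1 < m := by exact_mod_cast h3
  have h6 : m = 0 := by omega
  rw [h6, Int.cast_zero, sub_eq_zero] at h1
  exact Subtype.ext h1

/-- A `[λ]`-primitive module has no morphism to expansions with other exponents. -/
lemma IsPrimitive.eq_zero_of_ne (h : IsPrimitive l F) {l' : Expo} (hl : l' ≠ l)
    (φ : F →ₗ[Atilde] Expansion l') (x : F) : φ x = 0 := by
  obtain ⟨-, B, ⟨-, G, _, _, i, ⟨hG, hs, hi, -⟩, t, ht, rfl⟩, hB⟩ := h
  have hsG := isScalarTower_moduleComplex G
  obtain ⟨θ, hθ⟩ := exists_euler hG.b_injective hs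
  have hq : ∀ x, ∃ y, Polynomial.aeval θ ((minpoly ℂ t).comp (-Polynomial.X)) x =
      Atilde.b • y := by
    intro x
    have h1 := aeval_bernstein hθ ht (minpoly ℂ t) x
    rw [minpoly.aeval, LinearMap.zero_apply] at h1
    exact (Submodule.Quotient.mk_eq_zero _).1 h1.symm
  -- With `j = 0` the conclusion is `φ x = 0`, and the condition is that no `λ' + p` be a root at
  -- all. The roots of the shifted polynomials are in `λ + ℤ`, so such a root would force `λ' = λ`.
  have h0 := logDer_pow_eq_zero_of_aeval (j := 0) hG hθ hi (l := l') (fun n => ?_) φ x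
  · exact h0
  have hroot : ∀ p : ℕ, ¬ (∏ m ∈ Finset.range n, ((minpoly ℂ t).comp (-Polynomial.X)).comp
      (Polynomial.X - Polynomial.C (m : ℂ))).IsRoot (((l'.1 : ℚ) : ℂ) + p) := by
    intro p hp
    rw [Polynomial.IsRoot.def, Polynomial.eval_prod] at hp
    obtain ⟨m, -, hm⟩ := Finset.prod_eq_zero_iff.1 hp
    simp only [Polynomial.eval_comp, Polynomial.eval_neg, Polynomial.eval_X, Polynomial.eval_sub,
      Polynomial.eval_C] at hm
    obtain ⟨c, hc⟩ := hB _ hm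
    refine hl (expo_eq_of_sub_eq_int (m := m - p - c) ?_)
    push_cast
    linear_combination -hc
  refine ⟨_, ?_, exists_eq_b_pow_smul_of_prod_shift hG.b_injective hθ hq n, fun p => ?_⟩
  · intro h
    refine hroot 0 ?_
    rw [h]
    exact Polynomial.eval_zero
  · rw [Polynomial.rootMultiplicity_eq_zero (hroot p)]

end Bernstein

/-! ## Coordinates on frescos -/

/-- The algebra acts only on the left factor, so coordinates on `V` are linear over it and separate
points. The exponent of `D` found here is `N + 1`, as `Log s` may occur to the power `N`. -/
lemma IsMonogenicIn.exists_coordinates {V : Type} [AddCommGroup V] [Module ℂ V] {κ : Type}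
    [Fintype κ] (B : Module.Basis κ ℂ V) (h : IsMonogenicIn V F) :
    (∃ e : F, Submodule.span Atilde {e} = ⊤) ∧
    ∃ (L : Finset Expo) (k : ℕ) (f : ∀ p : L × κ, F →ₗ[Atilde] Expansion p.1.1),
      (∀ x, (∀ p, f p x = 0) → x = 0) ∧ ∀ p x, (logDer p.1.1 ^ k) (f p x) = 0 := by
  obtain ⟨L, N, z, ⟨e⟩⟩ := h
  refine ⟨⟨e.symm ⟨z, Submodule.mem_span_singleton_self z⟩, ?_⟩, ?_⟩
  · refine eq_top_iff.2 fun x _ => ?_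
    obtain ⟨u, hu⟩ := Submodule.mem_span_singleton.1 (e x).2
    refine Submodule.mem_span_singleton.2 ⟨u, ?_⟩
    rw [← map_smul, LinearEquiv.symm_apply_eq]
    exact Subtype.ext hu
  let g : κ → XiLN L N ⊗[ℂ] V →ₗ[Atilde] XiLN L N := fun i =>
    (TensorProduct.AlgebraTensorModule.rid ℂ Atilde (XiLN L N)).toLinearMap ∘ₗ
      TensorProduct.AlgebraTensorModule.lTensor Atilde (XiLN L N) (B.coord i)
  have hg : ∀ w, w = ∑ i, g i w ⊗ₜ[ℂ] B i := by
    intro w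
    induction w using TensorProduct.induction_on with
    | zero => simp
    | tmul y v =>
      have h1 : ∀ i, g i (y ⊗ₜ[ℂ] v) = B.coord i v • y := fun i => rfl
      simp only [h1, TensorProduct.smul_tmul, Module.Basis.coord_apply]
      rw [← TensorProduct.tmul_sum, B.sum_repr]
    | add x y hx hy =>
      simp only [map_add, TensorProduct.add_tmul, Finset.sum_add_distrib]
      rw [← hx, ← hy]
  let f' : ∀ p : L × κ, F →ₗ[Atilde] XiN p.1.1 N := fun p =>
    LinearMap.proj p.1 ∘ₗ g p.2 ∘ₗ (Submodule.span Atilde {z}).subtype ∘ₗ e.toLinearMap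
  refine ⟨L, N + 1, fun p => (XiN p.1.1 N).subtype ∘ₗ f' p, ?_, ?_⟩
  · intro x hx
    have h1 : ∀ i, g i (e x).1 = 0 := fun i => funext fun l' => Subtype.ext (hx (l', i))
    have h2 := hg (e x).1
    simp only [h1, TensorProduct.zero_tmul, Finset.sum_const_zero] at h2
    exact e.map_eq_zero_iff.1 (Subtype.ext h2)
  · intro p x
    exact XiN_le_logFilt N (f' p x).2

lemma IsFresco.exists_coordinates (h : IsFresco F) :
    (∃ e : F, Submodule.span Atilde {e} = ⊤) ∧
    ∃ (n k : ℕ) (L : Fin n → Expo) (f : ∀ i, F →ₗ[Atilde] Expansion (L i)),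
      (∀ x, (∀ i, f i x = 0) → x = 0) ∧ ∀ i x, (logDer (L i) ^ k) (f i x) = 0 := by
  obtain ⟨V, _, _, _, h⟩ := h
  obtain ⟨he, L, k, f, hf, hk⟩ := h.exists_coordinates (Module.finBasis ℂ V)
  let ε := Fintype.equivFin (L × Fin (Module.finrank ℂ V))
  refine ⟨he, _, k, fun i => (ε.symm i).1.1, fun i => f (ε.symm i), fun x hx => hf x fun p => ?_,
    fun i x => hk _ x⟩
  obtain ⟨i, rfl⟩ := ε.symm.surjective p
  exact hx i

/-- A `[λ]`-primitive theme embeds in the expansions with exponent `λ`. -/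
lemma IsTheme.exists_injective (h : IsTheme F) (hp : IsPrimitive l F) :
    ∃ (k : ℕ) (f : F →ₗ[Atilde] Expansion l), Function.Injective f ∧
      ∀ x, (logDer l ^ k) (f x) = 0 := by
  obtain ⟨-, L, k, f, hf, hk⟩ := IsMonogenicIn.exists_coordinates (Module.Basis.singleton Unit ℂ) h
  -- As `V = ℂ`, there is one coordinate for each exponent, and those of exponent other than `λ`
  -- vanish. Hence the one of exponent `λ` is injective, and if `λ` does not occur the module is
  -- zero.
  by_cases hl : l ∈ L
  · refine ⟨k, f (⟨l, hl⟩, ()), ?_, hk (⟨l, hl⟩, ())⟩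
    rw [← LinearMap.ker_eq_bot, LinearMap.ker_eq_bot']
    intro x hx
    refine hf x ?_
    rintro ⟨⟨l', hl'⟩, ⟨⟩⟩
    by_cases h : l' = l
    · subst h; exact hx
    · exact hp.eq_zero_of_ne h _ x
  · refine ⟨0, 0, fun x y _ => ?_, fun x => map_zero _⟩
    have h0 : ∀ x : F, x = 0 := fun x => hf x fun p =>
      hp.eq_zero_of_ne (fun h => hl (by rw [← h]; exact p.1.2)) _ x
    rw [h0 x, h0 y]

end Themes

/-! ## Normal submodules of monogenic modules -/

namespace Atilde

/-- Right multiplication by `b` shifts the coefficients, and `b u` has no coefficient of index `0`.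
This exchange makes the elements with a `b`-power multiple in a submodule stable under the whole
algebra. -/
lemma exists_b_mul_eq (u : Atilde) : ∃ v, b * u = v * b := by
  let v : ℕ → ℂ[X] := fun n => lb (fun m => u.coeff m) (n + 1)
  refine ⟨mk v, ext_coeff fun n => ?_⟩
  have e : (Pi.single 1 1 : ℕ → ℂ[X]) =
      fun n => Polynomial.C ((Pi.single 1 1 : ℕ → ℂ) n) := by
    funext n
    by_cases h : n = 1
    · subst h; simp
    · simp [h]
  have h1 : (mk v * b).coeff n = act la lb v (Pi.single 1 1) n := rfl
  have h2 : (b * u).coeff n = lb (fun m => u.coeff m) n := by rw [b_mul]; rfl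
  rw [h1, h2, act]
  cases n with
  | zero => simp [lb_zero, aeval_la]
  | succ n =>
    rw [Finset.sum_eq_single n]
    · rw [aeval_la, e, lb_pow_const]; simp [v]
    · intro ν hν hn
      have : ν ≤ n + 1 := by
        have := Finset.mem_range.1 hν
        omega
      rw [aeval_la, e, lb_pow_const, if_pos this, Pi.single_eq_of_ne (by omega)]
      simp
    · simp

lemma exists_b_pow_mul_eq (k : ℕ) (u : Atilde) : ∃ v, b ^ k * u = v * b ^ k := by
  induction k with
  | zero => exact ⟨u, by simp⟩
  | succ k ih =>
    obtain ⟨v, hv⟩ := ih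
    obtain ⟨w, hw⟩ := exists_b_mul_eq v
    exact ⟨w, by rw [pow_succ', mul_assoc, hv, ← mul_assoc, hw, mul_assoc]⟩

lemma poly_zero : poly 0 = 0 := Pi.single_zero _

lemma exists_poly_mul_b_eq (p : ℂ[X]) : ∃ v, poly p * b = b * v := by
  obtain ⟨v, hv⟩ := exists_eq_poly_add (poly p * b)
  have h : (poly p * b).coeff 0 = 0 := by
    change act la lb (Pi.single 0 p) (Pi.single 1 1) 0 = 0
    rw [act_single, aeval_la]
    simp
  exact ⟨v, by rw [hv, h, poly_zero, zero_add]⟩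

end Atilde

section NormalSubmodules

open Expansion

variable {E : Type*} [AddCommGroup E] [Module Atilde E]

/-- The elements with a multiple by a power of `b` in `A`. -/
def bSaturation (A : Submodule Atilde E) : Submodule Atilde E where
  carrier := {x | ∃ k : ℕ, Atilde.b ^ k • x ∈ A}
  zero_mem' := ⟨0, by simp⟩
  add_mem' := by
    rintro x y ⟨k, hk⟩ ⟨m, hm⟩
    refine ⟨k + m, ?_⟩
    rw [smul_add]
    refine A.add_mem ?_ ?_
    · rw [add_comm, pow_add, mul_smul]; exact A.smul_mem _ hk
    · rw [pow_add, mul_smul]; exact A.smul_mem _ hm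
  smul_mem' := by
    rintro u x ⟨k, hk⟩
    obtain ⟨v, hv⟩ := Atilde.exists_b_pow_mul_eq k u
    refine ⟨k, ?_⟩
    rw [← mul_smul, hv, mul_smul]
    exact A.smul_mem _ hk

lemma le_bSaturation (A : Submodule Atilde E) : A ≤ bSaturation A :=
  fun x hx => ⟨0, by simpa using hx⟩

lemma mem_bSaturation_of_b_smul {A : Submodule Atilde E} {x : E}
    (h : Atilde.b • x ∈ bSaturation A) : x ∈ bSaturation A := by
  obtain ⟨k, hk⟩ := h
  exact ⟨k + 1, by rwa [pow_succ, mul_smul]⟩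

/-- `b (b⁻¹ a x) = a x` stays in the saturation and so does its quotient by `b`: saturating makes
`A` stable under `b⁻¹ a`. -/
lemma aeval_euler_mem_bSaturation [Module ℂ E] [IsScalarTower ℂ Atilde E] {A : Submodule Atilde E}
    {θ : Module.End ℂ E} (hθ : ∀ x, Atilde.b • θ x = Atilde.a • x) (q : ℂ[X]) {x : E}
    (hx : x ∈ bSaturation A) : Polynomial.aeval θ q x ∈ bSaturation A := by
  induction q using Polynomial.induction_on generalizing x with
  | C c =>
    rw [Polynomial.aeval_C, Module.algebraMap_end_apply, ← algebraMap_smul Atilde c x]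
    exact Submodule.smul_mem _ _ hx
  | add p q hp hq =>
    rw [map_add]
    exact Submodule.add_mem _ (hp hx) (hq hx)
  | monomial k c ih =>
    have e : Polynomial.C c * Polynomial.X ^ (k + 1) =
      (Polynomial.C c * Polynomial.X ^ k) * Polynomial.X := by ring
    rw [e, map_mul, Module.End.mul_apply, Polynomial.aeval_X]
    refine ih (mem_bSaturation_of_b_smul ?_)
    rw [hθ]
    exact Submodule.smul_mem _ _ hx

/-- Normal submodules of monogenic (a,b)-modules are monogenic. -/
lemma exists_span_eq_top_of_isNormal (hE : IsABModule E) {e : E}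
    (he : Submodule.span Atilde {e} = ⊤) {T : Submodule Atilde E} (hT : IsNormal T) :
    ∃ t : T, Submodule.span Atilde {t} = ⊤ := by
  have hb := hE.b_injective
  have hTAB : IsABModule T := hE.of_injective (i := T.subtype) Subtype.val_injective
  -- The polynomials `p` with `p(a) e` in `T + b E` form an ideal; a generator of it, corrected
  -- modulo `b E`, gives the candidate generator `t` of `T`.
  let I : Ideal ℂ[X] :=
    { carrier := {p | ∃ t ∈ T, ∃ z, Atilde.poly p • e = t + Atilde.b • z}
      zero_mem' := ⟨0, T.zero_mem, 0, by
        rw [Atilde.poly_zero, zero_smul, smul_zero, add_zero]⟩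
      add_mem' := by
        rintro p q ⟨t, ht, z, hz⟩ ⟨t', ht', z', hz'⟩
        refine ⟨t + t', T.add_mem ht ht', z + z', ?_⟩
        rw [Atilde.poly_add, add_smul, hz, hz', smul_add]
        abel
      smul_mem' := by
        rintro p q ⟨t, ht, z, hz⟩
        obtain ⟨v, hv⟩ := Atilde.exists_poly_mul_b_eq p
        refine ⟨Atilde.poly p • t, T.smul_mem _ ht, v • z, ?_⟩
        rw [smul_eq_mul, ← Atilde.poly_mul, mul_smul, hz, smul_add, ← mul_smul _ Atilde.b, hv,
          mul_smul] }
  obtain ⟨g, hg⟩ := IsPrincipalIdealRing.principal I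
  obtain ⟨t, ht, z, hz⟩ : g ∈ I := by rw [hg]; exact Submodule.mem_span_singleton_self g
  refine ⟨⟨t, ht⟩, eq_top_of_forall_exists_b_smul hTAB.finite _ ?_⟩
  rintro ⟨y, hy⟩
  obtain ⟨w, hw⟩ := Submodule.mem_span_singleton.1 
    (he ▸ Submodule.mem_top : y ∈ Submodule.span Atilde {e})
  obtain ⟨v, hwv⟩ := Atilde.exists_eq_poly_add w
  generalize w.coeff 0 = p at hwv
  subst hwv
  have hp : p ∈ I := by
    refine ⟨y, hy, -(v • e), ?_⟩
    rw [← hw, add_smul, mul_smul, smul_neg]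
    abel
  rw [hg] at hp
  obtain ⟨h, rfl⟩ := Submodule.mem_span_singleton.1 hp
  have hpe : ∃ z', Atilde.poly (h • g) • e = Atilde.poly h • t + Atilde.b • z' := by
    obtain ⟨v', hv⟩ := Atilde.exists_poly_mul_b_eq h
    refine ⟨v' • z, ?_⟩
    rw [smul_eq_mul, ← Atilde.poly_mul, mul_smul, hz, smul_add, ← mul_smul _ Atilde.b, hv, mul_smul]
  obtain ⟨z', hz'⟩ := hpe
  -- Normality turns a remainder in `T ∩ b E` into one in `b T`, which is the form required by
  -- Nakayama's lemma.
  have hmem : Atilde.b • (z' + v • e) ∈ T := by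
    have : Atilde.b • (z' + v • e) = y - Atilde.poly h • t := by
      rw [← hw, add_smul, hz', mul_smul, smul_add]
      abel
    rw [this]
    exact T.sub_mem hy (T.smul_mem _ ht)
  refine ⟨Atilde.poly h • ⟨t, ht⟩, Submodule.smul_mem _ _ (Submodule.mem_span_singleton_self _),
    ⟨z' + v • e, (isNormal_iff hb T).1 hT _ hmem⟩, Subtype.ext ?_⟩
  change y = Atilde.poly h • t + Atilde.b • (z' + v • e)
  rw [← hw, add_smul, hz', mul_smul, smul_add, add_assoc]

end NormalSubmodules

/-! ## Homogeneous elements and normal sub-themes -/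

section SubThemes

open Expansion

lemma coeff_aeval_logDer {l : Expo} (q : ℂ[X]) (f : Expansion l) (n : ℕ) :
    (Polynomial.aeval (logDer l) q f).coeff n =
      Polynomial.aeval (Polynomial.derivative : Module.End ℂ ℂ[X]) q (f.coeff n) := by
  induction q using Polynomial.induction_on generalizing f with
  | C c => simp only [Polynomial.aeval_C, Module.algebraMap_end_apply, coeff_smul]
  | add p q hp hq => simp [hp, hq]
  | monomial k c ih =>
    have e : Polynomial.C c * Polynomial.X ^ (k + 1) =
      (Polynomial.C c * Polynomial.X ^ k) * Polynomial.X := by ring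
    rw [e]
    generalize Polynomial.C c * Polynomial.X ^ k = r at ih
    rw [map_mul, Module.End.mul_apply, Polynomial.aeval_X, ih, map_mul, Module.End.mul_apply,
      Polynomial.aeval_X, coeff_logDer]

/-- The expansion `s ^ (λ - 1 + p) c(Log s)`. -/
def homogeneous (l : Expo) (p : ℕ) (c : ℂ[X]) : Expansion l := mk fun n => if n = p then c else 0

/-- A polynomial of degree exactly `d` yields all those of degree at most `d` by differential
operators with constant coefficients. Polynomials in `D` are linear over the algebra, so
annihilators are inherited. -/
lemma smul_homogeneous_eq_zero {l l' : Expo} (hl : l' = l) {p d : ℕ} {c c' : ℂ[X]}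
    (hc : (Polynomial.derivative ^ d : Module.End ℂ ℂ[X]) c ≠ 0)
    (hc1 : (Polynomial.derivative ^ (d + 1) : Module.End ℂ ℂ[X]) c = 0)
    (hc2 : (Polynomial.derivative ^ (d + 1) : Module.End ℂ ℂ[X]) c' = 0) {u : Atilde}
    (h : u • homogeneous l p c = 0) : u • homogeneous l' p c' = 0 := by
  subst hl
  obtain ⟨q, rfl⟩ := exists_aeval_derivative_eq hc hc1 le_rfl hc2
  have e : homogeneous l' p (Polynomial.aeval (Polynomial.derivative : Module.End ℂ ℂ[X]) q c) =
      Polynomial.aeval (logDer l') q (homogeneous l' p c) := by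
    refine ext_coeff fun n => ?_
    rw [coeff_aeval_logDer]
    by_cases hn : n = p <;> simp [homogeneous, hn]
  rw [e, ← map_smul, h, map_zero]

/-- For every finite set of exponents there is a polynomial in `b⁻¹ a` which approximates the
projection to the component of exponent `μ`. -/
lemma exists_projection_polynomial (μ : ℂ) (d : ℕ) (Λ : Finset ℂ) : ∃ q r : ℂ[X],
    q = 1 - r * (Polynomial.X - Polynomial.C μ) ^ d ∧
    ∀ ν ∈ Λ, ν ≠ μ → (Polynomial.X - Polynomial.C ν) ^ d ∣ q := by
  classical
  have h : IsCoprime ((Polynomial.X - Polynomial.C μ) ^ d)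
      (∏ ν ∈ Λ.erase μ, (Polynomial.X - Polynomial.C ν) ^ d) := by
    refine IsCoprime.prod_right fun ν hν => IsCoprime.pow ?_
    exact Polynomial.isCoprime_X_sub_C_of_isUnit_sub
      (isUnit_iff_ne_zero.2 (sub_ne_zero.2 (Finset.ne_of_mem_erase hν).symm))
  obtain ⟨r, s, hrs⟩ := h
  refine ⟨s * ∏ ν ∈ Λ.erase μ, (Polynomial.X - Polynomial.C ν) ^ d, r, ?_, fun ν hν hνμ => ?_⟩
  · rw [← hrs]; ring
  · exact (Finset.dvd_prod_of_mem (fun ν => (Polynomial.X - Polynomial.C ν : ℂ[X]) ^ d)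
      (Finset.mem_erase.2 ⟨hνμ, hν⟩)).mul_left s

variable {E : Type*} [AddCommGroup E] [Module Atilde E]

/-- `q` is `1` modulo `(X - λ₀ - p) ^ d` and divisible by `(X - λ - m) ^ d` at any other exponent
considered. Hence `q(b⁻¹ a)` is the identity on the coefficient of exponent `λ₀ + p` and zero on the
others. -/
lemma coeff_sub_aeval_euler_eq_zero {l l₀ : Expo} {d m p : ℕ} {g : Expansion l}
    (hg : (Polynomial.derivative ^ d : Module.End ℂ ℂ[X]) (g.coeff m) = 0) {q r : ℂ[X]}
    (hq : q = 1 - r * (Polynomial.X - Polynomial.C (((l₀.1 : ℚ) : ℂ) + p)) ^ d)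
    (hq' : ((l.1 : ℚ) : ℂ) + m ≠ ((l₀.1 : ℚ) : ℂ) + p →
      (Polynomial.X - Polynomial.C (((l.1 : ℚ) : ℂ) + m)) ^ d ∣ q) :
    (if l = l₀ then homogeneous l p (g.coeff p) else 0).coeff m -
      (Polynomial.aeval (euler l) q g).coeff m = 0 := by
  rw [coeff_aeval_euler]
  by_cases hc : ((l.1 : ℚ) : ℂ) + m = ((l₀.1 : ℚ) : ℂ) + p
  · have hL : l = l₀ := by
      refine expo_eq_of_sub_eq_int (m := p - m) ?_
      push_cast
      linear_combination hc
    subst hL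
    have hmp : m = p := by exact_mod_cast add_left_cancel hc
    subst hmp
    rw [if_pos rfl, hq, Polynomial.sub_comp, Polynomial.mul_comp, Polynomial.pow_comp,
      Polynomial.sub_comp, Polynomial.X_comp, Polynomial.C_comp, Polynomial.one_comp,
      add_sub_cancel_right, map_sub, map_one, map_mul, map_pow, Polynomial.aeval_X,
      LinearMap.sub_apply, Module.End.mul_apply, hg, map_zero, sub_zero,
      Module.End.one_apply]
    simp [homogeneous]
  · obtain ⟨w, hw⟩ := hq' hc
    rw [hw, mul_comm, Polynomial.mul_comp, Polynomial.pow_comp, Polynomial.sub_comp,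
      Polynomial.X_comp, Polynomial.C_comp, add_sub_cancel_right, map_mul,
      Module.End.mul_apply, map_pow, Polynomial.aeval_X, hg, map_zero, sub_zero]
    split_ifs with hL
    · have hmp : m ≠ p := by
        rintro rfl
        exact hc (by rw [hL])
      simp [homogeneous, hmp]
    · exact coeff_zero m

lemma homogeneous_mem_logFilt {l : Expo} {d p : ℕ} {c : ℂ[X]}
    (hc : (Polynomial.derivative ^ d : Module.End ℂ ℂ[X]) c = 0) :
    homogeneous l p c ∈ logFilt l d := by
  rw [mem_logFilt_iff_coeff]
  intro m
  by_cases hm : m = p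
  · simpa [homogeneous, hm] using hc
  · simp [homogeneous, hm]

/-- The homogeneous components of an element belong to the module, up to a power of `b`. -/
lemma exists_homogeneous {n d : ℕ} {L : Fin n → Expo} {f : ∀ i, E →ₗ[Atilde] Expansion (L i)}
    (hd : ∀ i x, (logDer (L i) ^ d) (f i x) = 0) (x : E) (i₀ : Fin n) (p : ℕ) :
    ∃ (x' : E) (k : ℕ), ∀ i, f i x' = Atilde.b ^ k •
      (if L i = L i₀ then homogeneous (L i) p ((f i x).coeff p) else 0) := by
  obtain ⟨Φ, hΦ⟩ : ∃ Φ : E →ₗ[Atilde] (∀ i, logFilt (L i) d), ∀ x i, (Φ x i).1 = f i x :=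
    ⟨LinearMap.pi fun i => (f i).codRestrict (logFilt (L i) d) (hd i), fun _ _ => rfl⟩
  have hP : IsABModule (∀ i, logFilt (L i) d) := IsABModule.pi fun i => isABModule_logFilt (L i) d
  have hs : HasSimplePole (∀ i, logFilt (L i) d) := by
    intro x
    choose y hy using fun i => hasSimplePole_logFilt (L i) d (x i)
    exact ⟨y, funext hy⟩
  obtain ⟨θ, hθ⟩ := exists_euler hP.b_injective hs
  obtain ⟨y, hy⟩ : ∃ y : ∀ i, logFilt (L i) d, ∀ i, (y i).1 =
      if L i = L i₀ then homogeneous (L i) p ((f i x).coeff p) else 0 := by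
    refine ⟨fun i => ⟨if L i = L i₀ then homogeneous (L i) p ((f i x).coeff p) else 0, ?_⟩,
      fun i => rfl⟩
    split_ifs
    · exact homogeneous_mem_logFilt (mem_logFilt_iff_coeff.1 (hd i x) p)
    · exact Submodule.zero_mem _
  -- The image of `E` need not be stable under `b⁻¹ a`, but its `b`-saturation is, and it is closed.
  -- The homogeneous component is a limit of elements `q(b⁻¹ a) Φ(x)`, with `q` adapted to the
  -- exponents below order `N`.
  have hmem : y ∈ bSaturation (LinearMap.range Φ) := by
    refine mem_of_forall_exists_b_pow hP _ y fun N => ?_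
    obtain ⟨q, r, hq, hq'⟩ := exists_projection_polynomial ((((L i₀).1 : ℚ) : ℂ) + p) d
      ((Finset.univ ×ˢ Finset.range N).image fun z : Fin n × ℕ => (((L z.1).1 : ℚ) : ℂ) + z.2)
    refine ⟨Polynomial.aeval θ q (Φ x),
      aeval_euler_mem_bSaturation hθ q (le_bSaturation _ ⟨x, rfl⟩), ?_⟩
    have h1 : ∀ i, (Polynomial.aeval θ q (Φ x) i).1 =
        Polynomial.aeval (euler (L i)) q (f i x) := by
      intro i
      rw [← hΦ]
      exact euler_comm b_smul_injective hθ b_smul_euler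
        ((logFilt (L i) d).subtype ∘ₗ LinearMap.proj i) q (Φ x)
    generalize Polynomial.aeval θ q (Φ x) = z at h1
    have key : ∀ i, ∃ w : logFilt (L i) d, y i = z i + Atilde.b ^ N • w := by
      intro i
      obtain ⟨g, hg, hg'⟩ := exists_mem_logFilt_eq_b_pow_smul N
        ((logFilt (L i) d).sub_mem (y i).2 (z i).2) (by
          intro m hm
          rw [coeff_sub, hy, h1]
          exact coeff_sub_aeval_euler_eq_zero (mem_logFilt_iff_coeff.1 (hd i x) m) hq
            (hq' _ (Finset.mem_image.2 ⟨(i, m), Finset.mem_product.2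
              ⟨Finset.mem_univ i, Finset.mem_range.2 hm⟩, rfl⟩)))
      exact ⟨⟨g, hg⟩, Subtype.ext (sub_eq_iff_eq_add'.1 hg')⟩
    choose w hw using key
    exact ⟨w, funext hw⟩
  obtain ⟨k, x', hx'⟩ := hmem
  refine ⟨x', k, fun i => ?_⟩
  rw [← hΦ, hx', ← hy]
  rfl

lemma isABModule_of_jointly_injective {n k : ℕ} {L : Fin n → Expo}
    {f : ∀ i, E →ₗ[Atilde] Expansion (L i)} (hf : ∀ x, (∀ i, f i x = 0) → x = 0)
    (hk : ∀ i x, (logDer (L i) ^ k) (f i x) = 0) : IsABModule E := by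
  refine (IsABModule.pi fun i => isABModule_logFilt (L i) k).of_injective
    (i := LinearMap.pi fun i => (f i).codRestrict (logFilt (L i) k) (hk i)) ?_
  rw [← LinearMap.ker_eq_bot, LinearMap.ker_eq_bot']
  intro x hx
  exact hf x fun i => congrArg Subtype.val (congrFun hx i)

/-- A normal sub-theme of maximal rank. -/
lemma exists_normal_subtheme {n d : ℕ} {L : Fin n → Expo} {f : ∀ i, E →ₗ[Atilde] Expansion (L i)}
    {e : E} (he : Submodule.span Atilde {e} = ⊤) (hf : ∀ x, (∀ i, f i x = 0) → x = 0)
    (hd : ∀ i x, (logDer (L i) ^ (d + 1)) (f i x) = 0) {i₀ : Fin n} {x : E}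
    (hx : (logDer (L i₀) ^ d) (f i₀ x) ≠ 0) : ∃ T : Submodule Atilde E,
      IsNormal T ∧ IsTheme T ∧ IsPrimitive (L i₀) T ∧ rank T = d + 1 := by
  have hE := isABModule_of_jointly_injective hf hd
  have hb := hE.b_injective
  obtain ⟨p, hp⟩ : ∃ p, (Polynomial.derivative ^ d : Module.End ℂ ℂ[X]) ((f i₀ x).coeff p) ≠ 0 := by
    by_contra! h
    exact hx (mem_logFilt_iff_coeff.2 h)
  obtain ⟨x', k, hx'⟩ := exists_homogeneous hd x i₀ p
  have hd' : ∀ i, (Polynomial.derivative ^ (d + 1) : Module.End ℂ ℂ[X]) ((f i x).coeff p) = 0 :=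
    fun i => mem_logFilt_iff_coeff.1 (hd i x) p
  have h₀ := hx' i₀
  rw [if_pos rfl] at h₀
  -- All nonzero coordinates of `x'` have the same exponent, and the polynomial in the coordinate
  -- `i₀` has the highest possible degree `d`. So this coordinate controls the annihilator of `x'`.
  have hu : ∀ u : Atilde, f i₀ (u • x') = 0 → u • x' = 0 := by
    intro u hu
    refine hf _ fun i => ?_
    rw [map_smul, h₀, ← mul_smul] at hu
    rw [map_smul, hx', ← mul_smul]
    split_ifs with hL
    · exact smul_homogeneous_eq_zero hL hp (hd' i₀) (hd' i) hu
    · exact smul_zero _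
  have hdx : (logDer (L i₀) ^ d) (f i₀ x') ≠ 0 := by
    intro h
    rw [h₀, map_smul] at h
    have h1 := mem_logFilt_iff_coeff.1 (eq_zero_of_b_pow_smul b_smul_injective h) p
    exact hp (by simpa [homogeneous] using h1)
  -- Saturation gives normality and preserves the injectivity of `f i₀`, as `E` has no `b`-torsion;
  -- it may destroy the generator `x'`, and another one comes from `exists_span_eq_top_of_isNormal`.
  let T := bSaturation (Submodule.span Atilde {x'})
  have hT : IsNormal T := (isNormal_iff hb T).2 fun y hy => mem_bSaturation_of_b_smul hy
  have hinj : Function.Injective (f i₀ ∘ₗ T.subtype) := by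
    rw [← LinearMap.ker_eq_bot, LinearMap.ker_eq_bot']
    rintro ⟨z, m, hm⟩ hz
    obtain ⟨u, hu'⟩ := Submodule.mem_span_singleton.1 hm
    have hz' : f i₀ z = 0 := hz
    refine Subtype.ext (eq_zero_of_b_pow_smul hb (k := m) ?_)
    change Atilde.b ^ m • z = 0
    rw [← hu']
    exact hu u (by rw [hu', map_smul, hz', smul_zero])
  obtain ⟨t, ht⟩ := exists_span_eq_top_of_isNormal hE he hT
  exact ⟨T, hT, isTheme_of_injective ht hinj (fun z => hd i₀ z.1),
    isPrimitive_of_injective hinj (fun z => hd i₀ z.1),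
    rank_eq_of_logDer hinj (fun z => hd i₀ z.1)
      (Or.inr ⟨⟨x', le_bSaturation _ (Submodule.mem_span_singleton_self x')⟩, hdx⟩)⟩

/-- The quotient by the kernel of a morphism to expansions is a theme. -/
lemma quotient_ker_isTheme {l : Expo} {d : ℕ} {e : E} (he : Submodule.span Atilde {e} = ⊤)
    {φ : E →ₗ[Atilde] Expansion l} (hd : ∀ x, (logDer l ^ d) (φ x) = 0)
    (hd' : d = 0 ∨ ∃ x, (logDer l ^ (d - 1)) (φ x) ≠ 0) :
    IsTheme (E ⧸ LinearMap.ker φ) ∧ IsPrimitive l (E ⧸ LinearMap.ker φ) ∧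
      rank (E ⧸ LinearMap.ker φ) = d := by
  have hinj : Function.Injective ((LinearMap.ker φ).liftQ φ le_rfl) :=
    LinearMap.ker_eq_bot.1 (Submodule.ker_liftQ_eq_bot' _ _ rfl)
  have h1 : ∀ x, (logDer l ^ d) ((LinearMap.ker φ).liftQ φ le_rfl x) = 0 := by
    intro x
    obtain ⟨x, rfl⟩ := (LinearMap.ker φ).mkQ_surjective x
    exact hd x
  have h2 : Submodule.span Atilde {(LinearMap.ker φ).mkQ e} = ⊤ := by
    rw [← Set.image_singleton, ← Submodule.map_span, he, Submodule.map_top, Submodule.range_mkQ]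
  refine ⟨isTheme_of_injective h2 hinj h1, isPrimitive_of_injective hinj h1,
    rank_eq_of_logDer hinj h1 (hd'.imp_right ?_)⟩
  rintro ⟨x, hx⟩
  exact ⟨(LinearMap.ker φ).mkQ x, hx⟩

lemma mem_Xi_iff {l : Expo} {x : Expansion l} : x ∈ Xi l ↔ ∃ N, x ∈ XiN l N := by
  refine Submodule.mem_iSup_of_directed _ (Monotone.directed_le fun N M h f hf n => ?_)
  exact (hf n).trans h

/-- The image of the generator lies in some `Ξ_λ^{(N)}`, and this bounds the logarithms of the whole
image. -/
lemma exists_logDer_pow_eq_zero {l : Expo} {e : E} (he : Submodule.span Atilde {e} = ⊤)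
    (φ : E →ₗ[Atilde] Xi l) : ∃ k, ∀ x, (logDer l ^ k) (φ x : Expansion l) = 0 := by
  obtain ⟨N, hN⟩ := mem_Xi_iff.1 (φ e).2
  refine ⟨N + 1, fun x => ?_⟩
  obtain ⟨u, rfl⟩ := Submodule.mem_span_singleton.1
    (he ▸ Submodule.mem_top : x ∈ Submodule.span Atilde {e})
  have h : ((φ (u • e) : Xi l) : Expansion l) = u • (φ e : Expansion l) := by
    rw [map_smul]; rfl
  rw [h, map_smul, XiN_le_logFilt N hN, smul_zero]

end SubThemes

/-- Morphisms from a module of expansions in `Ξ_λ` do not raise the powers of `Log s`. -/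
lemma logDer_pow_eq_zero_of_injective {M : Type*} [AddCommGroup M] [Module Atilde M] {l : Expo}
    {j : ℕ} {g : M →ₗ[Atilde] Expansion l} (hg : Function.Injective g)
    (hj : ∀ x, (Expansion.logDer l ^ j) (g x) = 0) {l' : Expo} (φ : M →ₗ[Atilde] Expansion l')
    (x : M) : (Expansion.logDer l' ^ j) (φ x) = 0 :=
  logDer_pow_eq_zero_of_jointly_injective (n := 1) (L := fun _ => l) (f := fun _ => g)
    (fun x hx => hg (by rw [hx 0, map_zero])) (fun _ => hj) φ x

/-- Morphisms from `S_j(E)` to expansions involve only powers of `Log s` smaller than `j`. -/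
lemma logDer_pow_eq_zero_of_mem_ssFilt {E : Type*} [AddCommGroup E] [Module Atilde E]
    {n : ℕ} {L : Fin n → Expo} {f : ∀ i, E →ₗ[Atilde] Expansion (L i)}
    (hf : ∀ x, (∀ i, f i x = 0) → x = 0) {j : ℕ} {l : Expo}
    (φ : ssFilt E j →ₗ[Atilde] Expansion l) (x : ssFilt E j) :
    (Expansion.logDer l ^ j) (φ x) = 0 :=
  logDer_pow_eq_zero_of_jointly_injective (f := fun i => f i ∘ₗ (ssFilt E j).subtype)
    (fun z hz => Subtype.ext (hf z.1 hz)) (fun i z => (mem_ssFilt_iff hf j z.1).1 z.2 i) φ x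

/-- The image of a monogenic module in `Ξ_λ` is a `[λ]`-primitive theme, and its normal submodule of
rank `j` consists of the expansions with powers of `Log s` smaller than `j`. -/
lemma range_isTheme {E : Type*} [AddCommGroup E] [Module Atilde E] {e : E}
    (he : Submodule.span Atilde {e} = ⊤) (j : ℕ) {l : Expo} (φ : E →ₗ[Atilde] Xi l) :
    IsTheme (LinearMap.range φ) ∧ IsPrimitive l (LinearMap.range φ) ∧
      (∃! F : Submodule Atilde (LinearMap.range φ), IsNormalTerm (LinearMap.range φ) j F) ∧
      ∀ x, x ∈ (normalTerm (LinearMap.range φ) j).comap φ.rangeRestrict ↔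
        (Expansion.logDer l ^ j) (φ x : Expansion l) = 0 := by
  obtain ⟨k, hk⟩ := exists_logDer_pow_eq_zero he φ
  let g : LinearMap.range φ →ₗ[Atilde] Expansion l :=
    (Xi l).subtype ∘ₗ (LinearMap.range φ).subtype
  have hg : Function.Injective g := Subtype.val_injective.comp Subtype.val_injective
  have hgk : ∀ y, (Expansion.logDer l ^ k) (g y) = 0 := by
    rintro ⟨_, x, rfl⟩
    exact hk x
  have hspan : Submodule.span Atilde {φ.rangeRestrict e} = ⊤ := by
    rw [← Set.image_singleton, ← Submodule.map_span, he, Submodule.map_top,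
      LinearMap.range_rangeRestrict]
  refine ⟨isTheme_of_injective hspan hg hgk, isPrimitive_of_injective hg hgk,
    ⟨_, (isNormalTerm_iff hg hgk j _).2 rfl, fun F hF => (isNormalTerm_iff hg hgk j F).1 hF⟩,
    fun x => ?_⟩
  rw [normalTerm_eq hg hgk j]
  rfl

/-- Expansions with bounded powers of `Log s` belong to `Ξ_λ`. -/
lemma mem_Xi_of_logDer {l : Expo} {k : ℕ} {x : Expansion l}
    (hx : (Expansion.logDer l ^ k) x = 0) : x ∈ Xi l :=
  mem_Xi_iff.2 ⟨k, logFilt_le_XiN k hx⟩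

end FrescoTheory

end

/-! ### The semi-simple filtration and depth of a fresco in terms of themes -/

open FrescoTheory in
theorem proposition2p3p2 {E : Type*} [AddCommGroup E] [Module FrescoTheory.Atilde E]
    (hE : FrescoTheory.IsFresco E) :
    -- sub-themes of rank `j` lie in `S_j(E)`
    (∀ (j : ℕ) (l : FrescoTheory.Expo) (T : Submodule FrescoTheory.Atilde E),
      FrescoTheory.IsTheme T → FrescoTheory.IsPrimitive l T → FrescoTheory.rank T = j →
        T ≤ FrescoTheory.ssFilt E j) ∧
    -- quotient themes of `S_j(E)` have rank at most `j`
    (∀ (j : ℕ) (l : FrescoTheory.Expo)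
      (K : Submodule FrescoTheory.Atilde (FrescoTheory.ssFilt E j)),
      FrescoTheory.IsTheme (FrescoTheory.ssFilt E j ⧸ K) →
      FrescoTheory.IsPrimitive l (FrescoTheory.ssFilt E j ⧸ K) →
        FrescoTheory.rank (FrescoTheory.ssFilt E j ⧸ K) ≤ j) ∧
    -- `S_j(E)` as an intersection; the submodules `F_j(φ)` of the themes `φ(E)` are well defined
    (∀ (j : ℕ),
      (∀ (l : FrescoTheory.Expo) (φ : E →ₗ[FrescoTheory.Atilde] FrescoTheory.Xi l),
        FrescoTheory.IsTheme (LinearMap.range φ) ∧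
        FrescoTheory.IsPrimitive l (LinearMap.range φ) ∧
        ∃! F : Submodule FrescoTheory.Atilde (LinearMap.range φ),
          FrescoTheory.IsNormalTerm (LinearMap.range φ) j F) ∧
      FrescoTheory.ssFilt E j =
        ⨅ (l : FrescoTheory.Expo) (φ : E →ₗ[FrescoTheory.Atilde] FrescoTheory.Xi l),
          (FrescoTheory.normalTerm (LinearMap.range φ) j).comap φ.rangeRestrict) ∧
    -- the semi-simple depth is well defined
    FrescoTheory.ssFilt E (FrescoTheory.ssDepth E) = ⊤ ∧
    -- it is the maximal rank of a quotient theme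
    (∀ d : ℕ, FrescoTheory.ssDepth E = d ↔
      IsGreatest {r : ℕ | ∃ (l : FrescoTheory.Expo) (K : Submodule FrescoTheory.Atilde E),
        FrescoTheory.IsTheme (E ⧸ K) ∧ FrescoTheory.IsPrimitive l (E ⧸ K) ∧
          FrescoTheory.rank (E ⧸ K) = r} d) ∧
    -- it is the maximal rank of a normal sub-theme
    (∀ d : ℕ, FrescoTheory.ssDepth E = d ↔
      IsGreatest {r : ℕ | ∃ (l : FrescoTheory.Expo) (T : Submodule FrescoTheory.Atilde E),
        FrescoTheory.IsNormal T ∧ FrescoTheory.IsTheme T ∧ FrescoTheory.IsPrimitive l T ∧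
          FrescoTheory.rank T = r} d) := by
  obtain ⟨⟨e, he⟩, n, k, L, f, hf, hk⟩ := hE.exists_coordinates
  have hss := fun j x => mem_ssFilt_iff hf j x
  have hdepth : ssFilt E (ssDepth E) = ⊤ :=
    Nat.sInf_mem (s := {d : ℕ | ssFilt E d = ⊤})
      ⟨k, eq_top_iff.2 fun x _ => (hss k x).2 fun i => hk i x⟩
  have hd : ∀ i x, (Expansion.logDer (L i) ^ ssDepth E) (f i x) = 0 := fun i x =>
    (hss _ x).1 (hdepth ▸ Submodule.mem_top) i
  -- The minimality of the depth, seen on coordinates: the next lower power of `D` does not kill all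
  -- of them.
  have hexists : ∀ d, ssDepth E = d + 1 →
      ∃ i x, (Expansion.logDer (L i) ^ d) (f i x) ≠ 0 := by
    intro d hd1
    by_contra! h
    have h1 : ssFilt E d = ⊤ := eq_top_iff.2 fun x _ => (hss d x).2 fun i => h i x
    exact Nat.notMem_of_lt_sInf (s := {d : ℕ | ssFilt E d = ⊤}) (show d < ssDepth E by omega) h1
  refine ⟨?_, ?_, ?_, hdepth, ?_, ?_⟩
  · intro j l T hT hP hr x hx
    obtain ⟨m, g, hg, hm⟩ := hT.exists_injective hP
    exact (hss j x).2 fun i => logDer_pow_eq_zero_of_injective hg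
      ((rank_le_iff hg hm j).1 hr.le) (f i ∘ₗ T.subtype) ⟨x, hx⟩
  · intro j l K hT hP
    obtain ⟨m, g, hg, hm⟩ := hT.exists_injective hP
    refine (rank_le_iff hg hm j).2 fun y => ?_
    obtain ⟨y, rfl⟩ := K.mkQ_surjective y
    exact logDer_pow_eq_zero_of_mem_ssFilt hf (g ∘ₗ K.mkQ) y
  · intro j
    refine ⟨fun l φ => ?_, le_antisymm ?_ ?_⟩
    · obtain ⟨h1, h2, h3, -⟩ := range_isTheme he j φ
      exact ⟨h1, h2, h3⟩
    · refine le_iInf fun l => le_iInf fun φ => fun x hx => ?_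
      refine ((range_isTheme he j φ).2.2.2 x).2 ?_
      exact logDer_pow_eq_zero_of_mem_ssFilt hf ((Xi l).subtype ∘ₗ φ ∘ₗ (ssFilt E j).subtype)
        ⟨x, hx⟩
    · intro x hx
      refine (hss j x).2 fun i => ?_
      -- The coordinates `f i` themselves take values in `Ξ_λ` and already cut out `S_j(E)`.
      have h1 := (Submodule.mem_iInf _).1 ((Submodule.mem_iInf _).1 hx (L i))
        ((f i).codRestrict (Xi (L i)) fun x => mem_Xi_of_logDer (hk i x))
      exact ((range_isTheme he j _).2.2.2 x).1 h1
  · have hmax : IsGreatest {r : ℕ | ∃ (l : Expo) (K : Submodule Atilde E),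
        IsTheme (E ⧸ K) ∧ IsPrimitive l (E ⧸ K) ∧ rank (E ⧸ K) = r} (ssDepth E) := by
      refine ⟨?_, ?_⟩
      · rcases hcase : ssDepth E with _ | d
        -- In depth zero the zero module is the required theme, and it is primitive for any
        -- exponent; `1` is an arbitrary choice.
        · exact ⟨⟨1, by norm_num⟩, LinearMap.ker (0 : E →ₗ[Atilde] Expansion ⟨1, by norm_num⟩),
            quotient_ker_isTheme he (fun x => map_zero _) (Or.inl rfl)⟩
        · obtain ⟨i, x, hx⟩ := hexists d hcase
          exact ⟨L i, LinearMap.ker (f i),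
            quotient_ker_isTheme he (fun x => hcase ▸ hd i x) (Or.inr ⟨x, hx⟩)⟩
      · rintro r ⟨l, K, hT, hP, rfl⟩
        obtain ⟨m, g, hg, hm⟩ := hT.exists_injective hP
        -- Composed with the projection, the embedding of a quotient theme is a morphism on `E`, so
        -- its logarithms are bounded by the depth.
        refine (rank_le_iff hg hm _).2 fun y => ?_
        obtain ⟨y, rfl⟩ := K.mkQ_surjective y
        exact logDer_pow_eq_zero_of_jointly_injective hf hd (g ∘ₗ K.mkQ) y
    exact fun d => ⟨fun h => h ▸ hmax, fun h => hmax.unique h⟩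
  · have hmax : IsGreatest {r : ℕ | ∃ (l : Expo) (T : Submodule Atilde E),
        IsNormal T ∧ IsTheme T ∧ IsPrimitive l T ∧ rank T = r} (ssDepth E) := by
      refine ⟨?_, ?_⟩
      · rcases hcase : ssDepth E with _ | d
        · have h0 : ∀ x : E, x = 0 := fun x => hf x fun i => by
            have := hd i x
            rwa [hcase, pow_zero] at this
          have hinj : Function.Injective
              (0 : (⊤ : Submodule Atilde E) →ₗ[Atilde] Expansion ⟨1, by norm_num⟩) :=
            fun x y _ => Subtype.ext (by rw [h0 x.1, h0 y.1])
          refine ⟨⟨1, by norm_num⟩, ⊤, ?_, isTheme_of_injective (e := 0) ?_ (k := 0) hinj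
            (fun x => rfl), isPrimitive_of_injective (k := 0) hinj (fun x => rfl),
            rank_eq_zero_of_forall fun x => Subtype.ext (h0 x.1)⟩
          · exact (isNormal_iff (fun x y _ => by rw [h0 x, h0 y]) _).2 fun y _ => trivial
          · refine eq_top_iff.2 fun x _ => ?_
            have : x = 0 := Subtype.ext (h0 x.1)
            rw [this]
            exact Submodule.zero_mem _
        · obtain ⟨i, x, hx⟩ := hexists d hcase
          obtain ⟨T, h⟩ := exists_normal_subtheme he hf (fun i x => hcase ▸ hd i x) hx
          exact ⟨L i, T, h⟩
      · rintro r ⟨l, T, -, hT, hP, rfl⟩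
        obtain ⟨m, g, hg, hm⟩ := hT.exists_injective hP
        refine (rank_le_iff hg hm _).2 fun y => ?_
        -- The coordinates restricted to `T` remain jointly injective and bound the logarithms of
        -- any embedding of `T`; normality plays no role in this upper bound.
        exact logDer_pow_eq_zero_of_jointly_injective (f := fun i => f i ∘ₗ T.subtype)
          (fun z hz => Subtype.ext (hf z.1 hz)) (fun i z => hd i z.1) g y
    exact fun d => ⟨fun h => h ▸ hmax, fun h => hmax.unique h⟩
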